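/- Let $\mathbb K=\mathbb R$ or $\mathbb C$, let $N\ge -1$ be an integer and let $D_i\in\mathbb K$ ($1\le i\le N+1$) be arbitrary. **Setting.** Let $V$ be the super vector space with even basis $x^1,x^2,\dots$ and odd basis $\theta^1,\theta^2,\dots$, with dual sets $y_1,y_2,\dots$ and $\eta_1,\eta_2,\dots$ in $V^*$, and let $\widetilde V=V\oplus\mathbb K\theta^0$ with one extra odd basis vector $\theta^0$. Let $\mathbb K[[\widetilde V,\hbar]]$ be the completion of the super polynomial algebra $\mathbb K[\widetilde V,\hbar]$ in powers of the ideal of elements without constant term. Let $\mathcal W_\hbar(\widetilde V)$ be the space of finite sums of operators $\hbar^{m+k}x^{i_1}\cdots x^{i_n}c_{i_1\dots i_n}^{j_1\dots j_m}\partial_{j_1}\cdots\partial_{j_m}$ ($k\ge 0$; here $x$ stands for all basis variables; for each $(j_1,\dots,j_m)$ finitely many nonzero coefficients), graded by $n+m+2k$, and let $\widehat{\mathcal W}_\hbar(\widetilde V)$ be its completion for pointwise convergence on $\mathbb K[[\widetilde V,\hbar]]$. A *super quantum Airy structure* is an even, continuous linear map $L:V^*\to\widehat{\mathcal W}_\hbar(\widetilde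 V)$ ($V^*$ with the topology of pointwise convergence, $\mathbb K$ discrete) such that (1) the left ideal $\mathfrak L\subseteq\widehat{\mathcal W}_\hbar(\widetilde V)$ generated by $L(V^*)$ satisfies $[\mathfrak L,\mathfrak L]\subseteq\hbar\,\mathfrak L$ for the super-commutator, and (2) for every element of the dual set, the part of degree $\le 1$ of $L(y_i)$ is $\hbar\,\partial/\partial x^i$ and that of $L(\eta_j)$ is $\hbar\,\partial/\partial\theta^j$. **Modes.** For $r\in\mathbb Z_{\ge0}+\frac12$ and $m\in\mathbb Z_{\ge1}$ put $$b_r=\sqrt\hbar\,\tfrac{\partial}{\partial x^{r+1/2}},\quad b_{-r}=\tfrac{r}{\sqrt\hbar}\,x^{r+1/2},\quad \psi_m=\sqrt\hbar\,\tfrac{\partial}{\partial\theta^m},\quad \psi_{-m}=\tfrac1{\sqrt\hbar}\,\theta^m,\quad \psi_0=\tfrac1{\sqrt{2\hbar}}\Big(\theta^0+\hbar\tfrac{\partial}{\partial\theta^0}\Big).$$ They satisfy $[b_r,b_s]=r\,\delta_{r,-s}$, $\{\psi_m,\psi_n\}=\delta_{m,-n}$, $[b_r,\psi_n]=0$. Let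 $:\,:$ be normal ordering: positive bosonic modes are moved to the right, and $:\psi_r\psi_s:$ equals $\psi_r\psi_s$ if $r\le s$ and $-\psi_s\psi_r$ if $r>s$. **Statement.** For integers $i\ge1$ and $r\in\mathbb Z_{\ge0}+\frac12$ let $$H_i=\hbar\frac{\partial}{\partial x^i}+\frac\hbar2\sum_{s\in\mathbb Z+\frac12}:b_s b_{i+N-1-s}:+\frac\hbar2\sum_{j\in\mathbb Z}\Big(j+\frac{i+N-1}2\Big):\psi_{-j}\psi_{i+N-1+j}:+\frac\hbar8\,\delta_{i,1-N}+\hbar D_i\,\delta_{i\le N+1},$$ $$F_r=\hbar\frac{\partial}{\partial\theta^{r+1/2}}+\hbar\sum_{s\in\mathbb Z+\frac12}b_s\,\psi_{r+N-s}.$$ All these sums converge pointwise. There is exactly one continuous linear map $H:V^*\to\widehat{\mathcal W}_\hbar(\widetilde V)$ with $H(y_i)=H_i$ and $H(\eta_{r+1/2})=F_r$ for all $i,r$, and $H$ is a super quantum Airy structure. For all integers $m,n\ge1$ and $r,s\in\mathbb Z_{\ge0}+\frac12$, $$[H_m,H_n]=\hbar(m-n)H_{m+n+N-1},\quad [H_m,F_r]=\hbar\Big(\frac{m-N-1}2-r\Big)F_{m+r+N-1},\quad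 \{F_r,F_s\}=2\hbar H_{r+s+N+1}$$ (a right-hand side with coefficient $0$ is read as $0$). Consequently $L_{i+N-1}\mapsto H_i$, $G_{r+N}\mapsto F_r$ represents, up to the factor $\hbar$ in the brackets, the subalgebra spanned by $L_m$ ($m\ge N$) and $G_r$ ($r\ge N+\frac12$) of the Neveu–Schwarz super Virasoro algebra $$[L_m,L_n]=(m-n)L_{m+n}+\tfrac{c}{12}m(m^2-1)\delta_{m,-n},\quad [L_n,G_r]=(\tfrac n2-r)G_{n+r},\quad \{G_r,G_s\}=2L_{r+s}+\tfrac c3(r^2-\tfrac14)\delta_{r,-s}.$$ The extra odd variable occurs: $\{F_r,\theta^0\}\ne0$ for every $r$. Finally let $Q_m=\frac\hbar2\sum_{j\in\mathbb Z}(j+\frac m2):\psi_{-j}\psi_{m+j}:$. If $N=-1$ then for all $i\ge1$ one has $H_i=K_i+\frac\hbar{16}\delta_{i,2}+Q_{i-2}$ with the Kontsevich–Witten operators $$K_i=\hbar\partial_i+\frac{\hbar^2}2\sum_{j=1}^{i-2}\partial_j\partial_{i-1-j}+\frac\hbar2\sum_{j\ge\max(1,i-1)}(2j-2i+3)\,x^{j-i+2}\partial_j+\frac18(x^1)^2\delta_{i,1}+\frac\hbar{16}\delta_{i,2};$$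 if $N=0$ then for all $i\ge1$ one has $H_i=B_i+\hbar(\frac1{16}+D_1)\delta_{i,1}+Q_{i-1}$ with the Brézin–Gross–Witten operators $$B_i=\hbar\partial_i+\frac{\hbar^2}2\sum_{j=1}^{i-1}\partial_j\partial_{i-j}+\frac\hbar2\sum_{j\ge i}(2j-2i+1)\,x^{j-i+1}\partial_j+\frac\hbar{16}\delta_{i,1}$$ (here $\partial_j=\partial/\partial x^j$). -/

import Mathlib

open scoped BigOperators

noncomputable section

namespace SuperAiry

/-! ### Formal series in even variables, odd variables and `ħ`

`ι` indexes the even and `κ` the odd members of a homogeneous basis of a super vector space. -/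

/-- The monomial `ħ ^ hExp * ∏ (x i) ^ (xExp i) * ∏ θ j`, the last product over `j ∈ odd` in
increasing order. -/
@[ext]
structure Mono (ι κ : Type*) where
  hExp : ℕ
  xExp : ι →₀ ℕ
  odd : Finset κ

/-- The degree: `x i` and `θ j` have degree one, `ħ` has degree two. -/
def Mono.deg {ι κ : Type*} (μ : Mono ι κ) : ℕ :=
  2 * μ.hExp + μ.xExp.degree + μ.odd.card

/-- Families of coefficients with finitely many nonzero entries in each degree. -/
def seriesSubmodule (𝕜 ι κ : Type*) [Field 𝕜] : Submodule 𝕜 (Mono ι κ → 𝕜) where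
  carrier := {f | ∀ d : ℕ, {μ | μ.deg = d ∧ f μ ≠ 0}.Finite}
  add_mem' := by
    intro f g hf hg d
    refine ((hf d).union (hg d)).subset ?_
    rintro μ ⟨hd, hμ⟩
    by_cases h : f μ = 0
    · refine Or.inr ⟨hd, fun h' => hμ ?_⟩
      simp [h, h']
    · exact Or.inl ⟨hd, h⟩
  zero_mem' := by
    intro d
    simp
  smul_mem' := by
    intro c f hf d
    refine (hf d).subset ?_
    rintro μ ⟨hd, hμ⟩
    refine ⟨hd, fun h' => hμ ?_⟩
    simp [h']

/-- `𝕜[[V, ħ]]`: the completion of the super polynomial algebra `𝕜[V, ħ]` in the powers of the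
ideal of elements without constant term. An element is a sequence of polynomials, one homogeneous
polynomial in each degree. -/
def Ser (𝕜 ι κ : Type*) [Field 𝕜] : Type _ := seriesSubmodule 𝕜 ι κ

instance (𝕜 ι κ : Type*) [Field 𝕜] : AddCommGroup (Ser 𝕜 ι κ) :=
  inferInstanceAs (AddCommGroup (seriesSubmodule 𝕜 ι κ))

instance (𝕜 ι κ : Type*) [Field 𝕜] : Module 𝕜 (Ser 𝕜 ι κ) :=
  inferInstanceAs (Module 𝕜 (seriesSubmodule 𝕜 ι κ))

/-- The coefficient of a monomial in a series. -/
def Ser.coeff {𝕜 ι κ : Type*} [Field 𝕜] (f : Ser 𝕜 ι κ) (μ : Mono ι κ) : 𝕜 := f.1 μ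

/-- Linear operators on `𝕜[[V, ħ]]`; multiplication is composition. -/
abbrev Op (𝕜 ι κ : Type*) [Field 𝕜] : Type _ := Module.End 𝕜 (Ser 𝕜 ι κ)

/-- The operator `f ↦ g` with `g μ = w μ * f (s μ)` where `P μ` holds and `g μ = 0` elsewhere. -/
def shiftOp {𝕜 ι κ : Type*} [Field 𝕜] (P : Mono ι κ → Prop) [DecidablePred P]
    (s : Mono ι κ → Mono ι κ) (w : Mono ι κ → 𝕜) (hs : Set.InjOn s {μ | P μ})
    (hd : ∃ g : ℕ → ℕ, ∀ μ, P μ → (s μ).deg = g μ.deg) : Op 𝕜 ι κ where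
  toFun f := ⟨fun μ => if P μ then w μ * f.1 (s μ) else 0, by
    intro d
    obtain ⟨g, hg⟩ := hd
    refine Set.Finite.of_finite_image (f := s) ((f.2 (g d)).subset ?_) ?_
    · rintro _ ⟨μ, ⟨hd, hμ⟩, rfl⟩
      by_cases h : P μ
      · refine ⟨by rw [hg μ h, hd], fun h' => hμ ?_⟩
        simp [h']
      · exact absurd (if_neg h) hμ
    · refine hs.mono ?_
      rintro μ ⟨-, hμ⟩
      by_contra h
      exact hμ (if_neg h)⟩
  map_add' f g := by
    apply Subtype.ext
    funext μ
    change (if P μ then w μ * (f.1 (s μ) + g.1 (s μ)) else 0)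
      = (if P μ then w μ * f.1 (s μ) else 0) + (if P μ then w μ * g.1 (s μ) else 0)
    split_ifs
    · ring
    · simp
  map_smul' c f := by
    apply Subtype.ext
    funext μ
    change (if P μ then w μ * (c * f.1 (s μ)) else 0)
      = c * (if P μ then w μ * f.1 (s μ) else 0)
    split_ifs
    · ring
    · simp

theorem shiftOp_coeff {𝕜 ι κ : Type*} [Field 𝕜] (P : Mono ι κ → Prop) [DecidablePred P]
    (s : Mono ι κ → Mono ι κ) (w : Mono ι κ → 𝕜) (hs : Set.InjOn s {μ | P μ})
    (hd : ∃ g : ℕ → ℕ, ∀ μ, P μ → (s μ).deg = g μ.deg) (f : Ser 𝕜 ι κ) (μ : Mono ι κ) :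
    (shiftOp P s w hs hd f).coeff μ = if P μ then w μ * f.coeff (s μ) else 0 := rfl

section Operators

variable (𝕜 : Type*) {ι κ : Type*} [Field 𝕜]

/-- Multiplication by `ħ`. -/
def hbar : Op 𝕜 ι κ :=
  shiftOp (fun μ => 0 < μ.hExp) (fun μ => ⟨μ.hExp - 1, μ.xExp, μ.odd⟩) (fun _ => 1)
    (by
      rintro ⟨p, a, S⟩ hp ⟨q, b, T⟩ hq h
      simp only [Mono.mk.injEq, Set.mem_ofPred_eq] at h hp hq ⊢
      exact ⟨by omega, h.2⟩)
    ⟨fun d => d - 2, by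
      rintro ⟨p, a, S⟩ hp
      simp only [Mono.deg] at hp ⊢
      omega⟩

/-- Multiplication by the even variable `x i`. -/
def mulX (i : ι) : Op 𝕜 ι κ :=
  shiftOp (fun μ => 0 < μ.xExp i)
    (fun μ => ⟨μ.hExp, μ.xExp - Finsupp.single i 1, μ.odd⟩) (fun _ => 1)
    (by
      rintro ⟨p, a, S⟩ hp ⟨q, b, T⟩ hq h
      simp only [Mono.mk.injEq, Set.mem_ofPred_eq] at h hp hq ⊢
      refine ⟨h.1, ?_, h.2.2⟩
      have ha : Finsupp.single i 1 ≤ a := Finsupp.single_le_iff.mpr hp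
      have hb : Finsupp.single i 1 ≤ b := Finsupp.single_le_iff.mpr hq
      rw [← tsub_add_cancel_of_le ha, h.2.1, tsub_add_cancel_of_le hb])
    ⟨fun d => d - 1, by
      rintro ⟨p, a, S⟩ hp
      have ha : Finsupp.single i 1 ≤ a := Finsupp.single_le_iff.mpr hp
      have h : a.degree = (a - Finsupp.single i 1).degree + 1 := by
        conv_lhs => rw [← tsub_add_cancel_of_le ha]
        simp
      simp only [Mono.deg]
      omega⟩

/-- The derivative `∂ / ∂ x i`. -/
def derX (i : ι) : Op 𝕜 ι κ :=
  shiftOp (fun _ => True) (fun μ => ⟨μ.hExp, μ.xExp + Finsupp.single i 1, μ.odd⟩)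
    (fun μ => (μ.xExp i : 𝕜) + 1)
    (by
      rintro ⟨p, a, S⟩ - ⟨q, b, T⟩ - h
      simpa using h)
    ⟨fun d => d + 1, by
      rintro ⟨p, a, S⟩ -
      simp only [Mono.deg, map_add, Finsupp.degree_single]
      omega⟩

variable [LinearOrder κ]

/-- Left multiplication by the odd variable `θ j`. -/
def mulTheta (j : κ) : Op 𝕜 ι κ :=
  shiftOp (fun μ => j ∈ μ.odd) (fun μ => ⟨μ.hExp, μ.xExp, μ.odd.erase j⟩)
    (fun μ => (-1) ^ (μ.odd.filter (· < j)).card)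
    (by
      rintro ⟨p, a, S⟩ hp ⟨q, b, T⟩ hq h
      simp only [Mono.mk.injEq, Set.mem_ofPred_eq] at h hp hq ⊢
      refine ⟨h.1, h.2.1, ?_⟩
      rw [← Finset.insert_erase hp, h.2.2, Finset.insert_erase hq])
    ⟨fun d => d - 1, by
      rintro ⟨p, a, S⟩ hp
      have h := Finset.card_erase_add_one hp
      simp only [Mono.deg] at h ⊢
      omega⟩

/-- The left derivative `∂ / ∂ θ j`. -/
def derTheta (j : κ) : Op 𝕜 ι κ :=
  shiftOp (fun μ => j ∉ μ.odd) (fun μ => ⟨μ.hExp, μ.xExp, insert j μ.odd⟩)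
    (fun μ => (-1) ^ (μ.odd.filter (· < j)).card)
    (by
      rintro ⟨p, a, S⟩ hp ⟨q, b, T⟩ hq h
      simp only [Mono.mk.injEq, Set.mem_ofPred_eq] at h hp hq ⊢
      refine ⟨h.1, h.2.1, ?_⟩
      rw [← Finset.erase_insert hp, h.2.2, Finset.erase_insert hq])
    ⟨fun d => d + 1, by
      rintro ⟨p, a, S⟩ hp
      have h := Finset.card_insert_of_notMem hp
      simp only [Mono.deg] at h ⊢
      omega⟩

/-- Multiplication by a basis variable, even or odd. -/
def mulVar : ι ⊕ κ → Op 𝕜 ι κ := Sum.elim (mulX 𝕜) (mulTheta 𝕜)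

/-- Derivative in a basis variable, even or odd. -/
def derVar : ι ⊕ κ → Op 𝕜 ι κ := Sum.elim (derX 𝕜) (derTheta 𝕜)

end Operators

/-! ### Topology, parity and grading -/

section Structure

variable {𝕜 ι κ : Type*} [Field 𝕜]

/-- The homogeneous component of degree `d` of a series. -/
def homPart (d : ℕ) : Op 𝕜 ι κ :=
  shiftOp (fun μ => μ.deg = d) id (fun _ => 1) (Set.injOn_id _) ⟨id, fun _ _ => rfl⟩

/-- The adic topology of `𝕜[[V, ħ]]`: a net converges when each homogeneous component is eventually
constant. -/
instance : TopologicalSpace (Ser 𝕜 ι κ) :=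
  ⨅ d : ℕ, TopologicalSpace.induced (fun f : Ser 𝕜 ι κ => homPart d f) ⊥

/-- The topology of pointwise convergence on operators. -/
instance : TopologicalSpace (Op 𝕜 ι κ) :=
  TopologicalSpace.induced (fun (T : Op 𝕜 ι κ) (f : Ser 𝕜 ι κ) => T f) inferInstance

/-- The parity involution, `θ j ↦ - θ j`. -/
def parity : Op 𝕜 ι κ :=
  shiftOp (fun _ => True) id (fun μ => (-1) ^ μ.odd.card) (Set.injOn_id _) ⟨id, fun _ _ => rfl⟩

def IsEvenOp (T : Op 𝕜 ι κ) : Prop := parity * T = T * parity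

def IsOddOp (T : Op 𝕜 ι κ) : Prop := parity * T = -(T * parity)

/-- The even part of an operator. -/
def evenPart (T : Op 𝕜 ι κ) : Op 𝕜 ι κ := (2 : 𝕜)⁻¹ • (T + parity * T * parity)

/-- The odd part of an operator. -/
def oddPart (T : Op 𝕜 ι κ) : Op 𝕜 ι κ := (2 : 𝕜)⁻¹ • (T - parity * T * parity)

/-- The super-commutator: the bilinear operation that is `T * S - (-1) ^ (|T| |S|) • (S * T)` on
homogeneous operators. -/
def superComm (T S : Op 𝕜 ι κ) : Op 𝕜 ι κ :=
  T * S - (evenPart S * evenPart T + evenPart S * oddPart T + oddPart S * evenPart T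
    - oddPart S * oddPart T)

/-- The component of an operator that raises degrees by exactly `d`. On the completed Weyl algebra
this is the component of degree `d`, where `ħ ^ (m + k) x ^ n ∂ ^ m` has degree `n + m + 2 k`. -/
def component (d : ℕ) (T : Op 𝕜 ι κ) : Op 𝕜 ι κ where
  toFun f := ⟨fun μ => if d ≤ μ.deg then (T (homPart (μ.deg - d) f)).1 μ else 0, by
    intro e
    refine ((T (homPart (e - d) f)).2 e).subset ?_
    rintro μ ⟨rfl, hμ⟩
    refine ⟨rfl, fun h' => hμ ?_⟩
    simp [h']⟩
  map_add' f g := by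
    apply Subtype.ext
    funext μ
    change (if d ≤ μ.deg then (T (homPart (μ.deg - d) (f + g))).1 μ else 0)
      = (if d ≤ μ.deg then (T (homPart (μ.deg - d) f)).1 μ else 0)
        + (if d ≤ μ.deg then (T (homPart (μ.deg - d) g)).1 μ else 0)
    split_ifs
    · rw [map_add, map_add]; rfl
    · simp
  map_smul' c f := by
    apply Subtype.ext
    funext μ
    change (if d ≤ μ.deg then (T (homPart (μ.deg - d) (c • f))).1 μ else 0)
      = c * (if d ≤ μ.deg then (T (homPart (μ.deg - d) f)).1 μ else 0)
    split_ifs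
    · rw [map_smul, map_smul]; rfl
    · simp

/-- The truncation `T ^ {≤ n}`, the sum of the components of degree at most `n`. -/
def truncLE (n : ℕ) (T : Op 𝕜 ι κ) : Op 𝕜 ι κ := ∑ d ∈ Finset.range (n + 1), component d T

/-! ### The completed Weyl algebra -/

variable [LinearOrder κ]

/-- `T` is `∑ ħ ^ (m + k) x^{i₁} ⋯ x^{iₙ} c^{j₁ ⋯ jₘ}_{i₁ ⋯ iₙ} ∂_{j₁} ⋯ ∂_{jₘ}`, where for each
`(j₁, …, jₘ)` only finitely many coefficients are nonzero. The sum over `(j₁, …, jₘ)` may be infinite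
and converges pointwise. -/
def IsWeylTerm (T : Op 𝕜 ι κ) : Prop :=
  ∃ (n m k : ℕ) (c : (Fin m → ι ⊕ κ) → ((Fin n → ι ⊕ κ) →₀ 𝕜)),
    HasSum (fun J : Fin m → ι ⊕ κ =>
      hbar 𝕜 ^ (m + k)
        * (c J).sum (fun I a => a • (List.ofFn fun t => mulVar 𝕜 (I t)).prod)
        * (List.ofFn fun t => derVar 𝕜 (J t)).prod) T

variable (𝕜 ι κ)

/-- The space `𝒲_ħ(V)` of finite sums of terms as above. -/
def weyl : Submodule 𝕜 (Op 𝕜 ι κ) := Submodule.span 𝕜 {T | IsWeylTerm T}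

/-- The completion of `𝒲_ħ(V)` for pointwise convergence, realised as the closure among all linear
operators (the space of linear operators on the complete space `𝕜[[V, ħ]]` is complete). -/
def weylHat : Set (Op 𝕜 ι κ) := closure (weyl 𝕜 ι κ : Set (Op 𝕜 ι κ))

end Structure

/-! ### Super quantum Airy structures

`V` has basis indexed by `ι ⊕ κ`. The super vector space `V ⊕ 𝕜^{0|1}` has even basis `ι` and odd
basis `WithBot κ`; the extra odd basis vector is `⊥`. -/

section AiryStructure

variable (𝕜 ι κ : Type*) [Field 𝕜]

/-- The full linear dual of `V`. -/
def DualSp : Type _ := Module.Dual 𝕜 ((ι ⊕ κ) →₀ 𝕜)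

instance : AddCommGroup (DualSp 𝕜 ι κ) := inferInstanceAs (AddCommGroup (Module.Dual 𝕜 _))

instance : Module 𝕜 (DualSp 𝕜 ι κ) := inferInstanceAs (Module 𝕜 (Module.Dual 𝕜 _))

variable {𝕜 ι κ}

/-- The value of a functional at a vector. -/
def DualSp.eval (φ : DualSp 𝕜 ι κ) (v : (ι ⊕ κ) →₀ 𝕜) : 𝕜 :=
  (show Module.Dual 𝕜 ((ι ⊕ κ) →₀ 𝕜) from φ) v

/-- The topology of pointwise convergence on the dual, the scalars being discrete (as they are in
the adic topology). -/
instance : TopologicalSpace (DualSp 𝕜 ι κ) :=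
  ⨅ v : (ι ⊕ κ) →₀ 𝕜, TopologicalSpace.induced (fun φ => φ.eval v) ⊥

/-- The member of the dual set that is attached to the basis vector `a`. -/
def dualBasis (a : ι ⊕ κ) : DualSp 𝕜 ι κ := (Finsupp.lapply a : ((ι ⊕ κ) →₀ 𝕜) →ₗ[𝕜] 𝕜)

/-- Even functionals vanish on the odd part of `V`. -/
def DualSp.IsEven (φ : DualSp 𝕜 ι κ) : Prop := ∀ j : κ, φ.eval (Finsupp.single (Sum.inr j) 1) = 0

/-- Odd functionals vanish on the even part of `V`. -/
def DualSp.IsOdd (φ : DualSp 𝕜 ι κ) : Prop := ∀ i : ι, φ.eval (Finsupp.single (Sum.inl i) 1) = 0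

/-- The inclusion of the basis of `V` in that of `V ⊕ 𝕜^{0|1}`. -/
def inclVar : ι ⊕ κ → ι ⊕ WithBot κ := Sum.map id (fun j => (j : WithBot κ))

variable [LinearOrder κ]

/-- The left ideal of the completed Weyl algebra of `V ⊕ 𝕜^{0|1}` generated by the image of `L`. -/
def leftIdeal (L : DualSp 𝕜 ι κ →ₗ[𝕜] Op 𝕜 ι (WithBot κ)) : Submodule 𝕜 (Op 𝕜 ι (WithBot κ)) :=
  Submodule.span 𝕜 {T | ∃ A ∈ weylHat 𝕜 ι (WithBot κ), ∃ φ, T = A * L φ}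

/-- `(V, L)` is a super quantum Airy structure. -/
structure IsSuperQuantumAiryStructure (L : DualSp 𝕜 ι κ →ₗ[𝕜] Op 𝕜 ι (WithBot κ)) : Prop where
  mem_weylHat : ∀ φ, L φ ∈ weylHat 𝕜 ι (WithBot κ)
  continuous : Continuous L
  map_even : ∀ φ : DualSp 𝕜 ι κ, φ.IsEven → IsEvenOp (L φ)
  map_odd : ∀ φ : DualSp 𝕜 ι κ, φ.IsOdd → IsOddOp (L φ)
  involutive : ∀ A ∈ leftIdeal L, ∀ B ∈ leftIdeal L, ∃ C ∈ leftIdeal L,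
    superComm A B = hbar 𝕜 * C
  linear_part : ∀ a : ι ⊕ κ,
    truncLE 1 (L (dualBasis a)) = hbar 𝕜 * derVar 𝕜 (inclVar a)

end AiryStructure

/-! ### The twisted modes

The even variables are `x 1, x 2, …` and the odd ones `θ 0 = θ ⊥, θ 1, θ 2, …`. The modes `b r`,
`ψ n` contain `ħ ^ (± 1/2)`; the operators below are `√ħ b r` and `√ħ ψ n`, so that
`ħ b r b s = (√ħ b r) (√ħ b s)` and so on. A half-integer `r` is written `k - 1/2` with `k : ℤ`. -/

section Modes

/-- Operators on `𝕜[[V ⊕ 𝕜^{0|1}, ħ]]` for `V` with basis `x 1, x 2, …` and `θ 1, θ 2, …`. -/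
abbrev TwOp (𝕜 : Type*) [Field 𝕜] : Type _ := Op 𝕜 ℕ+ (WithBot ℕ+)

/-- A positive integer as an index. -/
def posIdx (k : ℤ) : ℕ+ := k.toNat.toPNat'

variable (𝕜 : Type*) [RCLike 𝕜]

/-- Multiplication by `x k`, for `k ≥ 1`. -/
def xVar (k : ℤ) : TwOp 𝕜 := mulVar 𝕜 (Sum.inl (posIdx k))

/-- `∂ / ∂ x k`, for `k ≥ 1`. -/
def dxVar (k : ℤ) : TwOp 𝕜 := derVar 𝕜 (Sum.inl (posIdx k))

/-- Multiplication by `θ k`, for `k ≥ 1`. -/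
def thetaVar (k : ℤ) : TwOp 𝕜 := mulVar 𝕜 (Sum.inr (posIdx k : WithBot ℕ+))

/-- `∂ / ∂ θ k`, for `k ≥ 1`. -/
def dthetaVar (k : ℤ) : TwOp 𝕜 := derVar 𝕜 (Sum.inr (posIdx k : WithBot ℕ+))

/-- Multiplication by the extra odd variable `θ 0`. -/
def theta0 : TwOp 𝕜 := mulVar 𝕜 (Sum.inr ⊥)

/-- `∂ / ∂ θ 0`. -/
def dtheta0 : TwOp 𝕜 := derVar 𝕜 (Sum.inr ⊥)

/-- `√ħ b_{k - 1/2}`: for `r ∈ ℤ_{≥ 0} + 1/2`, `b_r = √ħ ∂/∂x^{r + 1/2}` and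
`b_{-r} = (r / √ħ) x^{r + 1/2}`. -/
def bMode (k : ℤ) : TwOp 𝕜 :=
  if 0 < k then hbar 𝕜 * dxVar 𝕜 k else ((1 / 2 : 𝕜) - (k : 𝕜)) • xVar 𝕜 (1 - k)

/-- `√ħ ψ_n`: for `n ≥ 1`, `ψ_n = √ħ ∂/∂θ^n` and `ψ_{-n} = θ^n / √ħ`, while
`ψ_0 = (θ^0 + ħ ∂/∂θ^0) / √(2ħ)`. -/
def psiMode (n : ℤ) : TwOp 𝕜 :=
  if 0 < n then hbar 𝕜 * dthetaVar 𝕜 n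
  else if n < 0 then thetaVar 𝕜 (-n)
  else ((Real.sqrt 2 : ℝ) : 𝕜)⁻¹ • (theta0 𝕜 + hbar 𝕜 * dtheta0 𝕜)

/-- `ħ :b_{k - 1/2} b_{l - 1/2}:`, negative modes on the left and positive modes on the right. -/
def bNormal (k l : ℤ) : TwOp 𝕜 :=
  if 0 < k ∧ l ≤ 0 then bMode 𝕜 l * bMode 𝕜 k else bMode 𝕜 k * bMode 𝕜 l

/-- `ħ :ψ_m ψ_n:`. -/
def psiNormal (m n : ℤ) : TwOp 𝕜 :=
  if m ≤ n then psiMode 𝕜 m * psiMode 𝕜 n else -(psiMode 𝕜 n * psiMode 𝕜 m)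

/-- The summands `ħ :b_r b_{m - r}:`, with `r = k - 1/2`. -/
def bosonTerm (m k : ℤ) : TwOp 𝕜 := bNormal 𝕜 k (m + 1 - k)

/-- The summands `ħ (j + m / 2) :ψ_{-j} ψ_{m + j}:`. -/
def fermionTerm (m j : ℤ) : TwOp 𝕜 :=
  ((j : 𝕜) + (m : 𝕜) / 2) • psiNormal 𝕜 (-j) (m + j)

/-- The summands `ħ b_s ψ_{r - s}`, with `r = j - 1/2` and `s = k - 1/2`. -/
def superTerm (j k : ℤ) : TwOp 𝕜 := bMode 𝕜 k * psiMode 𝕜 (j - k)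

/-- The fermionic part of `ħ L_m`. -/
def fermionPart (m : ℤ) : TwOp 𝕜 := (1 / 2 : 𝕜) • ∑' j : ℤ, fermionTerm 𝕜 m j

/-- `ħ L_m` for the twisted representation. -/
def virasoroL (m : ℤ) : TwOp 𝕜 :=
  (1 / 2 : 𝕜) • (∑' k : ℤ, bosonTerm 𝕜 m k) + fermionPart 𝕜 m
    + if m = 0 then (1 / 8 : 𝕜) • hbar 𝕜 else 0

/-- `ħ G_{j - 1/2}` for the twisted representation. -/
def superG (j : ℤ) : TwOp 𝕜 := ∑' k : ℤ, superTerm 𝕜 j k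

/-- The operator `H_i`, `i ≥ 1`. -/
def airyH (N : ℤ) (D : ℤ → 𝕜) (i : ℤ) : TwOp 𝕜 :=
  hbar 𝕜 * dxVar 𝕜 i + virasoroL 𝕜 (i + N - 1) + if i ≤ N + 1 then D i • hbar 𝕜 else 0

/-- The operator `F_{j - 1/2}`, `j ≥ 1`. -/
def airyF (N : ℤ) (j : ℤ) : TwOp 𝕜 := hbar 𝕜 * dthetaVar 𝕜 j + superG 𝕜 (j + N)

/-! ### The super Virasoro algebra in the Neveu-Schwarz sector -/

/-- The basis `L_m`, `G_{j - 1/2}` and the central element of the super Virasoro algebra. -/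
inductive SVirBasis
  | L (m : ℤ)
  | G (j : ℤ)
  | C

variable {𝕜} in
open SVirBasis in
/-- The bracket of the super Virasoro algebra on basis elements. -/
def svirBracket : SVirBasis → SVirBasis → (SVirBasis →₀ 𝕜)
  | L m, L n => Finsupp.single (L (m + n)) ((m : 𝕜) - n)
      + Finsupp.single C (if m + n = 0 then (m : 𝕜) * ((m : 𝕜) ^ 2 - 1) / 12 else 0)
  | L n, G j => Finsupp.single (G (n + j)) ((n : 𝕜) / 2 - ((j : 𝕜) - 1 / 2))
  | G j, L n => -Finsupp.single (G (n + j)) ((n : 𝕜) / 2 - ((j : 𝕜) - 1 / 2))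
  | G j, G k => Finsupp.single (L (j + k - 1)) 2
      + Finsupp.single C
        (if j + k = 1 then (((j : 𝕜) - 1 / 2) ^ 2 - 1 / 4) / 3 else 0)
  | C, _ => 0
  | _, C => 0

/-- The elements `L_m`, `m ≥ N`, and `G_r`, `r ≥ N + 1/2`. -/
def svirSub (N : ℤ) : Set SVirBasis := {u | match u with
  | .L m => N ≤ m
  | .G j => N + 1 ≤ j
  | .C => False}

/-- `L_{i + N - 1} ↦ H_i` and `G_{r + N} ↦ F_r`. -/
def svirMap (N : ℤ) (D : ℤ → 𝕜) : SVirBasis → TwOp 𝕜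
  | .L m => airyH 𝕜 N D (m - N + 1)
  | .G j => airyF 𝕜 N (j - N)
  | .C => 0

/-! ### The Kontsevich-Witten and Brezin-Gross-Witten operators -/

/-- The `i`-th Virasoro operator of the Kontsevich-Witten tau function. -/
def kwOp (i : ℤ) : TwOp 𝕜 :=
  hbar 𝕜 * dxVar 𝕜 i
    + (1 / 2 : 𝕜) • (∑ j ∈ Finset.Icc 1 (i - 2), hbar 𝕜 ^ 2 * dxVar 𝕜 j * dxVar 𝕜 (i - 1 - j))
    + (1 / 2 : 𝕜) • (∑' j : ℤ, if 1 ≤ j ∧ i - 1 ≤ j then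
        (2 * (j : 𝕜) - 2 * (i : 𝕜) + 3) • (hbar 𝕜 * xVar 𝕜 (j - i + 2) * dxVar 𝕜 j) else 0)
    + (if i = 1 then (1 / 8 : 𝕜) • xVar 𝕜 1 ^ 2 else 0)
    + (if i = 2 then (1 / 16 : 𝕜) • hbar 𝕜 else 0)

/-- The `i`-th Virasoro operator of the Brezin-Gross-Witten tau function. -/
def bgwOp (i : ℤ) : TwOp 𝕜 :=
  hbar 𝕜 * dxVar 𝕜 i
    + (1 / 2 : 𝕜) • (∑ j ∈ Finset.Icc 1 (i - 1), hbar 𝕜 ^ 2 * dxVar 𝕜 j * dxVar 𝕜 (i - j))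
    + (1 / 2 : 𝕜) • (∑' j : ℤ, if i ≤ j then
        (2 * (j : 𝕜) - 2 * (i : 𝕜) + 1) • (hbar 𝕜 * xVar 𝕜 (j - i + 1) * dxVar 𝕜 j) else 0)
    + (if i = 1 then (1 / 16 : 𝕜) • hbar 𝕜 else 0)

end Modes

end SuperAiry

end

namespace SuperAiry

section Coefficients

variable {𝕜 ι κ : Type*} [Field 𝕜]

theorem Ser.ext {f g : Ser 𝕜 ι κ} (h : ∀ μ, f.coeff μ = g.coeff μ) : f = g :=
  Subtype.ext (funext h)

theorem Op.ext_coeff {T S : Op 𝕜 ι κ} (h : ∀ f μ, (T f).coeff μ = (S f).coeff μ) : T = S :=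
  LinearMap.ext fun f => Ser.ext (h f)

@[simp] theorem coeff_add (f g : Ser 𝕜 ι κ) (μ) : (f + g).coeff μ = f.coeff μ + g.coeff μ := rfl
@[simp] theorem coeff_sub (f g : Ser 𝕜 ι κ) (μ) : (f - g).coeff μ = f.coeff μ - g.coeff μ := rfl
@[simp] theorem coeff_neg (f : Ser 𝕜 ι κ) (μ) : (-f).coeff μ = -f.coeff μ := rfl
@[simp] theorem coeff_zero (μ) : (0 : Ser 𝕜 ι κ).coeff μ = 0 := rfl
@[simp] theorem coeff_smul (c : 𝕜) (f : Ser 𝕜 ι κ) (μ) : (c • f).coeff μ = c * f.coeff μ := rfl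

theorem coeff_sum {α : Type*} (s : Finset α) (f : α → Ser 𝕜 ι κ) (μ) :
    (∑ i ∈ s, f i).coeff μ = ∑ i ∈ s, (f i).coeff μ := by
  classical
  induction s using Finset.induction_on with
  | empty => simp
  | insert a s ha ih => simp [Finset.sum_insert ha, ih]

theorem hbar_coeff (f : Ser 𝕜 ι κ) (μ) : (hbar 𝕜 f).coeff μ
    = if 0 < μ.hExp then f.coeff ⟨μ.hExp - 1, μ.xExp, μ.odd⟩ else 0 := by
  exact (shiftOp_coeff ..).trans (by simp)

theorem mulX_coeff (i : ι) (f : Ser 𝕜 ι κ) (μ) : (mulX 𝕜 i f).coeff μ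
    = if 0 < μ.xExp i then f.coeff ⟨μ.hExp, μ.xExp - Finsupp.single i 1, μ.odd⟩ else 0 := by
  exact (shiftOp_coeff ..).trans (by simp)

theorem derX_coeff (i : ι) (f : Ser 𝕜 ι κ) (μ) : (derX 𝕜 i f).coeff μ
    = ((μ.xExp i : 𝕜) + 1) * f.coeff ⟨μ.hExp, μ.xExp + Finsupp.single i 1, μ.odd⟩ := by
  exact (shiftOp_coeff ..).trans (by simp)

theorem parity_coeff (f : Ser 𝕜 ι κ) (μ) : (parity f).coeff μ
    = (-1) ^ μ.odd.card * f.coeff μ := by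
  exact (shiftOp_coeff ..).trans (by simp)

theorem homPart_coeff (d : ℕ) (f : Ser 𝕜 ι κ) (μ) : (homPart d f).coeff μ
    = if μ.deg = d then f.coeff μ else 0 := by
  exact (shiftOp_coeff ..).trans (by simp)

theorem component_coeff (d : ℕ) (T : Op 𝕜 ι κ) (f : Ser 𝕜 ι κ) (μ) : (component d T f).coeff μ
    = if d ≤ μ.deg then (T (homPart (μ.deg - d) f)).coeff μ else 0 := rfl

variable [LinearOrder κ]

/-- The sign picked up by moving `θ j` past the smaller members of `S`. -/
noncomputable def thetaSign (𝕜 : Type*) [Field 𝕜] (j : κ) (S : Finset κ) : 𝕜 :=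
  (-1) ^ (S.filter (· < j)).card

theorem thetaSign_insert {i j : κ} {S : Finset κ} (hi : i ∉ S) :
    thetaSign 𝕜 j (insert i S) = if i < j then -thetaSign 𝕜 j S else thetaSign 𝕜 j S := by
  unfold thetaSign
  rw [Finset.filter_insert]
  split_ifs with h
  · rw [Finset.card_insert_of_notMem (by simp [hi]), pow_succ]; ring
  · rfl

theorem thetaSign_erase {i j : κ} {S : Finset κ} (hi : i ∈ S) :
    thetaSign 𝕜 j (S.erase i) = if i < j then -thetaSign 𝕜 j S else thetaSign 𝕜 j S := by
  have h := thetaSign_insert (𝕜 := 𝕜) (j := j) (Finset.notMem_erase i S)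
  rw [Finset.insert_erase hi] at h
  rw [h]
  split_ifs <;> simp

theorem thetaSign_mul_self (j : κ) (S : Finset κ) : thetaSign 𝕜 j S * thetaSign 𝕜 j S = 1 := by
  unfold thetaSign
  rw [← mul_pow]; simp

theorem mulTheta_coeff (j : κ) (f : Ser 𝕜 ι κ) (μ) : (mulTheta 𝕜 j f).coeff μ
    = if j ∈ μ.odd then thetaSign 𝕜 j μ.odd * f.coeff ⟨μ.hExp, μ.xExp, μ.odd.erase j⟩ else 0 := by
  exact (shiftOp_coeff ..).trans (by simp [thetaSign])

theorem derTheta_coeff (j : κ) (f : Ser 𝕜 ι κ) (μ) : (derTheta 𝕜 j f).coeff μ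
    = if j ∉ μ.odd then thetaSign 𝕜 j μ.odd * f.coeff ⟨μ.hExp, μ.xExp, insert j μ.odd⟩ else 0 := by
  exact (shiftOp_coeff ..).trans (by simp [thetaSign])

end Coefficients

section CanonicalRelations

variable (𝕜 : Type*) {ι κ : Type*} [Field 𝕜]

theorem hbar_mulX (i : ι) : Commute (hbar 𝕜 : Op 𝕜 ι κ) (mulX 𝕜 i) :=
  Op.ext_coeff fun f μ => by
    simp only [Module.End.mul_apply, hbar_coeff, mulX_coeff]
    split_ifs <;> rfl

theorem hbar_derX (i : ι) : Commute (hbar 𝕜 : Op 𝕜 ι κ) (derX 𝕜 i) :=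
  Op.ext_coeff fun f μ => by
    simp only [Module.End.mul_apply, hbar_coeff, derX_coeff]
    split_ifs <;> simp

theorem hbar_parity : Commute (hbar 𝕜 : Op 𝕜 ι κ) parity :=
  Op.ext_coeff fun f μ => by
    simp only [Module.End.mul_apply, hbar_coeff, parity_coeff]
    split_ifs <;> simp

theorem mulX_parity (i : ι) : Commute (mulX 𝕜 i : Op 𝕜 ι κ) parity :=
  Op.ext_coeff fun f μ => by
    simp only [Module.End.mul_apply, mulX_coeff, parity_coeff]
    split_ifs <;> simp

theorem derX_parity (i : ι) : Commute (derX 𝕜 i : Op 𝕜 ι κ) parity :=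
  Op.ext_coeff fun f μ => by
    simp only [Module.End.mul_apply, derX_coeff, parity_coeff]
    ring

theorem parity_mul_parity : (parity : Op 𝕜 ι κ) * parity = 1 :=
  Op.ext_coeff fun f μ => by
    simp only [Module.End.mul_apply, parity_coeff, Module.End.one_apply]
    rw [← mul_assoc, ← mul_pow]; simp

theorem mulX_mulX (i j : ι) : Commute (mulX 𝕜 i : Op 𝕜 ι κ) (mulX 𝕜 j) :=
  Op.ext_coeff fun f μ => by
    rcases eq_or_ne i j with rfl | h
    · rfl
    simp only [Module.End.mul_apply, mulX_coeff, Finsupp.coe_tsub, Pi.sub_apply,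
      Finsupp.single_eq_of_ne h, Finsupp.single_eq_of_ne h.symm, tsub_zero, tsub_right_comm]
    split_ifs <;> rfl

theorem derX_derX (i j : ι) : Commute (derX 𝕜 i : Op 𝕜 ι κ) (derX 𝕜 j) :=
  Op.ext_coeff fun f μ => by
    rcases eq_or_ne i j with rfl | h
    · rfl
    simp only [Module.End.mul_apply, derX_coeff, Finsupp.coe_add, Pi.add_apply,
      Finsupp.single_eq_of_ne h, Finsupp.single_eq_of_ne h.symm, add_zero, add_right_comm]
    rw [add_right_comm μ.xExp]; ring

open Classical in
theorem derX_mulX (i j : ι) : (derX 𝕜 i : Op 𝕜 ι κ) * mulX 𝕜 j - mulX 𝕜 j * derX 𝕜 i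
    = if i = j then 1 else 0 :=
  Op.ext_coeff fun f μ => by
    obtain ⟨p, a, S⟩ := μ
    rcases eq_or_ne i j with rfl | h
    · simp only [Module.End.mul_apply, derX_coeff, mulX_coeff, LinearMap.sub_apply, coeff_sub,
        Finsupp.coe_add, Pi.add_apply, Finsupp.single_eq_same, if_true, Module.End.one_apply,
        add_tsub_cancel_right, Nat.succ_pos, Finsupp.coe_tsub, Pi.sub_apply]
      split_ifs with h1
      · rw [tsub_add_cancel_of_le (Finsupp.single_le_iff.mpr h1), Nat.cast_sub h1]
        push_cast; ring
      · have : a i = 0 := by omega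
        simp [this]
    · simp only [Module.End.mul_apply, derX_coeff, mulX_coeff, LinearMap.sub_apply, coeff_sub,
        Finsupp.coe_add, Pi.add_apply, Finsupp.single_eq_of_ne h, Finsupp.single_eq_of_ne h.symm,
        if_neg h, add_zero, Finsupp.coe_tsub, Pi.sub_apply, tsub_zero, LinearMap.zero_apply,
        coeff_zero]
      split_ifs with h1
      · have : a + Finsupp.single i 1 - Finsupp.single j 1
            = a - Finsupp.single j 1 + Finsupp.single i 1 := by
          rw [tsub_add_eq_add_tsub (Finsupp.single_le_iff.mpr h1)]
        rw [this]; ring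
      · simp

variable [LinearOrder κ]

theorem hbar_mulTheta (i : κ) : Commute (hbar 𝕜 : Op 𝕜 ι κ) (mulTheta 𝕜 i) :=
  Op.ext_coeff fun f μ => by
    simp only [Module.End.mul_apply, hbar_coeff, mulTheta_coeff]
    split_ifs <;> simp

theorem hbar_derTheta (i : κ) : Commute (hbar 𝕜 : Op 𝕜 ι κ) (derTheta 𝕜 i) :=
  Op.ext_coeff fun f μ => by
    simp only [Module.End.mul_apply, hbar_coeff, derTheta_coeff]
    split_ifs <;> simp

theorem mulX_mulTheta (i : ι) (j : κ) : Commute (mulX 𝕜 i : Op 𝕜 ι κ) (mulTheta 𝕜 j) :=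
  Op.ext_coeff fun f μ => by
    simp only [Module.End.mul_apply, mulX_coeff, mulTheta_coeff]
    split_ifs <;> simp

theorem mulX_derTheta (i : ι) (j : κ) : Commute (mulX 𝕜 i : Op 𝕜 ι κ) (derTheta 𝕜 j) :=
  Op.ext_coeff fun f μ => by
    simp only [Module.End.mul_apply, mulX_coeff, derTheta_coeff]
    split_ifs <;> simp

theorem derX_mulTheta (i : ι) (j : κ) : Commute (derX 𝕜 i : Op 𝕜 ι κ) (mulTheta 𝕜 j) :=
  Op.ext_coeff fun f μ => by
    simp only [Module.End.mul_apply, derX_coeff, mulTheta_coeff]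
    split_ifs
    · ring
    · simp

theorem derX_derTheta (i : ι) (j : κ) : Commute (derX 𝕜 i : Op 𝕜 ι κ) (derTheta 𝕜 j) :=
  Op.ext_coeff fun f μ => by
    simp only [Module.End.mul_apply, derX_coeff, derTheta_coeff]
    split_ifs
    · simp
    · ring

theorem parity_mulTheta (j : κ) : (parity : Op 𝕜 ι κ) * mulTheta 𝕜 j = -(mulTheta 𝕜 j * parity) :=
  Op.ext_coeff fun f μ => by
    simp only [Module.End.mul_apply, parity_coeff, mulTheta_coeff, LinearMap.neg_apply, coeff_neg]
    split_ifs with h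
    · rw [← Finset.card_erase_add_one h, pow_succ]; ring
    · simp

theorem parity_derTheta (j : κ) : (parity : Op 𝕜 ι κ) * derTheta 𝕜 j = -(derTheta 𝕜 j * parity) :=
  Op.ext_coeff fun f μ => by
    simp only [Module.End.mul_apply, parity_coeff, derTheta_coeff, LinearMap.neg_apply, coeff_neg]
    split_ifs with h
    · simp
    · rw [Finset.card_insert_of_notMem h, pow_succ]; ring

theorem mulTheta_mulTheta (i j : κ) :
    (mulTheta 𝕜 i : Op 𝕜 ι κ) * mulTheta 𝕜 j + mulTheta 𝕜 j * mulTheta 𝕜 i = 0 :=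
  Op.ext_coeff fun f μ => by
    obtain ⟨p, a, S⟩ := μ
    simp only [Module.End.mul_apply, mulTheta_coeff, LinearMap.add_apply, coeff_add,
      LinearMap.zero_apply, coeff_zero, Finset.mem_erase]
    rcases eq_or_ne i j with rfl | h
    · simp
    by_cases hi : i ∈ S <;> by_cases hj : j ∈ S <;> simp [hi, hj, h, h.symm]
    rw [thetaSign_erase hi, thetaSign_erase hj, Finset.erase_right_comm]
    rcases lt_or_gt_of_ne h with h | h
    · rw [if_pos h, if_neg h.not_gt]; ring
    · rw [if_pos h, if_neg h.not_gt]; ring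

theorem derTheta_derTheta (i j : κ) :
    (derTheta 𝕜 i : Op 𝕜 ι κ) * derTheta 𝕜 j + derTheta 𝕜 j * derTheta 𝕜 i = 0 :=
  Op.ext_coeff fun f μ => by
    obtain ⟨p, a, S⟩ := μ
    simp only [Module.End.mul_apply, derTheta_coeff, LinearMap.add_apply, coeff_add,
      LinearMap.zero_apply, coeff_zero, Finset.mem_insert]
    rcases eq_or_ne i j with rfl | h
    · simp
    by_cases hi : i ∈ S <;> by_cases hj : j ∈ S <;> simp [hi, hj, h, h.symm]
    rw [thetaSign_insert hi, thetaSign_insert hj, Finset.insert_comm]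
    rcases lt_or_gt_of_ne h with h | h
    · rw [if_pos h, if_neg h.not_gt]; ring
    · rw [if_pos h, if_neg h.not_gt]; ring

theorem derTheta_mulTheta (i j : κ) :
    (derTheta 𝕜 i : Op 𝕜 ι κ) * mulTheta 𝕜 j + mulTheta 𝕜 j * derTheta 𝕜 i
      = if i = j then 1 else 0 :=
  Op.ext_coeff fun f μ => by
    obtain ⟨p, a, S⟩ := μ
    simp only [Module.End.mul_apply, mulTheta_coeff, derTheta_coeff, LinearMap.add_apply, coeff_add,
      Finset.mem_erase, Finset.mem_insert]
    rcases eq_or_ne i j with rfl | h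
    · by_cases hi : i ∈ S
      · simp [hi, thetaSign_erase hi, ← mul_assoc, thetaSign_mul_self]
      · simp [hi, thetaSign_insert hi, ← mul_assoc, thetaSign_mul_self]
    by_cases hi : i ∈ S <;> by_cases hj : j ∈ S <;> simp [hi, hj, h, h.symm]
    rw [thetaSign_insert hi, thetaSign_erase hj, Finset.erase_insert_of_ne h]
    rcases lt_or_gt_of_ne h with h | h
    · rw [if_pos h, if_neg h.not_gt]; ring
    · rw [if_pos h, if_neg h.not_gt]; ring

end CanonicalRelations

open Filter Topology

section Filtration

variable {𝕜 ι κ : Type*} [Field 𝕜]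

/-- The series without terms of degree less than `d`. -/
def Fil (𝕜 ι κ : Type*) [Field 𝕜] (d : ℕ) : Submodule 𝕜 (Ser 𝕜 ι κ) where
  carrier := {f | ∀ μ, μ.deg < d → f.coeff μ = 0}
  add_mem' := fun {f g} hf hg μ h => by simp [hf μ h, hg μ h]
  zero_mem' := fun μ _ => rfl
  smul_mem' := fun c f hf μ h => by simp [hf μ h]

theorem mem_Fil {d : ℕ} {f : Ser 𝕜 ι κ} : f ∈ Fil 𝕜 ι κ d ↔ ∀ μ, μ.deg < d → f.coeff μ = 0 :=
  Iff.rfl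

theorem eq_of_forall_sub_mem_Fil {f g : Ser 𝕜 ι κ} (h : ∀ d, f - g ∈ Fil 𝕜 ι κ d) : f = g :=
  Ser.ext fun μ => sub_eq_zero.mp (h (μ.deg + 1) μ (Nat.lt_succ_self _))

theorem coeff_eq_of_sub_mem_Fil {f g : Ser 𝕜 ι κ} {d : ℕ} (h : f - g ∈ Fil 𝕜 ι κ d) {μ : Mono ι κ}
    (hμ : μ.deg < d) : f.coeff μ = g.coeff μ :=
  sub_eq_zero.mp (h μ hμ)

theorem homPart_eq_iff {d : ℕ} {f g : Ser 𝕜 ι κ} :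
    homPart d f = homPart d g ↔ ∀ μ, μ.deg = d → f.coeff μ = g.coeff μ := by
  constructor
  · intro h μ hμ
    have := congrArg (fun k => k.coeff μ) h
    simpa [homPart_coeff, hμ] using this
  · intro h
    refine Ser.ext fun μ => ?_
    rw [homPart_coeff, homPart_coeff]
    split_ifs with h'
    exacts [h μ h', rfl]

theorem sub_mem_Fil_iff {d : ℕ} {f g : Ser 𝕜 ι κ} :
    f - g ∈ Fil 𝕜 ι κ d ↔ ∀ e ∈ Finset.range d, homPart e f = homPart e g := by
  simp only [Finset.mem_range, homPart_eq_iff, mem_Fil, coeff_sub, sub_eq_zero]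
  exact ⟨fun h e he μ hμ => h μ (hμ ▸ he), fun h μ hμ => h _ hμ μ rfl⟩

theorem ser_tendsto_iff {α : Type*} {l : Filter α} {u : α → Ser 𝕜 ι κ} {g : Ser 𝕜 ι κ} :
    Tendsto u l (𝓝 g) ↔ ∀ d, ∀ᶠ i in l, u i - g ∈ Fil 𝕜 ι κ d := by
  have h1 : Tendsto u l (𝓝 g) ↔ ∀ d, ∀ᶠ i in l, homPart d (u i) = homPart d g := by
    rw [nhds_iInf, tendsto_iInf]
    refine forall_congr' fun d => ?_
    rw [@nhds_induced _ _ ⊥, tendsto_comap_iff, @nhds_discrete _ ⊥ (@DiscreteTopology.mk _ ⊥ rfl),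
      tendsto_pure]
    rfl
  rw [h1]
  constructor
  · intro h d
    simp only [sub_mem_Fil_iff]
    exact (eventually_all_finset _).mpr fun e _ => h e
  · intro h d
    filter_upwards [h (d + 1)] with i hi
    exact sub_mem_Fil_iff.mp hi d (by simp)

theorem op_tendsto_iff {α : Type*} {l : Filter α} {T : α → Op 𝕜 ι κ} {S : Op 𝕜 ι κ} :
    Tendsto T l (𝓝 S) ↔ ∀ f d, ∀ᶠ i in l, T i f - S f ∈ Fil 𝕜 ι κ d := by
  rw [nhds_induced, tendsto_comap_iff, tendsto_pi_nhds]
  simp only [ser_tendsto_iff, Function.comp]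

instance : T2Space (Ser 𝕜 ι κ) := by
  rw [t2_iff_nhds]
  intro f g h
  refine eq_of_forall_sub_mem_Fil fun d => ?_
  have h1 : ∀ᶠ k in 𝓝 f ⊓ 𝓝 g, k - f ∈ Fil 𝕜 ι κ d :=
    (ser_tendsto_iff.mp tendsto_id d).filter_mono inf_le_left
  have h2 : ∀ᶠ k in 𝓝 f ⊓ 𝓝 g, k - g ∈ Fil 𝕜 ι κ d :=
    (ser_tendsto_iff.mp tendsto_id d).filter_mono inf_le_right
  obtain ⟨k, hk1, hk2⟩ := (h1.and h2).exists
  simpa using sub_mem hk2 hk1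

instance : T2Space (Op 𝕜 ι κ) :=
  T2Space.of_injective_continuous (f := fun (T : Op 𝕜 ι κ) (f : Ser 𝕜 ι κ) => T f)
    DFunLike.coe_injective continuous_induced_dom

instance : ContinuousAdd (Op 𝕜 ι κ) where
  continuous_add := continuous_iff_continuousAt.mpr fun p => by
    refine op_tendsto_iff.mpr fun f d => ?_
    have h1 := op_tendsto_iff.mp (continuous_fst.tendsto p) f d
    have h2 := op_tendsto_iff.mp (continuous_snd.tendsto p) f d
    filter_upwards [h1, h2] with q hq1 hq2
    have := add_mem hq1 hq2
    simp only [LinearMap.add_apply]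
    convert this using 1; abel

instance : ContinuousNeg (Op 𝕜 ι κ) where
  continuous_neg := continuous_iff_continuousAt.mpr fun p => by
    refine op_tendsto_iff.mpr fun f d => ?_
    filter_upwards [op_tendsto_iff.mp (continuous_id.tendsto p) f d] with q hq
    have := neg_mem hq
    simp only [LinearMap.neg_apply]
    convert this using 1
    simp only [id]; abel

instance : IsTopologicalAddGroup (Op 𝕜 ι κ) where

instance : ContinuousConstSMul 𝕜 (Op 𝕜 ι κ) where
  continuous_const_smul c := continuous_iff_continuousAt.mpr fun p => by
    refine op_tendsto_iff.mpr fun f d => ?_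
    filter_upwards [op_tendsto_iff.mp (continuous_id.tendsto p) f d] with q hq
    have := Submodule.smul_mem _ c hq
    simpa [smul_sub] using this

/-- Operators that do not lower degrees. -/
def IsFil (T : Op 𝕜 ι κ) : Prop := ∀ d, ∀ f ∈ Fil 𝕜 ι κ d, T f ∈ Fil 𝕜 ι κ d

namespace IsFil

variable {T S : Op 𝕜 ι κ}

theorem mul (hT : IsFil T) (hS : IsFil S) : IsFil (T * S) := fun d f hf => hT d _ (hS d f hf)
theorem add (hT : IsFil T) (hS : IsFil S) : IsFil (T + S) :=
  fun d f hf => add_mem (hT d f hf) (hS d f hf)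
theorem sub (hT : IsFil T) (hS : IsFil S) : IsFil (T - S) :=
  fun d f hf => sub_mem (hT d f hf) (hS d f hf)
theorem smul (c : 𝕜) (hT : IsFil T) : IsFil (c • T) :=
  fun d f hf => Submodule.smul_mem _ c (hT d f hf)
theorem one : IsFil (1 : Op 𝕜 ι κ) := fun _ _ hf => hf

theorem of_mem_closure {s : Set (Op 𝕜 ι κ)} (hs : ∀ T ∈ s, IsFil T) (hT : T ∈ closure s) :
    IsFil T := by
  intro d f hf
  have h1 := op_tendsto_iff.mp (tendsto_id (x := 𝓝 T)) f d
  obtain ⟨S, hS, hS'⟩ := (mem_closure_iff_frequently.mp hT).and_eventually h1 |>.exists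
  simpa using sub_mem (hs S hS d f hf) hS'

theorem continuous_mul_left (hT : IsFil T) : Continuous fun S : Op 𝕜 ι κ => T * S :=
  continuous_iff_continuousAt.mpr fun S => by
    refine op_tendsto_iff.mpr fun f d => ?_
    filter_upwards [op_tendsto_iff.mp (continuous_id.tendsto S) f d] with q hq
    have := hT d _ hq
    rwa [map_sub] at this

theorem _root_.SuperAiry.continuous_mul_right (T : Op 𝕜 ι κ) :
    Continuous fun S : Op 𝕜 ι κ => S * T :=
  continuous_iff_continuousAt.mpr fun S => op_tendsto_iff.mpr fun f d =>
    op_tendsto_iff.mp (continuous_id.tendsto S) (T f) d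

theorem hasSum_mul_left (hT : IsFil T) {α : Type*} {F : α → Op 𝕜 ι κ} (h : HasSum F S) :
    HasSum (fun i => T * F i) (T * S) :=
  h.map (AddMonoidHom.mulLeft T) hT.continuous_mul_left

end IsFil

theorem hasSum_apply_mem_Fil {α : Type*} {F : α → Op 𝕜 ι κ} {S : Op 𝕜 ι κ} (h : HasSum F S)
    {f : Ser 𝕜 ι κ} {d : ℕ} (hF : ∀ i, F i f ∈ Fil 𝕜 ι κ d) : S f ∈ Fil 𝕜 ι κ d := by
  obtain ⟨s, hs⟩ := (op_tendsto_iff.mp h f d).exists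
  rw [LinearMap.sum_apply] at hs
  have := sub_mem (sum_mem fun i _ => hF i : ∑ i ∈ s, F i f ∈ Fil 𝕜 ι κ d) hs
  simpa using this

theorem hasSum_apply_sub_mem_Fil {α : Type*} {F : α → Op 𝕜 ι κ} {S : Op 𝕜 ι κ} (h : HasSum F S)
    {f : Ser 𝕜 ι κ} {d : ℕ} (s : Finset α) (hF : ∀ i ∉ s, F i f ∈ Fil 𝕜 ι κ d) :
    S f - ∑ i ∈ s, F i f ∈ Fil 𝕜 ι κ d := by
  classical
  obtain ⟨t, ht, hst⟩ := ((op_tendsto_iff.mp h f d).and (eventually_ge_atTop s)).exists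
  have h1 : ∑ i ∈ t \ s, F i f ∈ Fil 𝕜 ι κ d :=
    sum_mem fun i hi => hF i (Finset.mem_sdiff.mp hi).2
  rw [LinearMap.sum_apply, ← Finset.sum_sdiff hst] at ht
  have := sub_mem h1 ht
  convert this using 1; abel

/-- A family of operators that tends to zero pointwise is summable. -/
theorem summable_of_cofinite {α : Type*} {F : α → Op 𝕜 ι κ}
    (h : ∀ f d, ∀ᶠ i in cofinite, F i f ∈ Fil 𝕜 ι κ d) : Summable F := by
  classical
  have hfin : ∀ f d, {i | F i f ∉ Fil 𝕜 ι κ d}.Finite := h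
  have hsupp : ∀ f μ, (Function.support fun i => (F i f).coeff μ).Finite := fun f μ =>
    (hfin f (μ.deg + 1)).subset fun i hi hi' => hi (hi' μ (Nat.lt_succ_self _))
  have hsum : ∀ f d μ, μ.deg < d → ∀ t : Finset α, (hfin f d).toFinset ⊆ t →
      ∑ᶠ i, (F i f).coeff μ = ∑ i ∈ t, (F i f).coeff μ := by
    intro f d μ hμ t ht
    refine finsum_eq_sum_of_support_subset _ fun i hi => ?_
    refine ht ?_
    rw [Set.Finite.mem_toFinset]
    exact fun hi' => hi (hi' μ hμ)
  let S : Op 𝕜 ι κ :=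
    { toFun := fun f => ⟨fun μ => ∑ᶠ i, (F i f).coeff μ, by
        intro d
        refine Set.Finite.subset ((hfin f (d + 1)).toFinset.finite_toSet.biUnion
          fun i _ => (F i f).2 d) ?_
        rintro μ ⟨rfl, hμ⟩
        obtain ⟨i, hi⟩ : ∃ i, (F i f).coeff μ ≠ 0 := by
          by_contra! h
          exact hμ (finsum_eq_zero_of_forall_eq_zero h)
        simp only [Set.mem_iUnion]
        refine ⟨i, ?_, rfl, hi⟩
        simp only [Set.Finite.coe_toFinset]
        exact fun hi' => hi (hi' μ (Nat.lt_succ_self _))⟩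
      map_add' := fun f g => Ser.ext fun μ => by
        change ∑ᶠ i, (F i (f + g)).coeff μ = ∑ᶠ i, (F i f).coeff μ + ∑ᶠ i, (F i g).coeff μ
        rw [← finsum_add_distrib (hsupp f μ) (hsupp g μ)]
        simp
      map_smul' := fun c f => Ser.ext fun μ => by
        change ∑ᶠ i, (F i (c • f)).coeff μ = c * ∑ᶠ i, (F i f).coeff μ
        rw [mul_finsum]
        simp }
  refine ⟨S, op_tendsto_iff.mpr fun f d => ?_⟩
  filter_upwards [eventually_ge_atTop (hfin f d).toFinset] with t ht μ hμ
  rw [coeff_sub, LinearMap.sum_apply, coeff_sum, sub_eq_zero]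
  exact (hsum f d μ hμ t ht).symm

theorem Ser.finite_deg_lt (f : Ser 𝕜 ι κ) (d : ℕ) : {μ | μ.deg < d ∧ f.coeff μ ≠ 0}.Finite :=
  ((Finset.range d).finite_toSet.biUnion fun e _ => f.2 e).subset fun μ hμ => by
    simp only [Set.mem_iUnion]
    exact ⟨μ.deg, by simpa using hμ.1, rfl, hμ.2⟩

/-- Multiplication by `ħ` is injective, with this left inverse. -/
noncomputable def divHbar (𝕜 : Type*) {ι κ : Type*} [Field 𝕜] : Op 𝕜 ι κ :=
  shiftOp (fun _ => True) (fun μ => ⟨μ.hExp + 1, μ.xExp, μ.odd⟩) (fun _ => 1)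
    (by
      rintro ⟨p, a, S⟩ - ⟨q, b, T⟩ - h
      simpa using h)
    ⟨fun d => d + 2, by
      rintro ⟨p, a, S⟩ -
      simp only [Mono.deg]
      omega⟩

theorem divHbar_mul_hbar : (divHbar 𝕜 : Op 𝕜 ι κ) * hbar 𝕜 = 1 :=
  Op.ext_coeff fun f μ => by
    have h : (divHbar 𝕜 (hbar 𝕜 f)).coeff μ
        = (hbar 𝕜 f).coeff ⟨μ.hExp + 1, μ.xExp, μ.odd⟩ := (shiftOp_coeff ..).trans (by simp)
    simp [h, hbar_coeff]

theorem hbar_mul_cancel {T S : Op 𝕜 ι κ} (h : hbar 𝕜 * T = hbar 𝕜 * S) : T = S := by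
  simpa [← mul_assoc, divHbar_mul_hbar] using congrArg (divHbar 𝕜 * ·) h

theorem isFil_hbar : IsFil (hbar 𝕜 : Op 𝕜 ι κ) := fun d f hf μ hμ => by
  rw [hbar_coeff]
  split_ifs with h
  · refine hf _ ?_
    simp only [Mono.deg] at hμ ⊢; omega
  · rfl

theorem isFil_parity : IsFil (parity : Op 𝕜 ι κ) := fun d f hf μ hμ => by
  rw [parity_coeff, hf μ hμ, mul_zero]

theorem isFil_mulX (i : ι) : IsFil (mulX 𝕜 i : Op 𝕜 ι κ) := fun d f hf μ hμ => by
  rw [mulX_coeff]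
  split_ifs with h
  · refine hf _ ?_
    have h' : (μ.xExp - Finsupp.single i 1).degree ≤ μ.xExp.degree :=
      Finsupp.degree_mono tsub_le_self
    simp only [Mono.deg] at hμ ⊢; omega
  · rfl

theorem isFil_hbar_derX (i : ι) : IsFil (hbar 𝕜 * derX 𝕜 i : Op 𝕜 ι κ) := fun d f hf μ hμ => by
  rw [Module.End.mul_apply, hbar_coeff]
  split_ifs with h
  · rw [derX_coeff, hf, mul_zero]
    simp only [Mono.deg, map_add, Finsupp.degree_single] at hμ ⊢; omega
  · rfl

theorem eventually_hbar_derX (f : Ser 𝕜 ι κ) (d : ℕ) :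
    ∀ᶠ i in cofinite, (hbar 𝕜 * derX 𝕜 i : Op 𝕜 ι κ) f ∈ Fil 𝕜 ι κ d := by
  refine Set.Finite.subset ((f.finite_deg_lt d).biUnion fun μ _ => μ.xExp.support.finite_toSet) ?_
  intro i hi
  obtain ⟨μ, hμ, hμ'⟩ : ∃ μ : Mono ι κ, μ.deg < d ∧ ((hbar 𝕜 * derX 𝕜 i : Op 𝕜 ι κ) f).coeff μ ≠ 0 := by
    by_contra! h
    exact hi h
  rw [Module.End.mul_apply, hbar_coeff] at hμ'
  split_ifs at hμ' with h
  · rw [derX_coeff] at hμ'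
    simp only [Set.mem_iUnion]
    refine ⟨_, ⟨?_, right_ne_zero_of_mul hμ'⟩, ?_⟩
    · simp only [Mono.deg, map_add, Finsupp.degree_single] at hμ ⊢; omega
    · simp
  · exact absurd rfl hμ'

variable [LinearOrder κ]

theorem isFil_mulTheta (i : κ) : IsFil (mulTheta 𝕜 i : Op 𝕜 ι κ) := fun d f hf μ hμ => by
  rw [mulTheta_coeff]
  split_ifs with h
  · rw [hf, mul_zero]
    have := Finset.card_erase_le (s := μ.odd) (a := i)
    simp only [Mono.deg] at hμ ⊢; omega
  · rfl

theorem isFil_hbar_derTheta (i : κ) : IsFil (hbar 𝕜 * derTheta 𝕜 i : Op 𝕜 ι κ) :=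
  fun d f hf μ hμ => by
  rw [Module.End.mul_apply, hbar_coeff]
  split_ifs with h
  · rw [derTheta_coeff]
    split_ifs with h'
    · rfl
    · rw [hf, mul_zero]
      have := Finset.card_insert_of_notMem h'
      simp only [Mono.deg] at hμ this ⊢; omega
  · rfl

theorem eventually_hbar_derTheta (f : Ser 𝕜 ι κ) (d : ℕ) :
    ∀ᶠ i in cofinite, (hbar 𝕜 * derTheta 𝕜 i : Op 𝕜 ι κ) f ∈ Fil 𝕜 ι κ d := by
  refine Set.Finite.subset ((f.finite_deg_lt d).biUnion fun μ _ => μ.odd.finite_toSet) ?_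
  intro i hi
  obtain ⟨μ, hμ, hμ'⟩ : ∃ μ : Mono ι κ, μ.deg < d ∧ ((hbar 𝕜 * derTheta 𝕜 i : Op 𝕜 ι κ) f).coeff μ ≠ 0 := by
    by_contra! h
    exact hi h
  rw [Module.End.mul_apply, hbar_coeff] at hμ'
  split_ifs at hμ' with h
  · rw [derTheta_coeff] at hμ'
    split_ifs at hμ' with h'
    · exact absurd rfl hμ'
    · simp only [Set.mem_iUnion]
      refine ⟨_, ⟨?_, right_ne_zero_of_mul hμ'⟩, ?_⟩
      · have := Finset.card_insert_of_notMem h'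
        simp only [Mono.deg] at hμ this ⊢; omega
      · simp
  · exact absurd rfl hμ'

end Filtration

section Parity

variable {𝕜 ι κ : Type*} [Field 𝕜]

/-- Conjugation by the parity involution. -/
noncomputable def parityConj : Op 𝕜 ι κ →ₐ[𝕜] Op 𝕜 ι κ where
  toFun T := parity * T * parity
  map_one' := by rw [mul_one, parity_mul_parity]
  map_mul' T S := by
    calc parity * (T * S) * parity = parity * T * (1 * S) * parity := by noncomm_ring
      _ = parity * T * parity * (parity * S * parity) := by
        rw [← parity_mul_parity]; noncomm_ring
  map_zero' := by simp
  map_add' T S := by noncomm_ring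
  commutes' c := by
    rw [Algebra.algebraMap_eq_smul_one, mul_smul_comm, mul_one, smul_mul_assoc, parity_mul_parity]

theorem parityConj_apply (T : Op 𝕜 ι κ) : parityConj T = parity * T * parity := rfl

theorem parityConj_parityConj (T : Op 𝕜 ι κ) : parityConj (parityConj T) = T := by
  calc parityConj (parityConj T) = (parity * parity) * T * (parity * parity) := by
        simp only [parityConj_apply]; noncomm_ring
    _ = T := by rw [parity_mul_parity, one_mul, mul_one]

theorem continuous_parityConj : Continuous (parityConj : Op 𝕜 ι κ → Op 𝕜 ι κ) :=
  (continuous_mul_right parity).comp isFil_parity.continuous_mul_left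

/-- The operator `T` is odd if `b` is true and even if `b` is false. -/
def HasParity (b : Bool) (T : Op 𝕜 ι κ) : Prop := parityConj T = if b then -T else T

theorem hasParity_false {T : Op 𝕜 ι κ} : HasParity false T ↔ parityConj T = T := by
  simp [HasParity]

theorem hasParity_true {T : Op 𝕜 ι κ} : HasParity true T ↔ parityConj T = -T := by
  simp [HasParity]

theorem parityConj_eq_iff {T S : Op 𝕜 ι κ} : parityConj T = S ↔ parity * T = S * parity := by
  constructor
  · rintro rfl
    rw [parityConj_apply, mul_assoc, parity_mul_parity, mul_one]
  · intro h
    rw [parityConj_apply, h, mul_assoc, parity_mul_parity, mul_one]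

theorem isEvenOp_iff {T : Op 𝕜 ι κ} : IsEvenOp T ↔ HasParity false T := by
  rw [hasParity_false, parityConj_eq_iff]; rfl

theorem isOddOp_iff {T : Op 𝕜 ι κ} : IsOddOp T ↔ HasParity true T := by
  rw [hasParity_true, parityConj_eq_iff, neg_mul]; rfl

namespace HasParity

variable {b c : Bool} {T S : Op 𝕜 ι κ}

theorem mul (hT : HasParity b T) (hS : HasParity c S) : HasParity (b ^^ c) (T * S) := by
  unfold HasParity at *
  rw [map_mul, hT, hS]
  cases b <;> cases c <;> simp

theorem add (hT : HasParity b T) (hS : HasParity b S) : HasParity b (T + S) := by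
  unfold HasParity at *
  rw [map_add, hT, hS]
  cases b <;> simp [add_comm]

theorem neg (hT : HasParity b T) : HasParity b (-T) := by
  unfold HasParity at *
  rw [map_neg, hT]
  cases b <;> simp

theorem sub (hT : HasParity b T) (hS : HasParity b S) : HasParity b (T - S) := by
  rw [sub_eq_add_neg]; exact hT.add hS.neg

theorem smul (a : 𝕜) (hT : HasParity b T) : HasParity b (a • T) := by
  unfold HasParity at *
  rw [map_smul, hT]
  cases b <;> simp

theorem zero : HasParity b (0 : Op 𝕜 ι κ) := by
  unfold HasParity
  cases b <;> simp

theorem hasSum {α : Type*} {F : α → Op 𝕜 ι κ} (h : HasSum F T) (hF : ∀ i, HasParity b (F i)) :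
    HasParity b T := by
  have h1 : HasSum (fun i => parityConj (F i)) (parityConj T) :=
    h.map (parityConj : Op 𝕜 ι κ →ₐ[𝕜] Op 𝕜 ι κ) continuous_parityConj
  unfold HasParity at *
  cases b
  · simp only [hF] at h1
    simpa using h1.unique h
  · simp only [hF] at h1
    simpa using h1.unique h.neg

end HasParity

/-- `T ↦ T` or `T ↦ parityConj T`. -/
noncomputable def twist : Bool → Op 𝕜 ι κ →ₐ[𝕜] Op 𝕜 ι κ
  | false => AlgHom.id 𝕜 _
  | true => parityConj

@[simp] theorem twist_false (T : Op 𝕜 ι κ) : twist false T = T := rfl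
@[simp] theorem twist_true (T : Op 𝕜 ι κ) : twist true T = parityConj T := rfl

theorem hasParity_false_hbar : HasParity false (hbar 𝕜 : Op 𝕜 ι κ) :=
  isEvenOp_iff.mp (hbar_parity 𝕜).symm.eq

theorem hasParity_mulX (i : ι) : HasParity false (mulX 𝕜 i : Op 𝕜 ι κ) :=
  isEvenOp_iff.mp (mulX_parity 𝕜 i).symm.eq

theorem hasParity_derX (i : ι) : HasParity false (derX 𝕜 i : Op 𝕜 ι κ) :=
  isEvenOp_iff.mp (derX_parity 𝕜 i).symm.eq

theorem hasParity_mulTheta [LinearOrder κ] (i : κ) : HasParity true (mulTheta 𝕜 i : Op 𝕜 ι κ) :=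
  isOddOp_iff.mp (parity_mulTheta 𝕜 i)

theorem hasParity_derTheta [LinearOrder κ] (i : κ) : HasParity true (derTheta 𝕜 i : Op 𝕜 ι κ) :=
  isOddOp_iff.mp (parity_derTheta 𝕜 i)

theorem evenPart_eq (T : Op 𝕜 ι κ) : evenPart T = (2 : 𝕜)⁻¹ • (T + parityConj T) := rfl
theorem oddPart_eq (T : Op 𝕜 ι κ) : oddPart T = (2 : 𝕜)⁻¹ • (T - parityConj T) := rfl

theorem evenPart_add (T S : Op 𝕜 ι κ) : evenPart (T + S) = evenPart T + evenPart S := by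
  simp only [evenPart_eq, map_add]; module

theorem oddPart_add (T S : Op 𝕜 ι κ) : oddPart (T + S) = oddPart T + oddPart S := by
  simp only [oddPart_eq, map_add]; module

theorem evenPart_smul (c : 𝕜) (T : Op 𝕜 ι κ) : evenPart (c • T) = c • evenPart T := by
  simp only [evenPart_eq, map_smul]; module

theorem oddPart_smul (c : 𝕜) (T : Op 𝕜 ι κ) : oddPart (c • T) = c • oddPart T := by
  simp only [oddPart_eq, map_smul]; module

theorem hasParity_evenPart (T : Op 𝕜 ι κ) : HasParity false (evenPart T) := by
  rw [hasParity_false, evenPart_eq, map_smul, map_add, parityConj_parityConj, add_comm]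

theorem hasParity_oddPart (T : Op 𝕜 ι κ) : HasParity true (oddPart T) := by
  rw [hasParity_true, oddPart_eq, map_smul, map_sub, parityConj_parityConj, ← smul_neg, neg_sub]

theorem superComm_add_left (T T' S : Op 𝕜 ι κ) :
    superComm (T + T') S = superComm T S + superComm T' S := by
  simp only [superComm, evenPart_add, oddPart_add]; noncomm_ring

theorem superComm_add_right (T S S' : Op 𝕜 ι κ) :
    superComm T (S + S') = superComm T S + superComm T S' := by
  simp only [superComm, evenPart_add, oddPart_add]; noncomm_ring

theorem superComm_smul_left (c : 𝕜) (T S : Op 𝕜 ι κ) :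
    superComm (c • T) S = c • superComm T S := by
  simp only [superComm, evenPart_smul, oddPart_smul, smul_mul_assoc, mul_smul_comm, smul_sub,
    smul_add]

theorem superComm_smul_right (c : 𝕜) (T S : Op 𝕜 ι κ) :
    superComm T (c • S) = c • superComm T S := by
  simp only [superComm, evenPart_smul, oddPart_smul, smul_mul_assoc, mul_smul_comm, smul_sub,
    smul_add]

/-- The super-commutator as a bilinear map. -/
noncomputable def superCommHom : Op 𝕜 ι κ →ₗ[𝕜] Op 𝕜 ι κ →ₗ[𝕜] Op 𝕜 ι κ :=
  LinearMap.mk₂ 𝕜 superComm superComm_add_left superComm_smul_left superComm_add_right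
    superComm_smul_right

theorem superCommHom_apply (T S : Op 𝕜 ι κ) : superCommHom T S = superComm T S := rfl

theorem continuous_evenPart : Continuous (evenPart : Op 𝕜 ι κ → Op 𝕜 ι κ) :=
  (continuous_id.add continuous_parityConj).const_smul (2 : 𝕜)⁻¹

theorem continuous_oddPart : Continuous (oddPart : Op 𝕜 ι κ → Op 𝕜 ι κ) :=
  (continuous_id.sub continuous_parityConj).const_smul (2 : 𝕜)⁻¹

theorem IsFil.evenPart {T : Op 𝕜 ι κ} (h : IsFil T) : IsFil (evenPart T) :=
  (h.add ((isFil_parity.mul h).mul isFil_parity)).smul _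

theorem IsFil.oddPart {T : Op 𝕜 ι κ} (h : IsFil T) : IsFil (oddPart T) :=
  (h.sub ((isFil_parity.mul h).mul isFil_parity)).smul _

theorem IsFil.continuous_superComm_right {T : Op 𝕜 ι κ} (h : IsFil T) :
    Continuous fun S => superComm T S := by
  have h1 := fun R : Op 𝕜 ι κ => (continuous_mul_right R).comp continuous_evenPart
  have h2 := fun R : Op 𝕜 ι κ => (continuous_mul_right R).comp continuous_oddPart
  exact h.continuous_mul_left.sub ((((h1 _).add (h1 _)).add (h2 _)).sub (h2 _))

theorem IsFil.continuous_superComm_left {S : Op 𝕜 ι κ} (h : IsFil S) :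
    Continuous fun T => superComm T S := by
  have h1 := h.evenPart.continuous_mul_left.comp continuous_evenPart
  have h2 := h.evenPart.continuous_mul_left.comp continuous_oddPart
  have h3 := h.oddPart.continuous_mul_left.comp continuous_evenPart
  have h4 := h.oddPart.continuous_mul_left.comp continuous_oddPart
  exact (continuous_mul_right S).sub (((h1.add h2).add h3).sub h4)

theorem continuous_divHbar_mul : Continuous fun T : Op 𝕜 ι κ => divHbar 𝕜 * T :=
  continuous_iff_continuousAt.mpr fun S => by
    refine op_tendsto_iff.mpr fun f d => ?_
    filter_upwards [op_tendsto_iff.mp (continuous_id.tendsto S) f (d + 2)] with q hq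
    rintro ⟨p, a, S⟩ hμ
    rw [Module.End.mul_apply, Module.End.mul_apply, ← map_sub]
    refine (shiftOp_coeff ..).trans ?_
    rw [if_pos trivial, one_mul]
    refine hq _ ?_
    simp only [Mono.deg] at hμ ⊢
    omega

variable [CharZero 𝕜]

theorem evenPart_add_oddPart (T : Op 𝕜 ι κ) : evenPart T + oddPart T = T := by
  rw [evenPart_eq, oddPart_eq]; module

theorem evenPart_sub_oddPart (T : Op 𝕜 ι κ) : evenPart T - oddPart T = parityConj T := by
  rw [evenPart_eq, oddPart_eq]; module

theorem HasParity.superComm_eq {b : Bool} {T : Op 𝕜 ι κ} (h : HasParity b T) (S : Op 𝕜 ι κ) :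
    superComm T S = T * S - twist b S * T := by
  have h2 : (2 : 𝕜)⁻¹ • (T + T) = T := by module
  cases b
  · rw [hasParity_false] at h
    rw [superComm, evenPart_eq T, oddPart_eq T, h, h2, sub_self, smul_zero, mul_zero, mul_zero,
      add_zero, sub_zero, ← add_mul, evenPart_add_oddPart, twist_false]
  · rw [hasParity_true] at h
    rw [superComm, evenPart_eq T, oddPart_eq T, h, sub_neg_eq_add, h2, add_neg_cancel, smul_zero,
      mul_zero, mul_zero, zero_add, add_zero, ← sub_mul, evenPart_sub_oddPart, twist_true]

theorem HasParity.superComm_eq_right {b : Bool} {S : Op 𝕜 ι κ} (h : HasParity b S)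
    (T : Op 𝕜 ι κ) : superComm T S = T * S - S * twist b T := by
  have h2 : (2 : 𝕜)⁻¹ • (S + S) = S := by module
  cases b
  · rw [hasParity_false] at h
    rw [superComm, evenPart_eq S, oddPart_eq S, h, h2, sub_self, smul_zero, zero_mul, zero_mul,
      add_zero, sub_zero, ← mul_add, evenPart_add_oddPart, twist_false]
  · rw [hasParity_true] at h
    rw [superComm, evenPart_eq S, oddPart_eq S, h, sub_neg_eq_add, h2, add_neg_cancel, smul_zero,
      zero_mul, zero_mul, zero_add, zero_add, ← mul_sub, evenPart_sub_oddPart, twist_true]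

theorem superComm_of_even_left {T : Op 𝕜 ι κ} (h : HasParity false T) (S : Op 𝕜 ι κ) :
    superComm T S = T * S - S * T := h.superComm_eq S

theorem superComm_of_even_right {S : Op 𝕜 ι κ} (h : HasParity false S) (T : Op 𝕜 ι κ) :
    superComm T S = T * S - S * T := h.superComm_eq_right T

theorem superComm_of_odd {T S : Op 𝕜 ι κ} (hT : HasParity true T) (hS : HasParity true S) :
    superComm T S = T * S + S * T := by
  rw [hT.superComm_eq, twist_true, hasParity_true.mp hS, neg_mul, sub_neg_eq_add]

theorem superComm_eq_of_hasParity {b c : Bool} {T S : Op 𝕜 ι κ} (hT : HasParity b T)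
    (hS : HasParity c S) : superComm T S = T * S - (if b && c then -(S * T) else S * T) := by
  cases b
  · simp [superComm_of_even_left hT]
  · cases c
    · simp [superComm_of_even_right hS]
    · simp [superComm_of_odd hT hS]

end Parity

section Weyl

variable (𝕜 ι κ : Type*) [Field 𝕜] [LinearOrder κ]

/-- The generators `ħ`, `x`, `θ`, `ħ ∂ / ∂ x`, `ħ ∂ / ∂ θ` of the Weyl algebra. -/
def weylGen : Set (Op 𝕜 ι κ) :=
  {hbar 𝕜} ∪ Set.range (mulVar 𝕜) ∪ Set.range fun a => hbar 𝕜 * derVar 𝕜 a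

/-- The algebra of finite sums of products of generators. -/
noncomputable def polyWeyl : Subalgebra 𝕜 (Op 𝕜 ι κ) := Algebra.adjoin 𝕜 (weylGen 𝕜 ι κ)

variable {ι κ}

theorem hbar_commute_mulVar (a : ι ⊕ κ) : Commute (hbar 𝕜 : Op 𝕜 ι κ) (mulVar 𝕜 a) := by
  cases a
  exacts [hbar_mulX 𝕜 _, hbar_mulTheta 𝕜 _]

theorem hbar_commute_derVar (a : ι ⊕ κ) : Commute (hbar 𝕜 : Op 𝕜 ι κ) (derVar 𝕜 a) := by
  cases a
  exacts [hbar_derX 𝕜 _, hbar_derTheta 𝕜 _]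

/-- The parity of a basis variable. -/
def varParity (a : ι ⊕ κ) : Bool := a.isRight

theorem hasParity_mulVar (a : ι ⊕ κ) : HasParity (varParity a) (mulVar 𝕜 a : Op 𝕜 ι κ) := by
  cases a
  exacts [hasParity_mulX _, hasParity_mulTheta _]

theorem hasParity_derVar (a : ι ⊕ κ) : HasParity (varParity a) (derVar 𝕜 a : Op 𝕜 ι κ) := by
  cases a
  exacts [hasParity_derX _, hasParity_derTheta _]

theorem derVar_mul_mulVar (a b : ι ⊕ κ) : ∃ s t : 𝕜,
    (derVar 𝕜 a : Op 𝕜 ι κ) * mulVar 𝕜 b = s • (mulVar 𝕜 b * derVar 𝕜 a) + t • 1 := by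
  classical
  rcases a with i | i <;> rcases b with j | j
  · refine ⟨1, if i = j then 1 else 0, ?_⟩
    have := derX_mulX 𝕜 (κ := κ) i j
    rw [sub_eq_iff_eq_add] at this
    change derX 𝕜 i * mulX 𝕜 j = (1 : 𝕜) • (mulX 𝕜 j * derX 𝕜 i) + _
    rw [this]
    split_ifs <;> simp [add_comm]
  · exact ⟨1, 0, by rw [one_smul, zero_smul, add_zero]; exact (derX_mulTheta 𝕜 i j).eq⟩
  · exact ⟨1, 0, by rw [one_smul, zero_smul, add_zero]; exact (mulX_derTheta 𝕜 j i).eq.symm⟩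
  · refine ⟨-1, if i = j then 1 else 0, ?_⟩
    have := derTheta_mulTheta 𝕜 (ι := ι) i j
    rw [← eq_sub_iff_add_eq] at this
    change derTheta 𝕜 i * mulTheta 𝕜 j = (-1 : 𝕜) • (mulTheta 𝕜 j * derTheta 𝕜 i) + _
    rw [this]
    split_ifs
    · rw [one_smul]; module
    · rw [zero_smul]; module

/-- The operator `ħ ^ (m + k) x^I ∂_J` with `m` the length of `J`. -/
noncomputable def ordTerm (k : ℕ) (I J : List (ι ⊕ κ)) : Op 𝕜 ι κ :=
  hbar 𝕜 ^ (J.length + k) * (I.map (mulVar 𝕜)).prod * (J.map (derVar 𝕜)).prod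

/-- The span of the ordered terms. -/
noncomputable def ordSpan (𝕜 ι κ : Type*) [Field 𝕜] [LinearOrder κ] : Submodule 𝕜 (Op 𝕜 ι κ) :=
  Submodule.span 𝕜 {T | ∃ k I J, T = ordTerm 𝕜 k I J}

theorem ordTerm_mem (k : ℕ) (I J : List (ι ⊕ κ)) : ordTerm 𝕜 k I J ∈ ordSpan 𝕜 ι κ :=
  Submodule.subset_span ⟨k, I, J, rfl⟩

theorem mul_mem_ordSpan {T : Op 𝕜 ι κ} (h : ∀ k I J, T * ordTerm 𝕜 k I J ∈ ordSpan 𝕜 ι κ)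
    {S : Op 𝕜 ι κ} (hS : S ∈ ordSpan 𝕜 ι κ) : T * S ∈ ordSpan 𝕜 ι κ := by
  induction hS using Submodule.span_induction with
  | mem x hx => obtain ⟨k, I, J, rfl⟩ := hx; exact h k I J
  | zero => simp
  | add x y _ _ hx hy => rw [mul_add]; exact add_mem hx hy
  | smul c x _ hx => rw [mul_smul_comm]; exact Submodule.smul_mem _ c hx

theorem mulVar_mul_ordTerm (a : ι ⊕ κ) (k : ℕ) (I J : List (ι ⊕ κ)) :
    mulVar 𝕜 a * ordTerm 𝕜 k I J = ordTerm 𝕜 k (a :: I) J := by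
  rw [ordTerm, ordTerm, ← mul_assoc, ← mul_assoc,
    ((hbar_commute_mulVar 𝕜 a).pow_left _).symm.eq, List.map_cons, List.prod_cons, ← mul_assoc]

theorem hbar_derVar_mul_ordTerm_mem (a : ι ⊕ κ) (k : ℕ) (I J : List (ι ⊕ κ)) :
    hbar 𝕜 * derVar 𝕜 a * ordTerm 𝕜 k I J ∈ ordSpan 𝕜 ι κ := by
  induction I with
  | nil =>
    have : hbar 𝕜 * derVar 𝕜 a * ordTerm 𝕜 k [] J = ordTerm 𝕜 k [] (a :: J) := by
      rw [ordTerm, ordTerm, List.map_nil, List.prod_nil, mul_one, mul_one, mul_assoc,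
        ← mul_assoc (derVar 𝕜 a), ((hbar_commute_derVar 𝕜 a).pow_left _).symm.eq, List.map_cons,
        List.prod_cons, List.length_cons, mul_assoc, ← mul_assoc (hbar 𝕜), ← pow_succ',
        add_right_comm]
    rw [this]
    exact ordTerm_mem 𝕜 _ _ _
  | cons b I ih =>
    obtain ⟨s, t, h⟩ := derVar_mul_mulVar 𝕜 a b
    have h1 : hbar 𝕜 * derVar 𝕜 a * ordTerm 𝕜 k (b :: I) J
        = s • (mulVar 𝕜 b * (hbar 𝕜 * derVar 𝕜 a * ordTerm 𝕜 k I J))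
          + t • ordTerm 𝕜 (k + 1) I J := by
      rw [← mulVar_mul_ordTerm, mul_assoc, ← mul_assoc (derVar 𝕜 a), h, add_mul, mul_add]
      congr 1
      · rw [smul_mul_assoc, mul_smul_comm, ← mul_assoc, ← mul_assoc (hbar 𝕜),
          (hbar_commute_mulVar 𝕜 b).eq]
        simp only [mul_assoc]
      · rw [smul_mul_assoc, mul_smul_comm, one_mul, ordTerm, ordTerm, ← mul_assoc, ← mul_assoc,
          ← pow_succ', add_assoc]
    rw [h1]
    refine add_mem (Submodule.smul_mem _ _ (mul_mem_ordSpan 𝕜 (fun k I J => ?_) ih))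
      (Submodule.smul_mem _ _ (ordTerm_mem 𝕜 _ _ _))
    rw [mulVar_mul_ordTerm]
    exact ordTerm_mem 𝕜 _ _ _

theorem polyWeyl_le_ordSpan : (polyWeyl 𝕜 ι κ).toSubmodule ≤ ordSpan 𝕜 ι κ := by
  intro T hT
  have key : ∀ S ∈ ordSpan 𝕜 ι κ, T * S ∈ ordSpan 𝕜 ι κ := by
    rw [Subalgebra.mem_toSubmodule, polyWeyl] at hT
    induction hT using Algebra.adjoin_induction with
    | mem x hx =>
      refine fun S hS => mul_mem_ordSpan 𝕜 (fun k I J => ?_) hS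
      rcases hx with (rfl | ⟨a, rfl⟩) | ⟨a, rfl⟩
      · have : hbar 𝕜 * ordTerm 𝕜 k I J = ordTerm 𝕜 (k + 1) I J := by
          rw [ordTerm, ordTerm, ← mul_assoc, ← mul_assoc, ← pow_succ', add_assoc]
        rw [this]
        exact ordTerm_mem 𝕜 _ _ _
      · rw [mulVar_mul_ordTerm]
        exact ordTerm_mem 𝕜 _ _ _
      · exact hbar_derVar_mul_ordTerm_mem 𝕜 a k I J
    | algebraMap r =>
      intro S hS
      rw [Algebra.algebraMap_eq_smul_one, smul_mul_assoc, one_mul]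
      exact Submodule.smul_mem _ _ hS
    | add x y _ _ hx hy => intro S hS; rw [add_mul]; exact add_mem (hx S hS) (hy S hS)
    | mul x y _ _ hx hy => intro S hS; rw [mul_assoc]; exact hx _ (hy S hS)
  have h1 : (1 : Op 𝕜 ι κ) ∈ ordSpan 𝕜 ι κ := by
    have := ordTerm_mem 𝕜 0 ([] : List (ι ⊕ κ)) []
    simpa [ordTerm] using this
  simpa using key 1 h1

theorem ordSpan_le_weyl : ordSpan 𝕜 ι κ ≤ weyl 𝕜 ι κ := by
  classical
  refine Submodule.span_mono ?_
  rintro _ ⟨k, I, J, rfl⟩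
  refine ⟨I.length, J.length, k,
    fun J' => if J' = J.get then Finsupp.single I.get 1 else 0, ?_⟩
  convert hasSum_ite_eq J.get (ordTerm 𝕜 k I J) using 2 with J'
  split_ifs with h
  · subst h
    beta_reduce
    rw [if_pos rfl, Finsupp.sum_single_index (by simp), one_smul, ordTerm]
    congr 2
    · congr 1
      exact List.map_ofFn.symm.trans (by rw [List.ofFn_get]; rfl)
    · exact List.map_ofFn.symm.trans (by rw [List.ofFn_get]; rfl)
  · beta_reduce
    rw [if_neg h, Finsupp.sum_zero_index, mul_zero, zero_mul]

theorem hbar_mem_polyWeyl : hbar 𝕜 ∈ polyWeyl 𝕜 ι κ :=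
  Algebra.subset_adjoin (Or.inl (Or.inl rfl))

theorem mulVar_mem_polyWeyl (a : ι ⊕ κ) : mulVar 𝕜 a ∈ polyWeyl 𝕜 ι κ :=
  Algebra.subset_adjoin (Or.inl (Or.inr ⟨a, rfl⟩))

theorem hbar_derVar_mem_polyWeyl (a : ι ⊕ κ) : hbar 𝕜 * derVar 𝕜 a ∈ polyWeyl 𝕜 ι κ :=
  Algebra.subset_adjoin (Or.inr ⟨a, rfl⟩)

theorem weyl_le_closure_polyWeyl :
    weyl 𝕜 ι κ ≤ (polyWeyl 𝕜 ι κ).toSubmodule.topologicalClosure := by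
  refine Submodule.span_le.mpr ?_
  rintro T ⟨n, m, k, c, h⟩
  refine mem_closure_of_tendsto h (Eventually.of_forall fun s => ?_)
  refine sum_mem fun J _ => ?_
  change _ ∈ polyWeyl 𝕜 ι κ
  have h1 : ∀ L : List (ι ⊕ κ),
      hbar 𝕜 ^ L.length * (L.map (derVar 𝕜)).prod ∈ polyWeyl 𝕜 ι κ := by
    intro L
    induction L with
    | nil => simp [one_mem]
    | cons a L ih =>
      have : hbar 𝕜 ^ (a :: L).length * ((a :: L).map (derVar 𝕜)).prod
          = hbar 𝕜 * derVar 𝕜 a * (hbar 𝕜 ^ L.length * (L.map (derVar 𝕜)).prod) := by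
        rw [List.map_cons, List.prod_cons, List.length_cons, pow_succ', mul_assoc, mul_assoc,
          ← mul_assoc (derVar 𝕜 a), ((hbar_commute_derVar 𝕜 a).pow_left _).symm.eq, mul_assoc]
      rw [this]
      exact mul_mem (hbar_derVar_mem_polyWeyl 𝕜 a) ih
  have h2 : ∀ L : List (ι ⊕ κ), (L.map (mulVar 𝕜)).prod ∈ polyWeyl 𝕜 ι κ := fun L =>
    list_prod_mem fun x hx => by
      obtain ⟨a, -, rfl⟩ := List.mem_map.mp hx
      exact mulVar_mem_polyWeyl 𝕜 a
  have h4 : ∀ L : List (ι ⊕ κ), Commute (hbar 𝕜 : Op 𝕜 ι κ) (L.map (mulVar 𝕜)).prod := fun L =>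
    Commute.list_prod_right _ _ fun x hx => by
      obtain ⟨a, -, rfl⟩ := List.mem_map.mp hx
      exact hbar_commute_mulVar 𝕜 a
  rw [Finsupp.sum, Finset.mul_sum, Finset.sum_mul]
  refine sum_mem fun I _ => ?_
  have h3 : hbar 𝕜 ^ (m + k) * (c J I • (List.ofFn fun t => mulVar 𝕜 (I t)).prod)
        * (List.ofFn fun t => derVar 𝕜 (J t)).prod
      = c J I • (((List.ofFn I).map (mulVar 𝕜)).prod
        * hbar 𝕜 ^ k * (hbar 𝕜 ^ (List.ofFn J).length * ((List.ofFn J).map (derVar 𝕜)).prod)) := by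
    rw [List.map_ofFn, List.map_ofFn, List.length_ofFn, mul_smul_comm, smul_mul_assoc]
    congr 1
    have := (h4 (List.ofFn I)).pow_left (m + k)
    rw [List.map_ofFn] at this
    change hbar 𝕜 ^ (m + k) * (List.ofFn (mulVar 𝕜 ∘ I)).prod * (List.ofFn (derVar 𝕜 ∘ J)).prod = _
    rw [this.eq, mul_assoc, mul_assoc, ← mul_assoc (hbar 𝕜 ^ k), ← pow_add, add_comm k]
  rw [h3]
  exact Subalgebra.smul_mem _ (mul_mem (mul_mem (h2 _) (pow_mem (hbar_mem_polyWeyl 𝕜) k)) (h1 _)) _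

variable (ι κ)

theorem weylHat_eq_closure : weylHat 𝕜 ι κ = closure (polyWeyl 𝕜 ι κ : Set (Op 𝕜 ι κ)) := by
  apply subset_antisymm
  · exact closure_minimal (weyl_le_closure_polyWeyl 𝕜) isClosed_closure
  · exact closure_mono ((polyWeyl_le_ordSpan 𝕜).trans (ordSpan_le_weyl 𝕜))

variable {ι κ}

theorem isFil_of_mem_polyWeyl {T : Op 𝕜 ι κ} (hT : T ∈ polyWeyl 𝕜 ι κ) : IsFil T := by
  induction hT using Algebra.adjoin_induction with
  | mem x hx =>
    rcases hx with (rfl | ⟨a, rfl⟩) | ⟨a, rfl⟩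
    · exact isFil_hbar
    · cases a
      exacts [isFil_mulX _, isFil_mulTheta _]
    · cases a
      exacts [isFil_hbar_derX _, isFil_hbar_derTheta _]
  | algebraMap r =>
    rw [Algebra.algebraMap_eq_smul_one]
    exact IsFil.one.smul r
  | add x y _ _ hx hy => exact hx.add hy
  | mul x y _ _ hx hy => exact hx.mul hy

theorem isFil_of_mem_weylHat {T : Op 𝕜 ι κ} (hT : T ∈ weylHat 𝕜 ι κ) : IsFil T := by
  rw [weylHat_eq_closure] at hT
  exact IsFil.of_mem_closure (fun _ => isFil_of_mem_polyWeyl 𝕜) hT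

theorem mul_mem_weylHat {T S : Op 𝕜 ι κ} (hT : T ∈ weylHat 𝕜 ι κ) (hS : S ∈ weylHat 𝕜 ι κ) :
    T * S ∈ weylHat 𝕜 ι κ := by
  rw [weylHat_eq_closure] at *
  rw [← closure_closure]
  refine map_mem_closure (f := fun A => A * S) (continuous_mul_right S) hT fun A hA => ?_
  exact map_mem_closure (isFil_of_mem_polyWeyl 𝕜 hA).continuous_mul_left hS
    fun B hB => mul_mem (S := Subalgebra 𝕜 (Op 𝕜 ι κ)) hA hB

variable (ι κ)

/-- The completed Weyl algebra as an algebra. -/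
noncomputable def weylAlg : Subalgebra 𝕜 (Op 𝕜 ι κ) :=
  Submodule.toSubalgebra (weyl 𝕜 ι κ).topologicalClosure
    (by
      change _ ∈ weylHat 𝕜 ι κ
      rw [weylHat_eq_closure]
      exact subset_closure (one_mem (polyWeyl 𝕜 ι κ)))
    fun _ _ hT hS => mul_mem_weylHat 𝕜 hT hS

variable {ι κ}

theorem mem_weylAlg {T : Op 𝕜 ι κ} : T ∈ weylAlg 𝕜 ι κ ↔ T ∈ weylHat 𝕜 ι κ := Iff.rfl

theorem isClosed_weylAlg : IsClosed (weylAlg 𝕜 ι κ : Set (Op 𝕜 ι κ)) :=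
  isClosed_closure (s := (weyl 𝕜 ι κ : Set (Op 𝕜 ι κ)))

theorem polyWeyl_le_weylAlg : polyWeyl 𝕜 ι κ ≤ weylAlg 𝕜 ι κ := fun T hT => by
  rw [mem_weylAlg, weylHat_eq_closure]
  exact subset_closure hT

theorem parityConj_mem_polyWeyl {T : Op 𝕜 ι κ} (hT : T ∈ polyWeyl 𝕜 ι κ) :
    parityConj T ∈ polyWeyl 𝕜 ι κ := by
  have key : ∀ (b : Bool) (S : Op 𝕜 ι κ), HasParity b S → S ∈ polyWeyl 𝕜 ι κ →
      parityConj S ∈ polyWeyl 𝕜 ι κ := by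
    intro b S hb hS
    rw [hb]
    split_ifs
    exacts [neg_mem hS, hS]
  induction hT using Algebra.adjoin_induction with
  | mem x hx =>
    have hx' := Algebra.subset_adjoin (R := 𝕜) hx
    rcases hx with (rfl | ⟨a, rfl⟩) | ⟨a, rfl⟩
    · exact key _ _ hasParity_false_hbar hx'
    · exact key _ _ (hasParity_mulVar 𝕜 a) hx'
    · exact key _ _ (hasParity_false_hbar.mul (hasParity_derVar 𝕜 a)) hx'
  | algebraMap r => rw [AlgHom.commutes]; exact Subalgebra.algebraMap_mem _ r
  | add x y _ _ hx hy => rw [map_add]; exact add_mem hx hy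
  | mul x y _ _ hx hy => rw [map_mul]; exact mul_mem hx hy

theorem parityConj_mem_weylAlg {T : Op 𝕜 ι κ} (hT : T ∈ weylAlg 𝕜 ι κ) :
    parityConj T ∈ weylAlg 𝕜 ι κ := by
  rw [mem_weylAlg, weylHat_eq_closure] at *
  exact map_mem_closure continuous_parityConj hT fun _ => parityConj_mem_polyWeyl 𝕜

theorem twist_mem_weylAlg {T : Op 𝕜 ι κ} (b : Bool) (hT : T ∈ weylAlg 𝕜 ι κ) :
    twist b T ∈ weylAlg 𝕜 ι κ := by
  cases b
  exacts [hT, parityConj_mem_weylAlg 𝕜 hT]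

theorem commute_hbar_of_mem_weylAlg {T : Op 𝕜 ι κ} (hT : T ∈ weylAlg 𝕜 ι κ) :
    hbar 𝕜 * T = T * hbar 𝕜 := by
  have hc : IsClosed {T : Op 𝕜 ι κ | hbar 𝕜 * T = T * hbar 𝕜} :=
    isClosed_eq isFil_hbar.continuous_mul_left (continuous_mul_right _)
  rw [mem_weylAlg, weylHat_eq_closure] at hT
  refine closure_minimal (fun S hS => ?_) hc hT
  change Commute (hbar 𝕜) S
  have hS' : S ∈ Algebra.adjoin 𝕜 (weylGen 𝕜 ι κ) := hS
  induction hS' using Algebra.adjoin_induction with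
  | mem x hx =>
    rcases hx with (rfl | ⟨a, rfl⟩) | ⟨a, rfl⟩
    · exact Commute.refl _
    · exact hbar_commute_mulVar 𝕜 a
    · exact (Commute.refl _).mul_right (hbar_commute_derVar 𝕜 a)
  | algebraMap r => exact (Algebra.commutes r _).symm
  | add x y hx' hy' hx hy => exact (hx hx').add_right (hy hy')
  | mul x y hx' hy' hx hy => exact (hx hx').mul_right (hy hy')

/-- The multiples of `ħ` in the completed Weyl algebra. -/
noncomputable def hbarWeyl (𝕜 ι κ : Type*) [Field 𝕜] [LinearOrder κ] : Submodule 𝕜 (Op 𝕜 ι κ) :=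
  (weylAlg 𝕜 ι κ).toSubmodule.map (LinearMap.mulLeft 𝕜 (hbar 𝕜))

theorem isClosed_hbarWeyl : IsClosed (hbarWeyl 𝕜 ι κ : Set (Op 𝕜 ι κ)) := by
  have h : (hbarWeyl 𝕜 ι κ : Set (Op 𝕜 ι κ)) = {T | hbar 𝕜 * (divHbar 𝕜 * T) = T} ∩
      (fun T => divHbar 𝕜 * T) ⁻¹' (weylAlg 𝕜 ι κ : Set (Op 𝕜 ι κ)) := by
    ext T
    constructor
    · rintro ⟨C, hC, rfl⟩
      have : divHbar 𝕜 * (hbar 𝕜 * C) = C := by rw [← mul_assoc, divHbar_mul_hbar, one_mul]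
      simp only [LinearMap.mulLeft_apply, Set.mem_inter_iff, Set.mem_ofPred_eq, Set.mem_preimage,
        this, true_and]
      exact hC
    · rintro ⟨h1, h2⟩
      exact ⟨_, h2, h1⟩
  rw [h]
  exact (isClosed_eq (isFil_hbar.continuous_mul_left.comp continuous_divHbar_mul)
    continuous_id).inter ((isClosed_weylAlg 𝕜).preimage continuous_divHbar_mul)

theorem mul_mem_hbarWeyl_left {T S : Op 𝕜 ι κ} (hT : T ∈ weylAlg 𝕜 ι κ)
    (hS : S ∈ hbarWeyl 𝕜 ι κ) : T * S ∈ hbarWeyl 𝕜 ι κ := by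
  obtain ⟨C, hC, rfl⟩ := hS
  refine ⟨T * C, Subalgebra.mul_mem _ hT hC, ?_⟩
  rw [LinearMap.mulLeft_apply, LinearMap.mulLeft_apply, ← mul_assoc, ← mul_assoc,
    commute_hbar_of_mem_weylAlg 𝕜 hT]

theorem mul_mem_hbarWeyl_right {T S : Op 𝕜 ι κ} (hT : T ∈ weylAlg 𝕜 ι κ)
    (hS : S ∈ hbarWeyl 𝕜 ι κ) : S * T ∈ hbarWeyl 𝕜 ι κ := by
  obtain ⟨C, hC, rfl⟩ := hS
  exact ⟨C * T, Subalgebra.mul_mem _ hC hT, by simp [mul_assoc]⟩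

end Weyl

section Generators

variable {𝕜 ι κ : Type*} [Field 𝕜] [LinearOrder κ]

theorem weylGen_parity {T : Op 𝕜 ι κ} (hT : T ∈ weylGen 𝕜 ι κ) : ∃ b, HasParity b T := by
  rcases hT with (rfl | ⟨a, rfl⟩) | ⟨a, rfl⟩
  · exact ⟨_, hasParity_false_hbar⟩
  · exact ⟨_, hasParity_mulVar 𝕜 a⟩
  · exact ⟨_, hasParity_false_hbar.mul (hasParity_derVar 𝕜 a)⟩

theorem mul_mem_leftIdeal {L : DualSp 𝕜 ι κ →ₗ[𝕜] Op 𝕜 ι (WithBot κ)} {A : Op 𝕜 ι (WithBot κ)}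
    (hA : A ∈ weylAlg 𝕜 ι (WithBot κ)) (φ : DualSp 𝕜 ι κ) : A * L φ ∈ leftIdeal L :=
  Submodule.subset_span ⟨A, hA, φ, rfl⟩

end Generators

section Commutators

variable {𝕜 ι κ : Type*} [Field 𝕜] [CharZero 𝕜]

theorem HasParity.superComm_mul {b : Bool} {T : Op 𝕜 ι κ} (h : HasParity b T) (S S' : Op 𝕜 ι κ) :
    superComm T (S * S') = superComm T S * S' + twist b S * superComm T S' := by
  simp only [h.superComm_eq, map_mul]; noncomm_ring

theorem HasParity.mul_superComm {b : Bool} {S : Op 𝕜 ι κ} (h : HasParity b S) (T T' : Op 𝕜 ι κ) :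
    superComm (T * T') S = T * superComm T' S + superComm T S * twist b T' := by
  simp only [h.superComm_eq_right, map_mul]; noncomm_ring

theorem superComm_swap {b c : Bool} {T S : Op 𝕜 ι κ} (hT : HasParity b T) (hS : HasParity c S) :
    superComm S T = if b && c then superComm T S else -superComm T S := by
  rw [superComm_eq_of_hasParity hT hS, superComm_eq_of_hasParity hS hT]
  cases b <;> cases c <;> simp [add_comm]

theorem superComm_hbar_mul {b c : Bool} {T S : Op 𝕜 ι κ} (hT : HasParity b T) (hS : HasParity c S)
    (hS' : hbar 𝕜 * S = S * hbar 𝕜) :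
    superComm (hbar 𝕜 * T) S = hbar 𝕜 * superComm T S := by
  have h := hasParity_false_hbar.mul hT
  rw [Bool.false_xor] at h
  rw [superComm_eq_of_hasParity h hS, superComm_eq_of_hasParity hT hS]
  split_ifs <;> simp only [← mul_assoc, ← hS', mul_sub, mul_neg]

theorem superComm_mul_mul_eq {a b l m : Bool} {A B X Y : Op 𝕜 ι κ} (hA : HasParity a A)
    (hB : HasParity b B) (hX : HasParity l X) (hY : HasParity m Y) :
    ∃ s₁ s₂ s₃ : 𝕜, superComm (A * X) (B * Y)
      = A * superComm X B * Y + s₁ • (A * B * superComm X Y)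
        + s₂ • (superComm A B * Y * X) + s₃ • (B * superComm A Y * X) := by
  rw [superComm_eq_of_hasParity (hA.mul hX) (hB.mul hY), superComm_eq_of_hasParity hX hB,
    superComm_eq_of_hasParity hX hY, superComm_eq_of_hasParity hA hB,
    superComm_eq_of_hasParity hA hY]
  refine ⟨if l && b then -1 else 1, if (l && b) ^^ (l && m) then -1 else 1,
    if (l && b) ^^ (l && m) ^^ (a && b) then -1 else 1, ?_⟩
  cases a <;> cases b <;> cases l <;> cases m <;> simp <;> noncomm_ring

variable [LinearOrder κ]

theorem superComm_mulVar_mulVar (a b : ι ⊕ κ) :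
    superComm (mulVar 𝕜 a) (mulVar 𝕜 b) = (0 : Op 𝕜 ι κ) := by
  rw [superComm_eq_of_hasParity (hasParity_mulVar 𝕜 a) (hasParity_mulVar 𝕜 b)]
  rcases a with i | i <;> rcases b with j | j <;>
    simp only [varParity, Sum.isRight_inl, Sum.isRight_inr, Bool.and_self, Bool.and_true,
      Bool.and_false, if_true, Bool.false_eq_true, if_false, sub_neg_eq_add, sub_eq_zero]
  exacts [mulX_mulX 𝕜 i j, mulX_mulTheta 𝕜 i j, (mulX_mulTheta 𝕜 j i).symm,
    mulTheta_mulTheta 𝕜 i j]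

theorem superComm_derVar_derVar (a b : ι ⊕ κ) :
    superComm (derVar 𝕜 a) (derVar 𝕜 b) = (0 : Op 𝕜 ι κ) := by
  rw [superComm_eq_of_hasParity (hasParity_derVar 𝕜 a) (hasParity_derVar 𝕜 b)]
  rcases a with i | i <;> rcases b with j | j <;>
    simp only [varParity, Sum.isRight_inl, Sum.isRight_inr, Bool.and_self, Bool.and_true,
      Bool.and_false, if_true, Bool.false_eq_true, if_false, sub_neg_eq_add, sub_eq_zero]
  exacts [derX_derX 𝕜 i j, derX_derTheta 𝕜 i j, (derX_derTheta 𝕜 j i).symm,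
    derTheta_derTheta 𝕜 i j]

open Classical in
theorem superComm_derVar_mulVar (a b : ι ⊕ κ) :
    superComm (derVar 𝕜 a) (mulVar 𝕜 b) = (if a = b then 1 else 0 : Op 𝕜 ι κ) := by
  rw [superComm_eq_of_hasParity (hasParity_derVar 𝕜 a) (hasParity_mulVar 𝕜 b)]
  rcases a with i | i <;> rcases b with j | j <;>
    simp only [varParity, Sum.isRight_inl, Sum.isRight_inr, Bool.and_self, Bool.and_true,
      Bool.and_false, if_true, Bool.false_eq_true, if_false, sub_neg_eq_add, Sum.inl.injEq,
      Sum.inr.injEq, reduceCtorEq, sub_eq_zero]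
  · exact derX_mulX 𝕜 i j
  · exact derX_mulTheta 𝕜 i j
  · exact (mulX_derTheta 𝕜 j i).symm
  · refine (derTheta_mulTheta 𝕜 i j).trans ?_
    congr

theorem superComm_hbar (T : Op 𝕜 ι κ) (hT : T ∈ weylAlg 𝕜 ι κ) : superComm (hbar 𝕜) T = 0 := by
  rw [superComm_of_even_left hasParity_false_hbar, commute_hbar_of_mem_weylAlg 𝕜 hT, sub_self]

theorem superComm_weylGen_mem {T S : Op 𝕜 ι κ} (hT : T ∈ weylGen 𝕜 ι κ)
    (hS : S ∈ weylGen 𝕜 ι κ) : superComm T S ∈ hbarWeyl 𝕜 ι κ := by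
  classical
  have hT' := polyWeyl_le_weylAlg 𝕜 (Algebra.subset_adjoin hT)
  have hS' := polyWeyl_le_weylAlg 𝕜 (Algebra.subset_adjoin hS)
  have key : ∀ a b : ι ⊕ κ,
      superComm (hbar 𝕜 * derVar 𝕜 a) (mulVar 𝕜 b) ∈ hbarWeyl 𝕜 ι κ := by
    intro a b
    rw [superComm_hbar_mul (hasParity_derVar 𝕜 a) (hasParity_mulVar 𝕜 b) (hbar_commute_mulVar 𝕜 b),
      superComm_derVar_mulVar]
    refine ⟨_, ?_, rfl⟩
    split_ifs
    exacts [one_mem (weylAlg 𝕜 ι κ), zero_mem (weylAlg 𝕜 ι κ)]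
  rcases hT with (rfl | ⟨a, rfl⟩) | ⟨a, rfl⟩
  · rw [superComm_hbar _ hS']; exact zero_mem _
  all_goals rcases hS with (rfl | ⟨b, rfl⟩) | ⟨b, rfl⟩
  · rw [superComm_of_even_right hasParity_false_hbar, commute_hbar_of_mem_weylAlg 𝕜 hT', sub_self]
    exact zero_mem _
  · rw [superComm_mulVar_mulVar]; exact zero_mem _
  · have h := superComm_swap (hasParity_false_hbar.mul (hasParity_derVar 𝕜 b))
      (hasParity_mulVar 𝕜 a)
    change superComm (mulVar 𝕜 a) (hbar 𝕜 * derVar 𝕜 b) ∈ _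
    rw [h]
    split_ifs
    exacts [key b a, neg_mem (key b a)]
  · rw [superComm_of_even_right hasParity_false_hbar, commute_hbar_of_mem_weylAlg 𝕜 hT', sub_self]
    exact zero_mem _
  · exact key a b
  · have h1 := commute_hbar_of_mem_weylAlg 𝕜 hS'
    have hb := hasParity_false_hbar.mul (hasParity_derVar 𝕜 b)
    change superComm (hbar 𝕜 * derVar 𝕜 a) (hbar 𝕜 * derVar 𝕜 b) ∈ _
    rw [superComm_hbar_mul (hasParity_derVar 𝕜 a) hb h1]
    have h2 := superComm_swap (hasParity_derVar 𝕜 b) (hasParity_derVar 𝕜 a)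
    rw [superComm_swap hb (hasParity_derVar 𝕜 a), superComm_hbar_mul (hasParity_derVar 𝕜 b)
      (hasParity_derVar 𝕜 a) (hbar_commute_derVar 𝕜 a), superComm_derVar_derVar]
    simp

/-- The super-commutators of the completed Weyl algebra are divisible by `ħ`. -/
theorem superComm_mem_hbarWeyl {T S : Op 𝕜 ι κ} (hT : T ∈ weylAlg 𝕜 ι κ)
    (hS : S ∈ weylAlg 𝕜 ι κ) : superComm T S ∈ hbarWeyl 𝕜 ι κ := by
  have h1 : ∀ S ∈ weylGen 𝕜 ι κ, ∀ T ∈ polyWeyl 𝕜 ι κ, superComm T S ∈ hbarWeyl 𝕜 ι κ := by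
    intro S hS T hT
    obtain ⟨b, hb⟩ := weylGen_parity hS
    induction hT using Algebra.adjoin_induction with
    | mem x hx => exact superComm_weylGen_mem hx hS
    | algebraMap r =>
      rw [hb.superComm_eq_right, AlgHom.commutes, Algebra.commutes, sub_self]
      exact zero_mem _
    | add x y _ _ hx hy => rw [superComm_add_left]; exact add_mem hx hy
    | mul x y hx' hy' hx hy =>
      rw [hb.mul_superComm]
      exact add_mem (mul_mem_hbarWeyl_left 𝕜 (polyWeyl_le_weylAlg 𝕜 hx') hy)
        (mul_mem_hbarWeyl_right 𝕜 (twist_mem_weylAlg 𝕜 _ (polyWeyl_le_weylAlg 𝕜 hy')) hx)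
  have h2 : ∀ b, ∀ T ∈ polyWeyl 𝕜 ι κ, HasParity b T → ∀ S ∈ polyWeyl 𝕜 ι κ,
      superComm T S ∈ hbarWeyl 𝕜 ι κ := by
    intro b T hT hb S hS
    induction hS using Algebra.adjoin_induction with
    | mem x hx => exact h1 x hx T hT
    | algebraMap r =>
      rw [hb.superComm_eq, AlgHom.commutes, Algebra.commutes, sub_self]
      exact zero_mem _
    | add x y _ _ hx hy => rw [superComm_add_right]; exact add_mem hx hy
    | mul x y hx' hy' hx hy =>
      rw [hb.superComm_mul]
      exact add_mem (mul_mem_hbarWeyl_right 𝕜 (polyWeyl_le_weylAlg 𝕜 hy') hx)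
        (mul_mem_hbarWeyl_left 𝕜 (twist_mem_weylAlg 𝕜 _ (polyWeyl_le_weylAlg 𝕜 hx')) hy)
  have h3 : ∀ T ∈ polyWeyl 𝕜 ι κ, ∀ S ∈ polyWeyl 𝕜 ι κ, superComm T S ∈ hbarWeyl 𝕜 ι κ := by
    intro T hT S hS
    have hp := parityConj_mem_polyWeyl 𝕜 hT
    rw [← evenPart_add_oddPart T, superComm_add_left]
    refine add_mem (h2 false _ ?_ (hasParity_evenPart T) S hS)
      (h2 true _ ?_ (hasParity_oddPart T) S hS)
    · exact Subalgebra.smul_mem _ (add_mem hT hp) _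
    · exact Subalgebra.smul_mem _ (sub_mem hT hp) _
  have h4 : ∀ T ∈ polyWeyl 𝕜 ι κ, ∀ S ∈ weylAlg 𝕜 ι κ, superComm T S ∈ hbarWeyl 𝕜 ι κ := by
    intro T hT S hS
    rw [mem_weylAlg, weylHat_eq_closure] at hS
    have := map_mem_closure (isFil_of_mem_polyWeyl 𝕜 hT).continuous_superComm_right hS (h3 T hT)
    rwa [(isClosed_hbarWeyl 𝕜).closure_eq] at this
  have hS' := isFil_of_mem_weylHat 𝕜 hS
  rw [mem_weylAlg, weylHat_eq_closure] at hT
  have := map_mem_closure hS'.continuous_superComm_left hT fun T hT => h4 T hT S hS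
  rwa [(isClosed_hbarWeyl 𝕜).closure_eq] at this

end Commutators

section Dual

variable {𝕜 ι κ : Type*} [Field 𝕜]

theorem DualSp.ext {φ ψ : DualSp 𝕜 ι κ}
    (h : ∀ a, φ.eval (Finsupp.single a 1) = ψ.eval (Finsupp.single a 1)) : φ = ψ :=
  Finsupp.lhom_ext' fun a => LinearMap.ext_ring (h a)

/-- A functional with prescribed values on the basis. -/
noncomputable def DualSp.ofFun (c : ι ⊕ κ → 𝕜) : DualSp 𝕜 ι κ :=
  Finsupp.linearCombination 𝕜 c

@[simp] theorem DualSp.ofFun_eval (c : ι ⊕ κ → 𝕜) (a : ι ⊕ κ) :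
    (DualSp.ofFun c).eval (Finsupp.single a 1) = c a :=
  (Finsupp.linearCombination_single 𝕜 1 a).trans (one_smul 𝕜 _)

theorem DualSp.exists_even_add_odd (φ : DualSp 𝕜 ι κ) :
    ∃ φ₀ φ₁ : DualSp 𝕜 ι κ, φ₀.IsEven ∧ φ₁.IsOdd ∧ φ = φ₀ + φ₁ := by
  refine ⟨DualSp.ofFun fun a => if a.isLeft then φ.eval (Finsupp.single a 1) else 0,
    DualSp.ofFun fun a => if a.isLeft then 0 else φ.eval (Finsupp.single a 1), ?_, ?_, ?_⟩
  · intro j; simp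
  · intro i; simp
  · refine DualSp.ext fun a => ?_
    have : ∀ φ ψ : DualSp 𝕜 ι κ, ∀ v, (φ + ψ).eval v = φ.eval v + ψ.eval v := fun _ _ _ => rfl
    rw [this]
    cases a <;> simp

end Dual

section LeftIdeal

variable {𝕜 ι κ : Type*} [Field 𝕜] [CharZero 𝕜] [LinearOrder κ]

theorem leftIdeal_involutive {L : DualSp 𝕜 ι κ →ₗ[𝕜] Op 𝕜 ι (WithBot κ)}
    (hL : ∀ φ, L φ ∈ weylHat 𝕜 ι (WithBot κ))
    (heven : ∀ φ : DualSp 𝕜 ι κ, φ.IsEven → IsEvenOp (L φ))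
    (hodd : ∀ φ : DualSp 𝕜 ι κ, φ.IsOdd → IsOddOp (L φ))
    (hcomm : ∀ φ ψ, ∃ χ, superComm (L φ) (L ψ) = hbar 𝕜 * L χ) :
    ∀ A ∈ leftIdeal L, ∀ B ∈ leftIdeal L, ∃ C ∈ leftIdeal L, superComm A B = hbar 𝕜 * C := by
  set M : Submodule 𝕜 (Op 𝕜 ι (WithBot κ)) := (leftIdeal L).map (LinearMap.mulLeft 𝕜 (hbar 𝕜))
  have hM : ∀ {T : Op 𝕜 ι (WithBot κ)}, T ∈ hbarWeyl 𝕜 ι (WithBot κ) → ∀ φ, T * L φ ∈ M := by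
    rintro _ ⟨C, hC, rfl⟩ φ
    exact ⟨_, mul_mem_leftIdeal hC φ, by simp [mul_assoc]⟩
  have hhom : ∀ (a b l m : Bool) (A B : Op 𝕜 ι (WithBot κ)) (φ ψ : DualSp 𝕜 ι κ),
      A ∈ weylAlg 𝕜 ι (WithBot κ) → B ∈ weylAlg 𝕜 ι (WithBot κ) → HasParity a A →
      HasParity b B → HasParity l (L φ) → HasParity m (L ψ) →
      superComm (A * L φ) (B * L ψ) ∈ M := by
    intro a b l m A B φ ψ hA hB ha hb hl hm
    obtain ⟨s₁, s₂, s₃, h⟩ := superComm_mul_mul_eq ha hb hl hm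
    obtain ⟨χ, hχ⟩ := hcomm φ ψ
    rw [h]
    refine add_mem (add_mem (add_mem ?_ (M.smul_mem _ ?_)) (M.smul_mem _ ?_)) (M.smul_mem _ ?_)
    · exact hM (mul_mem_hbarWeyl_left 𝕜 hA (superComm_mem_hbarWeyl (hL φ) hB)) ψ
    · rw [hχ, ← mul_assoc]
      exact hM (mul_mem_hbarWeyl_left 𝕜 (mul_mem hA hB)
        ⟨1, one_mem (weylAlg 𝕜 ι (WithBot κ)), mul_one _⟩) χ
    · exact hM (mul_mem_hbarWeyl_right 𝕜 (hL ψ) (superComm_mem_hbarWeyl hA hB)) φ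
    · exact hM (mul_mem_hbarWeyl_left 𝕜 hB (superComm_mem_hbarWeyl hA (hL ψ))) φ
  have hspan : leftIdeal L ≤ Submodule.span 𝕜 {T | ∃ (a l : Bool) (A : Op 𝕜 ι (WithBot κ))
      (φ : DualSp 𝕜 ι κ), A ∈ weylAlg 𝕜 ι (WithBot κ) ∧ HasParity a A ∧ HasParity l (L φ) ∧
      T = A * L φ} := by
    refine Submodule.span_le.mpr ?_
    rintro _ ⟨A, hA, φ, rfl⟩
    obtain ⟨φ₀, φ₁, h₀, h₁, rfl⟩ := φ.exists_even_add_odd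
    have h₀' := isEvenOp_iff.mp (heven _ h₀)
    have h₁' := isOddOp_iff.mp (hodd _ h₁)
    have hp := parityConj_mem_weylAlg 𝕜 hA
    have hA₀ : evenPart A ∈ weylAlg 𝕜 ι (WithBot κ) :=
      Subalgebra.smul_mem _ (add_mem (mem_weylAlg 𝕜 |>.mpr hA) hp) _
    have hA₁ : oddPart A ∈ weylAlg 𝕜 ι (WithBot κ) :=
      Subalgebra.smul_mem _ (sub_mem (mem_weylAlg 𝕜 |>.mpr hA) hp) _
    have : A * L (φ₀ + φ₁) = evenPart A * L φ₀ + oddPart A * L φ₀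
        + (evenPart A * L φ₁ + oddPart A * L φ₁) := by
      rw [← add_mul, ← add_mul, evenPart_add_oddPart, map_add, mul_add]
    rw [this]
    refine add_mem (add_mem ?_ ?_) (add_mem ?_ ?_) <;> apply Submodule.subset_span
    · exact ⟨_, _, _, _, hA₀, hasParity_evenPart A, h₀', rfl⟩
    · exact ⟨_, _, _, _, hA₁, hasParity_oddPart A, h₀', rfl⟩
    · exact ⟨_, _, _, _, hA₀, hasParity_evenPart A, h₁', rfl⟩
    · exact ⟨_, _, _, _, hA₁, hasParity_oddPart A, h₁', rfl⟩
  intro A hA B hB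
  suffices h : superComm A B ∈ M by
    obtain ⟨C, hC, h⟩ := h
    exact ⟨C, hC, h.symm⟩
  rw [← superCommHom_apply]
  replace hA := hspan hA
  replace hB := hspan hB
  induction hA using Submodule.span_induction with
  | zero => rw [map_zero, LinearMap.zero_apply]; exact zero_mem _
  | add x y _ _ hx hy => rw [map_add, LinearMap.add_apply]; exact add_mem hx hy
  | smul c x _ hx => rw [map_smul, LinearMap.smul_apply]; exact M.smul_mem _ hx
  | mem x hx =>
    obtain ⟨a, l, A, φ, hA, ha, hl, rfl⟩ := hx
    induction hB using Submodule.span_induction with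
    | zero => rw [map_zero]; exact zero_mem _
    | add x y _ _ hx hy => rw [map_add]; exact add_mem hx hy
    | smul c x _ hx => rw [map_smul]; exact M.smul_mem _ hx
    | mem x hx =>
      obtain ⟨b, m, B, ψ, hB, hb, hm, rfl⟩ := hx
      exact hhom a b l m A B φ ψ hA hB ha hb hl hm

end LeftIdeal

section CanonicalPairs

variable (𝕜 : Type*) {ι κ : Type*} [Field 𝕜] [LinearOrder κ]

theorem hasParity_hbar_derVar (a : ι ⊕ κ) :
    HasParity (varParity a) (hbar 𝕜 * derVar 𝕜 a : Op 𝕜 ι κ) := by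
  simpa using hasParity_false_hbar.mul (hasParity_derVar 𝕜 a)

variable [CharZero 𝕜]

open Classical in
theorem superComm_hbar_derVar_mulVar (a b : ι ⊕ κ) :
    superComm (hbar 𝕜 * derVar 𝕜 a) (mulVar 𝕜 b) = (if a = b then hbar 𝕜 else 0 : Op 𝕜 ι κ) := by
  rw [superComm_hbar_mul (hasParity_derVar 𝕜 a) (hasParity_mulVar 𝕜 b) (hbar_commute_mulVar 𝕜 b),
      superComm_derVar_mulVar]
  split_ifs <;> simp

open Classical in
theorem superComm_mulVar_hbar_derVar (a b : ι ⊕ κ) :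
    superComm (mulVar 𝕜 a) (hbar 𝕜 * derVar 𝕜 b)
      = (if a = b then (if varParity a then hbar 𝕜 else -hbar 𝕜) else 0 : Op 𝕜 ι κ) := by
  rw [superComm_swap (hasParity_hbar_derVar 𝕜 b) (hasParity_mulVar 𝕜 a),
    superComm_hbar_derVar_mulVar]
  rcases eq_or_ne a b with rfl | h
  · cases varParity a <;> simp
  · simp [h, h.symm]

theorem superComm_hbar_derVar_hbar_derVar (a b : ι ⊕ κ) :
    superComm (hbar 𝕜 * derVar 𝕜 a) (hbar 𝕜 * derVar 𝕜 b) = (0 : Op 𝕜 ι κ) := by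
  have hb := hasParity_hbar_derVar 𝕜 (ι := ι) b
  have h := (Commute.refl (hbar 𝕜 : Op 𝕜 ι κ)).mul_right (hbar_commute_derVar 𝕜 b)
  rw [superComm_hbar_mul (hasParity_derVar 𝕜 a) hb h, superComm_swap hb (hasParity_derVar 𝕜 a),
    superComm_hbar_mul (hasParity_derVar 𝕜 b) (hasParity_derVar 𝕜 a) (hbar_commute_derVar 𝕜 a),
    superComm_derVar_derVar]
  simp

end CanonicalPairs

theorem coe_posIdx {k : ℤ} (hk : 0 < k) : ((posIdx k : ℕ+) : ℤ) = k := by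
  have : (posIdx k : ℕ) = k.toNat := by
    rw [posIdx, Nat.toPNat'_coe, if_pos (by omega)]
  omega

theorem posIdx_inj {k l : ℤ} (hk : 0 < k) (hl : 0 < l) : posIdx k = posIdx l ↔ k = l := by
  constructor
  · intro h
    rw [← coe_posIdx hk, h, coe_posIdx hl]
  · rintro rfl; rfl

theorem posIdx_coe (i : ℕ+) : posIdx ((i : ℕ) : ℤ) = i := by
  apply PNat.coe_injective
  have := coe_posIdx (k := ((i : ℕ) : ℤ)) (by exact_mod_cast i.pos)
  exact_mod_cast this

section Modes

variable (𝕜 : Type*) [RCLike 𝕜]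

theorem bMode_of_pos {k : ℤ} (hk : 0 < k) :
    bMode 𝕜 k = hbar 𝕜 * derVar 𝕜 (Sum.inl (posIdx k)) := if_pos hk

theorem bMode_of_nonpos {k : ℤ} (hk : k ≤ 0) :
    bMode 𝕜 k = ((1 / 2 : 𝕜) - k) • mulVar 𝕜 (Sum.inl (posIdx (1 - k))) := if_neg hk.not_gt

theorem psiMode_of_pos {n : ℤ} (hn : 0 < n) :
    psiMode 𝕜 n = hbar 𝕜 * derVar 𝕜 (Sum.inr (posIdx n : WithBot ℕ+)) := if_pos hn

theorem psiMode_of_neg {n : ℤ} (hn : n < 0) :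
    psiMode 𝕜 n = mulVar 𝕜 (Sum.inr (posIdx (-n) : WithBot ℕ+)) := by
  rw [psiMode, if_neg hn.not_gt, if_pos hn]; rfl

theorem psiMode_zero : psiMode 𝕜 0 = ((Real.sqrt 2 : ℝ) : 𝕜)⁻¹ •
    (mulVar 𝕜 (Sum.inr ⊥) + hbar 𝕜 * derVar 𝕜 (Sum.inr ⊥)) := by
  rw [psiMode, if_neg (lt_irrefl _), if_neg (lt_irrefl _)]; rfl

theorem bMode_mem (k : ℤ) : bMode 𝕜 k ∈ polyWeyl 𝕜 ℕ+ (WithBot ℕ+) := by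
  rcases lt_or_ge 0 k with h | h
  · rw [bMode_of_pos 𝕜 h]; exact hbar_derVar_mem_polyWeyl 𝕜 _
  · rw [bMode_of_nonpos 𝕜 h]; exact Subalgebra.smul_mem _ (mulVar_mem_polyWeyl 𝕜 _) _

theorem psiMode_mem (n : ℤ) : psiMode 𝕜 n ∈ polyWeyl 𝕜 ℕ+ (WithBot ℕ+) := by
  rcases lt_trichotomy n 0 with h | rfl | h
  · rw [psiMode_of_neg 𝕜 h]; exact mulVar_mem_polyWeyl 𝕜 _
  · rw [psiMode_zero]
    exact Subalgebra.smul_mem _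
      (add_mem (mulVar_mem_polyWeyl 𝕜 _) (hbar_derVar_mem_polyWeyl 𝕜 _)) _
  · rw [psiMode_of_pos 𝕜 h]; exact hbar_derVar_mem_polyWeyl 𝕜 _

theorem bMode_memHat (k : ℤ) : bMode 𝕜 k ∈ weylAlg 𝕜 ℕ+ (WithBot ℕ+) :=
  polyWeyl_le_weylAlg 𝕜 (bMode_mem 𝕜 k)

theorem psiMode_memHat (n : ℤ) : psiMode 𝕜 n ∈ weylAlg 𝕜 ℕ+ (WithBot ℕ+) :=
  polyWeyl_le_weylAlg 𝕜 (psiMode_mem 𝕜 n)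

theorem isFil_bMode (k : ℤ) : IsFil (bMode 𝕜 k) := isFil_of_mem_polyWeyl 𝕜 (bMode_mem 𝕜 k)
theorem isFil_psiMode (n : ℤ) : IsFil (psiMode 𝕜 n) := isFil_of_mem_polyWeyl 𝕜 (psiMode_mem 𝕜 n)

theorem hasParity_bMode (k : ℤ) : HasParity false (bMode 𝕜 k) := by
  rcases lt_or_ge 0 k with h | h
  · rw [bMode_of_pos 𝕜 h]; exact hasParity_hbar_derVar 𝕜 _
  · rw [bMode_of_nonpos 𝕜 h]; exact (hasParity_mulVar 𝕜 _).smul _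

theorem hasParity_psiMode (n : ℤ) : HasParity true (psiMode 𝕜 n) := by
  rcases lt_trichotomy n 0 with h | rfl | h
  · rw [psiMode_of_neg 𝕜 h]; exact hasParity_mulVar 𝕜 _
  · rw [psiMode_zero]
    exact ((hasParity_mulVar 𝕜 _).add (hasParity_hbar_derVar 𝕜 _)).smul _
  · rw [psiMode_of_pos 𝕜 h]; exact hasParity_hbar_derVar 𝕜 _

theorem superComm_bMode_bMode (k l : ℤ) : superComm (bMode 𝕜 k) (bMode 𝕜 l)
    = if k + l = 1 then ((k : 𝕜) - 1 / 2) • hbar 𝕜 else 0 := by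
  classical
  rcases lt_or_ge 0 k with hk | hk <;> rcases lt_or_ge 0 l with hl | hl
  · rw [bMode_of_pos 𝕜 hk, bMode_of_pos 𝕜 hl, superComm_hbar_derVar_hbar_derVar,
      if_neg (by omega)]
  · rw [bMode_of_pos 𝕜 hk, bMode_of_nonpos 𝕜 hl, superComm_smul_right,
      superComm_hbar_derVar_mulVar]
    simp only [Sum.inl.injEq, posIdx_inj hk (show 0 < 1 - l by omega)]
    by_cases h : k + l = 1
    · obtain rfl : l = 1 - k := by omega
      rw [if_pos (by omega), if_pos h]
      congr 1; push_cast; ring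
    · rw [if_neg (by omega), if_neg h, smul_zero]
  · rw [bMode_of_nonpos 𝕜 hk, bMode_of_pos 𝕜 hl, superComm_smul_left,
      superComm_mulVar_hbar_derVar]
    simp only [Sum.inl.injEq, posIdx_inj (show 0 < 1 - k by omega) hl]
    by_cases h : k + l = 1
    · rw [if_pos (by omega), if_pos h]
      simp only [varParity, Sum.isRight_inl, Bool.false_eq_true, if_false]
      module
    · rw [if_neg (by omega), if_neg h, smul_zero]
  · rw [bMode_of_nonpos 𝕜 hk, bMode_of_nonpos 𝕜 hl, superComm_smul_left, superComm_smul_right,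
      superComm_mulVar_mulVar, smul_zero, smul_zero, if_neg (by omega)]

theorem sqrt_two_inv_mul_self :
    ((Real.sqrt 2 : ℝ) : 𝕜)⁻¹ * ((Real.sqrt 2 : ℝ) : 𝕜)⁻¹ = (1 / 2 : 𝕜) := by
  rw [← mul_inv, ← RCLike.ofReal_mul, Real.mul_self_sqrt (by norm_num), RCLike.ofReal_ofNat, one_div]

theorem superComm_psiMode_psiMode (m n : ℤ) : superComm (psiMode 𝕜 m) (psiMode 𝕜 n)
    = if m + n = 0 then hbar 𝕜 else 0 := by
  classical
  have hp : ∀ k : ℕ+, varParity (Sum.inr (k : WithBot ℕ+) : ℕ+ ⊕ WithBot ℕ+) = true := fun _ => rfl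
  have hb : varParity (Sum.inr ⊥ : ℕ+ ⊕ WithBot ℕ+) = true := rfl
  rcases lt_trichotomy m 0 with hm | rfl | hm <;> rcases lt_trichotomy n 0 with hn | rfl | hn
  · rw [psiMode_of_neg 𝕜 hm, psiMode_of_neg 𝕜 hn, superComm_mulVar_mulVar, if_neg (by omega)]
  · rw [psiMode_of_neg 𝕜 hm, psiMode_zero, superComm_smul_right, superComm_add_right,
      superComm_mulVar_mulVar, superComm_mulVar_hbar_derVar, if_neg (by simp), if_neg (by omega)]
    simp
  · rw [psiMode_of_neg 𝕜 hm, psiMode_of_pos 𝕜 hn, superComm_mulVar_hbar_derVar]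
    simp only [Sum.inr.injEq, WithBot.coe_inj, posIdx_inj (show 0 < -m by omega) hn, hp, if_true]
    exact if_congr (by omega) rfl rfl
  · rw [psiMode_of_neg 𝕜 hn, psiMode_zero, superComm_smul_left, superComm_add_left,
      superComm_mulVar_mulVar, superComm_hbar_derVar_mulVar, if_neg (by simp), if_neg (by omega)]
    simp
  · rw [psiMode_zero, superComm_smul_left, superComm_smul_right, superComm_add_left,
      superComm_add_right, superComm_add_right, superComm_mulVar_mulVar,
      superComm_hbar_derVar_mulVar, superComm_mulVar_hbar_derVar,
      superComm_hbar_derVar_hbar_derVar, smul_smul, sqrt_two_inv_mul_self, if_pos rfl, if_pos rfl,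
      hb, if_pos rfl, if_pos (by rfl)]
    module
  · rw [psiMode_of_pos 𝕜 hn, psiMode_zero, superComm_smul_left, superComm_add_left,
      superComm_hbar_derVar_hbar_derVar, superComm_mulVar_hbar_derVar, if_neg (by simp),
      if_neg (by omega)]
    simp
  · rw [psiMode_of_pos 𝕜 hm, psiMode_of_neg 𝕜 hn, superComm_hbar_derVar_mulVar]
    simp only [Sum.inr.injEq, WithBot.coe_inj, posIdx_inj hm (show 0 < -n by omega)]
    exact if_congr (by omega) rfl rfl
  · rw [psiMode_of_pos 𝕜 hm, psiMode_zero, superComm_smul_right, superComm_add_right,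
      superComm_hbar_derVar_hbar_derVar, superComm_hbar_derVar_mulVar, if_neg (by simp),
      if_neg (by omega)]
    simp
  · rw [psiMode_of_pos 𝕜 hm, psiMode_of_pos 𝕜 hn, superComm_hbar_derVar_hbar_derVar,
      if_neg (by omega)]

theorem superComm_bMode_psiMode (k n : ℤ) : superComm (bMode 𝕜 k) (psiMode 𝕜 n) = 0 := by
  classical
  have h : ∃ s t s' t' : 𝕜, ∃ i : ℕ+, ∃ j : WithBot ℕ+,
      bMode 𝕜 k = s • mulVar 𝕜 (Sum.inl i) + t • (hbar 𝕜 * derVar 𝕜 (Sum.inl i)) ∧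
      psiMode 𝕜 n = s' • mulVar 𝕜 (Sum.inr j) + t' • (hbar 𝕜 * derVar 𝕜 (Sum.inr j)) := by
    have h1 : ∃ s t : 𝕜, ∃ i : ℕ+,
        bMode 𝕜 k = s • mulVar 𝕜 (Sum.inl i) + t • (hbar 𝕜 * derVar 𝕜 (Sum.inl i)) := by
      rcases lt_or_ge 0 k with h | h
      · exact ⟨0, 1, _, by rw [bMode_of_pos 𝕜 h, zero_smul, one_smul, zero_add]⟩
      · exact ⟨(1 / 2 : 𝕜) - k, 0, posIdx (1 - k), by rw [bMode_of_nonpos 𝕜 h, zero_smul 𝕜, add_zero]⟩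
    have h2 : ∃ s t : 𝕜, ∃ j : WithBot ℕ+,
        psiMode 𝕜 n = s • mulVar 𝕜 (Sum.inr j) + t • (hbar 𝕜 * derVar 𝕜 (Sum.inr j)) := by
      rcases lt_trichotomy n 0 with h | rfl | h
      · exact ⟨1, 0, _, by rw [psiMode_of_neg 𝕜 h, zero_smul, one_smul, add_zero]⟩
      · exact ⟨_, _, _, by rw [psiMode_zero, smul_add]⟩
      · exact ⟨0, 1, _, by rw [psiMode_of_pos 𝕜 h, zero_smul, one_smul, zero_add]⟩
    obtain ⟨s, t, i, h1⟩ := h1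
    obtain ⟨s', t', j, h2⟩ := h2
    exact ⟨s, t, s', t', i, j, h1, h2⟩
  obtain ⟨s, t, s', t', i, j, h1, h2⟩ := h
  rw [h1, h2]
  simp only [superComm_add_left, superComm_add_right, superComm_smul_left, superComm_smul_right,
    superComm_mulVar_mulVar, superComm_hbar_derVar_mulVar, superComm_mulVar_hbar_derVar,
    superComm_hbar_derVar_hbar_derVar, reduceCtorEq, if_false, smul_zero, add_zero]

/-- The odd combination `θ 0 - ħ ∂ / ∂ θ 0`, which anticommutes with all modes `ψ n`. -/
noncomputable def chiMode : TwOp 𝕜 := mulVar 𝕜 (Sum.inr ⊥) - hbar 𝕜 * derVar 𝕜 (Sum.inr ⊥)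

theorem chiMode_mem : chiMode 𝕜 ∈ polyWeyl 𝕜 ℕ+ (WithBot ℕ+) :=
  sub_mem (mulVar_mem_polyWeyl 𝕜 _) (hbar_derVar_mem_polyWeyl 𝕜 _)

theorem hasParity_chiMode : HasParity true (chiMode 𝕜) :=
  (hasParity_mulVar 𝕜 _).sub (hasParity_hbar_derVar 𝕜 _)

theorem superComm_psiMode_chiMode (n : ℤ) : superComm (psiMode 𝕜 n) (chiMode 𝕜) = 0 := by
  classical
  have hb : varParity (Sum.inr ⊥ : ℕ+ ⊕ WithBot ℕ+) = true := rfl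
  rw [chiMode, sub_eq_add_neg, ← neg_one_smul 𝕜, superComm_add_right, superComm_smul_right]
  rcases lt_trichotomy n 0 with h | rfl | h
  · rw [psiMode_of_neg 𝕜 h, superComm_mulVar_mulVar, superComm_mulVar_hbar_derVar,
      if_neg (by simp)]
    simp
  · rw [psiMode_zero, superComm_smul_left, superComm_smul_left, superComm_add_left,
      superComm_add_left, superComm_mulVar_mulVar,
      superComm_hbar_derVar_mulVar, superComm_mulVar_hbar_derVar,
      superComm_hbar_derVar_hbar_derVar, if_pos rfl, if_pos rfl, hb, if_pos rfl]
    module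
  · rw [psiMode_of_pos 𝕜 h, superComm_hbar_derVar_mulVar, superComm_hbar_derVar_hbar_derVar,
      if_neg (by simp)]
    simp

theorem superComm_bMode_chiMode (k : ℤ) : superComm (bMode 𝕜 k) (chiMode 𝕜) = 0 := by
  classical
  rw [chiMode, sub_eq_add_neg, ← neg_one_smul 𝕜, superComm_add_right, superComm_smul_right]
  rcases lt_or_ge 0 k with h | h
  · rw [bMode_of_pos 𝕜 h, superComm_hbar_derVar_mulVar, superComm_hbar_derVar_hbar_derVar,
      if_neg (by simp)]
    simp
  · rw [bMode_of_nonpos 𝕜 h, superComm_smul_left, superComm_smul_left, superComm_mulVar_mulVar,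
      superComm_mulVar_hbar_derVar, if_neg (by simp)]
    simp

theorem bMode_mul_comm {k l : ℤ} (h : k + l ≠ 1) :
    bMode 𝕜 k * bMode 𝕜 l = bMode 𝕜 l * bMode 𝕜 k := by
  have := superComm_bMode_bMode 𝕜 k l
  rwa [superComm_of_even_left (hasParity_bMode 𝕜 k), if_neg h, sub_eq_zero] at this

theorem bMode_mul_psiMode (k n : ℤ) :
    bMode 𝕜 k * psiMode 𝕜 n = psiMode 𝕜 n * bMode 𝕜 k := by
  have := superComm_bMode_psiMode 𝕜 k n
  rwa [superComm_of_even_left (hasParity_bMode 𝕜 k), sub_eq_zero] at this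

theorem bNormal_eq (k l : ℤ) : bNormal 𝕜 k l = bMode 𝕜 (min k l) * bMode 𝕜 (max k l) := by
  rw [bNormal]
  split_ifs with h
  · rw [min_eq_right (by omega), max_eq_left (by omega)]
  · rcases le_total k l with hkl | hkl
    · rw [min_eq_left hkl, max_eq_right hkl]
    · rw [min_eq_right hkl, max_eq_left hkl, bMode_mul_comm]
      omega

/-- The positive modes tend to zero pointwise. -/
theorem exists_modes_mem_Fil (f : Ser 𝕜 ℕ+ (WithBot ℕ+)) (d : ℕ) : ∃ K : ℤ, 0 < K ∧ ∀ k, K ≤ k →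
    bMode 𝕜 k f ∈ Fil 𝕜 _ _ d ∧ psiMode 𝕜 k f ∈ Fil 𝕜 _ _ d := by
  have h1 := eventually_hbar_derX f d
  have h2 := (WithBot.coe_injective (α := ℕ+)).tendsto_cofinite.eventually
    (eventually_hbar_derTheta f d)
  obtain ⟨K, hK⟩ := (Set.Finite.bddAbove (s := _) (h1.and h2))
  refine ⟨K + 1, by positivity, fun k hk => ?_⟩
  have hk0 : 0 < k := by have := K.pos; omega
  rw [bMode_of_pos 𝕜 hk0, psiMode_of_pos 𝕜 hk0]
  by_contra hcon
  have := hK hcon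
  have h3 : ((posIdx k : ℕ+) : ℤ) ≤ ((K : ℕ) : ℤ) := by exact_mod_cast this
  rw [coe_posIdx hk0] at h3
  omega

theorem exists_bosonTerm_mem_Fil (f : Ser 𝕜 ℕ+ (WithBot ℕ+)) (d : ℕ) : ∃ K : ℤ, ∀ m k,
    K ≤ k ∨ K ≤ m + 1 - k → bosonTerm 𝕜 m k f ∈ Fil 𝕜 _ _ d := by
  obtain ⟨K, -, hK⟩ := exists_modes_mem_Fil 𝕜 f d
  refine ⟨K, fun m k h => ?_⟩
  rw [bosonTerm, bNormal_eq]
  exact isFil_bMode 𝕜 _ d _ (hK _ (by omega)).1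

theorem exists_fermionTerm_mem_Fil (f : Ser 𝕜 ℕ+ (WithBot ℕ+)) (d : ℕ) : ∃ K : ℤ, ∀ m j,
    K ≤ -j ∨ K ≤ m + j → fermionTerm 𝕜 m j f ∈ Fil 𝕜 _ _ d := by
  obtain ⟨K, -, hK⟩ := exists_modes_mem_Fil 𝕜 f d
  refine ⟨K, fun m j h => ?_⟩
  rw [fermionTerm, psiNormal]
  refine Submodule.smul_mem _ _ ?_
  split_ifs
  · exact isFil_psiMode 𝕜 _ d _ (hK _ (by omega)).2
  · exact neg_mem (isFil_psiMode 𝕜 _ d _ (hK _ (by omega)).2)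

theorem exists_superTerm_mem_Fil (f : Ser 𝕜 ℕ+ (WithBot ℕ+)) (d : ℕ) : ∃ K : ℤ, ∀ j k,
    K ≤ k ∨ K ≤ j - k → superTerm 𝕜 j k f ∈ Fil 𝕜 _ _ d := by
  obtain ⟨K, -, hK⟩ := exists_modes_mem_Fil 𝕜 f d
  refine ⟨K, fun j k h => ?_⟩
  rw [superTerm]
  rcases h with h | h
  · rw [bMode_mul_psiMode]
    exact isFil_psiMode 𝕜 _ d _ (hK _ h).1
  · exact isFil_bMode 𝕜 _ d _ (hK _ h).2

theorem summable_bosonTerm (m : ℤ) : Summable (bosonTerm 𝕜 m) :=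
  summable_of_cofinite fun f d => by
    obtain ⟨K, hK⟩ := exists_bosonTerm_mem_Fil 𝕜 f d
    refine (Set.finite_Ioo (m + 1 - K) K).subset fun k hk => ?_
    by_contra h
    exact hk (hK m k (by simp only [Set.mem_Ioo] at h; omega))

theorem summable_fermionTerm (m : ℤ) : Summable (fermionTerm 𝕜 m) :=
  summable_of_cofinite fun f d => by
    obtain ⟨K, hK⟩ := exists_fermionTerm_mem_Fil 𝕜 f d
    refine (Set.finite_Ioo (-K) (K - m)).subset fun k hk => ?_
    by_contra h
    exact hk (hK m k (by simp only [Set.mem_Ioo] at h; omega))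

theorem summable_superTerm (j : ℤ) : Summable (superTerm 𝕜 j) :=
  summable_of_cofinite fun f d => by
    obtain ⟨K, hK⟩ := exists_superTerm_mem_Fil 𝕜 f d
    refine (Set.finite_Ioo (j - K) K).subset fun k hk => ?_
    by_contra h
    exact hk (hK j k (by simp only [Set.mem_Ioo] at h; omega))

/-- The operators `virasoroL m` and `superG m` tend to zero pointwise. -/
theorem exists_currents_mem_Fil (f : Ser 𝕜 ℕ+ (WithBot ℕ+)) (d : ℕ) : ∃ K : ℤ, ∀ m, K ≤ m →
    virasoroL 𝕜 m f ∈ Fil 𝕜 _ _ d ∧ superG 𝕜 m f ∈ Fil 𝕜 _ _ d := by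
  obtain ⟨K₁, h₁⟩ := exists_bosonTerm_mem_Fil 𝕜 f d
  obtain ⟨K₂, h₂⟩ := exists_fermionTerm_mem_Fil 𝕜 f d
  obtain ⟨K₃, h₃⟩ := exists_superTerm_mem_Fil 𝕜 f d
  refine ⟨1 + 2 * (|K₁| + |K₂| + |K₃|), fun m hm => ?_⟩
  have a₁ := le_abs_self K₁
  have a₂ := le_abs_self K₂
  have a₃ := le_abs_self K₃
  have b₁ := abs_nonneg K₁
  have b₂ := abs_nonneg K₂
  have b₃ := abs_nonneg K₃
  constructor
  · rw [virasoroL, if_neg (by omega), add_zero, fermionPart]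
    refine add_mem (Submodule.smul_mem _ _ ?_) (Submodule.smul_mem _ _ ?_)
    · exact hasSum_apply_mem_Fil (summable_bosonTerm 𝕜 m).hasSum fun k => h₁ m k (by omega)
    · exact hasSum_apply_mem_Fil (summable_fermionTerm 𝕜 m).hasSum fun k => h₂ m k (by omega)
  · exact hasSum_apply_mem_Fil (summable_superTerm 𝕜 m).hasSum fun k => h₃ m k (by omega)

theorem bosonTerm_mem (m k : ℤ) : bosonTerm 𝕜 m k ∈ weylAlg 𝕜 ℕ+ (WithBot ℕ+) := by
  rw [bosonTerm, bNormal_eq]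
  exact mul_mem (bMode_memHat 𝕜 _) (bMode_memHat 𝕜 _)

theorem fermionTerm_mem (m j : ℤ) : fermionTerm 𝕜 m j ∈ weylAlg 𝕜 ℕ+ (WithBot ℕ+) := by
  rw [fermionTerm, psiNormal]
  refine Subalgebra.smul_mem _ ?_ _
  split_ifs
  · exact mul_mem (psiMode_memHat 𝕜 _) (psiMode_memHat 𝕜 _)
  · exact neg_mem (mul_mem (psiMode_memHat 𝕜 _) (psiMode_memHat 𝕜 _))

theorem hasSum_mem_weylAlg {α ι κ : Type*} [LinearOrder κ] {F : α → Op 𝕜 ι κ} {S : Op 𝕜 ι κ}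
    (h : HasSum F S) (hF : ∀ i, F i ∈ weylAlg 𝕜 ι κ) : S ∈ weylAlg 𝕜 ι κ :=
  (isClosed_weylAlg 𝕜).mem_of_tendsto h (Eventually.of_forall fun _ => sum_mem fun i _ => hF i)

theorem hbar_memHat : hbar 𝕜 ∈ weylAlg 𝕜 ℕ+ (WithBot ℕ+) :=
  polyWeyl_le_weylAlg 𝕜 (hbar_mem_polyWeyl 𝕜)

theorem virasoroL_mem (m : ℤ) : virasoroL 𝕜 m ∈ weylAlg 𝕜 ℕ+ (WithBot ℕ+) := by
  rw [virasoroL, fermionPart]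
  refine add_mem (add_mem (Subalgebra.smul_mem _ ?_ _) (Subalgebra.smul_mem _ ?_ _)) ?_
  · exact hasSum_mem_weylAlg 𝕜 (summable_bosonTerm 𝕜 m).hasSum (bosonTerm_mem 𝕜 m)
  · exact hasSum_mem_weylAlg 𝕜 (summable_fermionTerm 𝕜 m).hasSum (fermionTerm_mem 𝕜 m)
  · split_ifs
    exacts [Subalgebra.smul_mem _ (hbar_memHat 𝕜) _, zero_mem (weylAlg 𝕜 _ _)]

theorem superG_mem (j : ℤ) : superG 𝕜 j ∈ weylAlg 𝕜 ℕ+ (WithBot ℕ+) :=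
  hasSum_mem_weylAlg 𝕜 (summable_superTerm 𝕜 j).hasSum fun _ =>
    mul_mem (bMode_memHat 𝕜 _) (psiMode_memHat 𝕜 _)

theorem hasParity_virasoroL (m : ℤ) : HasParity false (virasoroL 𝕜 m) := by
  rw [virasoroL, fermionPart]
  refine ((HasParity.smul _ ?_).add (HasParity.smul _ ?_)).add ?_
  · refine HasParity.hasSum (summable_bosonTerm 𝕜 m).hasSum fun k => ?_
    rw [bosonTerm, bNormal_eq]
    exact (hasParity_bMode 𝕜 _).mul (hasParity_bMode 𝕜 _)
  · refine HasParity.hasSum (summable_fermionTerm 𝕜 m).hasSum fun k => ?_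
    rw [fermionTerm, psiNormal]
    refine HasParity.smul _ ?_
    split_ifs
    · exact (hasParity_psiMode 𝕜 _).mul (hasParity_psiMode 𝕜 _)
    · exact ((hasParity_psiMode 𝕜 _).mul (hasParity_psiMode 𝕜 _)).neg
  · split_ifs
    exacts [hasParity_false_hbar.smul _, HasParity.zero]

theorem hasParity_superG (j : ℤ) : HasParity true (superG 𝕜 j) :=
  HasParity.hasSum (summable_superTerm 𝕜 j).hasSum fun _ =>
    (hasParity_bMode 𝕜 _).mul (hasParity_psiMode 𝕜 _)

end Modes

section SuperLie

variable {𝕜 ι κ : Type*} [Field 𝕜]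

theorem superComm_zero_right (T : Op 𝕜 ι κ) : superComm T 0 = 0 := by
  rw [← superCommHom_apply, map_zero]

theorem superComm_zero_left (T : Op 𝕜 ι κ) : superComm 0 T = 0 := by
  rw [← superCommHom_apply, map_zero, LinearMap.zero_apply]

theorem superComm_sub_left (T T' S : Op 𝕜 ι κ) :
    superComm (T - T') S = superComm T S - superComm T' S := by
  simp only [← superCommHom_apply, map_sub, LinearMap.sub_apply]

theorem superComm_neg_right (T S : Op 𝕜 ι κ) : superComm T (-S) = -superComm T S := by
  simp only [← superCommHom_apply, map_neg]

theorem hasSum_superComm_left {α : Type*} {F : α → Op 𝕜 ι κ} {S X : Op 𝕜 ι κ} (h : HasSum F S)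
    (hX : IsFil X) : HasSum (fun i => superComm (F i) X) (superComm S X) :=
  h.map (superCommHom.flip X : Op 𝕜 ι κ →ₗ[𝕜] Op 𝕜 ι κ) hX.continuous_superComm_left

variable [CharZero 𝕜]

theorem HasParity.superComm {b c : Bool} {T S : Op 𝕜 ι κ} (hT : HasParity b T)
    (hS : HasParity c S) : HasParity (b ^^ c) (superComm T S) := by
  rw [superComm_eq_of_hasParity hT hS]
  have h := hS.mul hT
  rw [Bool.xor_comm] at h
  refine (hT.mul hS).sub ?_
  split_ifs
  exacts [h.neg, h]

/-- The super Jacobi identity. -/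
theorem superComm_superComm {a b c : Bool} {A B C : Op 𝕜 ι κ} (hA : HasParity a A)
    (hB : HasParity b B) (hC : HasParity c C) :
    superComm (superComm A B) C = superComm A (superComm B C)
      - if a && b then -superComm B (superComm A C) else superComm B (superComm A C) := by
  rw [superComm_eq_of_hasParity (hA.superComm hB) hC, superComm_eq_of_hasParity hA (hB.superComm hC),
    superComm_eq_of_hasParity hB (hA.superComm hC), superComm_eq_of_hasParity hA hB,
    superComm_eq_of_hasParity hA hC, superComm_eq_of_hasParity hB hC]
  cases a <;> cases b <;> cases c <;> simp <;> noncomm_ring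

theorem HasParity.superComm_mul_hbar {b : Bool} {T : Op 𝕜 ι κ} (h : HasParity b T)
    (hT : hbar 𝕜 * T = T * hbar 𝕜) (S : Op 𝕜 ι κ) :
    SuperAiry.superComm T (hbar 𝕜 * S) = hbar 𝕜 * SuperAiry.superComm T S := by
  have h0 : twist b (hbar 𝕜 : Op 𝕜 ι κ) = hbar 𝕜 := by
    cases b
    · rfl
    · exact hasParity_false.mp hasParity_false_hbar
  rw [h.superComm_mul, superComm_of_even_right hasParity_false_hbar, hT, sub_self, zero_mul,
    zero_add, h0]

theorem superComm_one (T : Op 𝕜 ι κ) : superComm T 1 = 0 := by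
  rw [superComm_of_even_right (hasParity_false.mpr (map_one _)), mul_one, one_mul, sub_self]

theorem superComm_mem_weylAlg [LinearOrder κ] {T S : Op 𝕜 ι κ} (hT : T ∈ weylAlg 𝕜 ι κ)
    (hS : S ∈ weylAlg 𝕜 ι κ) : superComm T S ∈ weylAlg 𝕜 ι κ := by
  obtain ⟨C, hC, h⟩ := superComm_mem_hbarWeyl hT hS
  rw [← h]
  exact mul_mem (polyWeyl_le_weylAlg 𝕜 (hbar_mem_polyWeyl 𝕜)) hC

end SuperLie

section ModeCommutators

variable (𝕜 : Type*) [RCLike 𝕜]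

theorem superComm_bMode_mul_bMode (k k' l : ℤ) :
    superComm (bMode 𝕜 k * bMode 𝕜 k') (bMode 𝕜 l)
      = (if k' + l = 1 then ((k' : 𝕜) - 1 / 2) • (hbar 𝕜 * bMode 𝕜 k) else 0)
        + if k + l = 1 then ((k : 𝕜) - 1 / 2) • (hbar 𝕜 * bMode 𝕜 k') else 0 := by
  rw [(hasParity_bMode 𝕜 l).mul_superComm, superComm_bMode_bMode, superComm_bMode_bMode,
    twist_false, commute_hbar_of_mem_weylAlg 𝕜 (bMode_memHat 𝕜 k)]
  split_ifs <;> simp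

theorem superComm_bosonTerm_bMode (m k l : ℤ) : superComm (bosonTerm 𝕜 m k) (bMode 𝕜 l)
    = (if k = m + l then ((1 / 2 : 𝕜) - l) • (hbar 𝕜 * bMode 𝕜 (m + l)) else 0)
      + if k = 1 - l then ((1 / 2 : 𝕜) - l) • (hbar 𝕜 * bMode 𝕜 (m + l)) else 0 := by
  have h1 : superComm (bosonTerm 𝕜 m k) (bMode 𝕜 l)
      = superComm (bMode 𝕜 k * bMode 𝕜 (m + 1 - k)) (bMode 𝕜 l) := by
    rw [bosonTerm, bNormal]
    split_ifs
    · rw [superComm_bMode_mul_bMode, superComm_bMode_mul_bMode, add_comm]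
    · rfl
  rw [h1, superComm_bMode_mul_bMode]
  congr 1
  · by_cases h : k = m + l
    · rw [if_pos (by omega), if_pos h, h]
      congr 1; push_cast; ring
    · rw [if_neg (by omega), if_neg h]
  · by_cases h : k = 1 - l
    · rw [if_pos (by omega), if_pos h, show m + 1 - k = m + l by omega, h]
      congr 1; push_cast; ring
    · rw [if_neg (by omega), if_neg h]

theorem superComm_psiMode_mul_psiMode (m n p : ℤ) :
    superComm (psiMode 𝕜 m * psiMode 𝕜 n) (psiMode 𝕜 p)
      = (if n + p = 0 then hbar 𝕜 * psiMode 𝕜 m else 0)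
        - if m + p = 0 then hbar 𝕜 * psiMode 𝕜 n else 0 := by
  rw [(hasParity_psiMode 𝕜 p).mul_superComm, superComm_psiMode_psiMode, superComm_psiMode_psiMode,
    twist_true, hasParity_true.mp (hasParity_psiMode 𝕜 n),
    commute_hbar_of_mem_weylAlg 𝕜 (psiMode_memHat 𝕜 m)]
  split_ifs <;> simp [sub_eq_add_neg]

theorem superComm_fermionTerm_psiMode (m j n : ℤ) :
    superComm (fermionTerm 𝕜 m j) (psiMode 𝕜 n)
      = (if j = -m - n then (-((m : 𝕜) / 2 + n)) • (hbar 𝕜 * psiMode 𝕜 (m + n)) else 0)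
        + if j = n then (-((m : 𝕜) / 2 + n)) • (hbar 𝕜 * psiMode 𝕜 (m + n)) else 0 := by
  have h1 : superComm (psiNormal 𝕜 (-j) (m + j)) (psiMode 𝕜 n)
      = superComm (psiMode 𝕜 (-j) * psiMode 𝕜 (m + j)) (psiMode 𝕜 n) := by
    rw [psiNormal]
    split_ifs
    · rfl
    · rw [← neg_one_smul 𝕜, superComm_smul_left, superComm_psiMode_mul_psiMode,
        superComm_psiMode_mul_psiMode, neg_one_smul, neg_sub]
  rw [fermionTerm, superComm_smul_left, h1, superComm_psiMode_mul_psiMode, smul_sub, sub_eq_add_neg]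
  congr 1
  · by_cases h : j = -m - n
    · rw [if_pos (by omega), if_pos h, show -j = m + n by omega, h]
      congr 1; push_cast; ring
    · rw [if_neg (by omega), if_neg h, smul_zero]
  · by_cases h : j = n
    · rw [if_pos (by omega), if_pos h, h, neg_smul, add_comm]
    · rw [if_neg (by omega), if_neg h, smul_zero, neg_zero]

theorem superComm_fermionTerm_bMode (m j l : ℤ) :
    superComm (fermionTerm 𝕜 m j) (bMode 𝕜 l) = 0 := by
  have h : ∀ p q : ℤ, superComm (psiMode 𝕜 p * psiMode 𝕜 q) (bMode 𝕜 l) = 0 := by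
    intro p q
    rw [(hasParity_bMode 𝕜 l).mul_superComm,
      superComm_swap (hasParity_bMode 𝕜 l) (hasParity_psiMode 𝕜 q),
      superComm_swap (hasParity_bMode 𝕜 l) (hasParity_psiMode 𝕜 p), superComm_bMode_psiMode,
      superComm_bMode_psiMode]
    simp
  rw [fermionTerm, psiNormal, superComm_smul_left]
  split_ifs
  · rw [h, smul_zero]
  · rw [← neg_one_smul 𝕜, superComm_smul_left, h, smul_zero, smul_zero]

theorem superComm_bosonTerm_psiMode (m k n : ℤ) :
    superComm (bosonTerm 𝕜 m k) (psiMode 𝕜 n) = 0 := by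
  rw [bosonTerm, bNormal_eq, (hasParity_psiMode 𝕜 n).mul_superComm, superComm_bMode_psiMode,
    superComm_bMode_psiMode]
  simp

theorem superComm_bosonTerm_chiMode (m k : ℤ) :
    superComm (bosonTerm 𝕜 m k) (chiMode 𝕜) = 0 := by
  rw [bosonTerm, bNormal_eq, (hasParity_chiMode 𝕜).mul_superComm, superComm_bMode_chiMode,
    superComm_bMode_chiMode]
  simp

theorem superComm_fermionTerm_chiMode (m j : ℤ) :
    superComm (fermionTerm 𝕜 m j) (chiMode 𝕜) = 0 := by
  have h : ∀ p q : ℤ, superComm (psiMode 𝕜 p * psiMode 𝕜 q) (chiMode 𝕜) = 0 := by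
    intro p q
    rw [(hasParity_chiMode 𝕜).mul_superComm, superComm_psiMode_chiMode, superComm_psiMode_chiMode]
    simp
  rw [fermionTerm, psiNormal, superComm_smul_left]
  split_ifs
  · rw [h, smul_zero]
  · rw [← neg_one_smul 𝕜, superComm_smul_left, h, smul_zero, smul_zero]

theorem superComm_eq_zero_of_hasSum {α ι κ : Type*} {F : α → Op 𝕜 ι κ} {S X : Op 𝕜 ι κ}
    (h : HasSum F S) (hX : IsFil X) (h0 : ∀ i, superComm (F i) X = 0) : superComm S X = 0 := by
  have h1 := hasSum_superComm_left h hX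
  simp only [h0] at h1
  exact h1.unique hasSum_zero

theorem isFil_chiMode : IsFil (chiMode 𝕜) := isFil_of_mem_polyWeyl 𝕜 (chiMode_mem 𝕜)

theorem superComm_hbar_ite (p : Prop) [Decidable p] (c : 𝕜) (T : TwOp 𝕜)
    (hT : T ∈ weylAlg 𝕜 ℕ+ (WithBot ℕ+)) :
    superComm (if p then c • hbar 𝕜 else 0) T = 0 := by
  split_ifs
  · rw [superComm_smul_left, superComm_hbar T hT, smul_zero]
  · exact superComm_zero_left T

theorem superComm_virasoroL_bMode (m l : ℤ) : superComm (virasoroL 𝕜 m) (bMode 𝕜 l)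
    = ((1 / 2 : 𝕜) - l) • (hbar 𝕜 * bMode 𝕜 (m + l)) := by
  have h1 := hasSum_superComm_left (summable_bosonTerm 𝕜 m).hasSum (isFil_bMode 𝕜 l)
  simp only [superComm_bosonTerm_bMode] at h1
  have h2 := h1.unique ((hasSum_ite_eq (m + l) _).add (hasSum_ite_eq (1 - l) _))
  rw [virasoroL, fermionPart, superComm_add_left, superComm_add_left, superComm_smul_left,
    superComm_smul_left, h2, superComm_eq_zero_of_hasSum 𝕜 (summable_fermionTerm 𝕜 m).hasSum
      (isFil_bMode 𝕜 l) fun j => superComm_fermionTerm_bMode 𝕜 m j l,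
    superComm_hbar_ite 𝕜 _ _ _ (bMode_memHat 𝕜 l)]
  module

theorem superComm_virasoroL_psiMode (m n : ℤ) : superComm (virasoroL 𝕜 m) (psiMode 𝕜 n)
    = (-((m : 𝕜) / 2 + n)) • (hbar 𝕜 * psiMode 𝕜 (m + n)) := by
  have h1 := hasSum_superComm_left (summable_fermionTerm 𝕜 m).hasSum (isFil_psiMode 𝕜 n)
  simp only [superComm_fermionTerm_psiMode] at h1
  have h2 := h1.unique ((hasSum_ite_eq (-m - n) _).add (hasSum_ite_eq n _))
  rw [virasoroL, fermionPart, superComm_add_left, superComm_add_left, superComm_smul_left,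
    superComm_smul_left, h2, superComm_eq_zero_of_hasSum 𝕜 (summable_bosonTerm 𝕜 m).hasSum
      (isFil_psiMode 𝕜 n) fun k => superComm_bosonTerm_psiMode 𝕜 m k n,
    superComm_hbar_ite 𝕜 _ _ _ (psiMode_memHat 𝕜 n)]
  module

theorem superComm_virasoroL_chiMode (m : ℤ) : superComm (virasoroL 𝕜 m) (chiMode 𝕜) = 0 := by
  rw [virasoroL, fermionPart, superComm_add_left, superComm_add_left, superComm_smul_left,
    superComm_smul_left, superComm_eq_zero_of_hasSum 𝕜 (summable_bosonTerm 𝕜 m).hasSum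
      (isFil_chiMode 𝕜) (superComm_bosonTerm_chiMode 𝕜 m),
    superComm_eq_zero_of_hasSum 𝕜 (summable_fermionTerm 𝕜 m).hasSum
      (isFil_chiMode 𝕜) (superComm_fermionTerm_chiMode 𝕜 m),
    superComm_hbar_ite 𝕜 _ _ _ (polyWeyl_le_weylAlg 𝕜 (chiMode_mem 𝕜))]
  module

theorem superComm_superG_psiMode (j n : ℤ) : superComm (superG 𝕜 j) (psiMode 𝕜 n)
    = hbar 𝕜 * bMode 𝕜 (j + n) := by
  have h1 := hasSum_superComm_left (summable_superTerm 𝕜 j).hasSum (isFil_psiMode 𝕜 n)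
  have h2 : ∀ k, superComm (superTerm 𝕜 j k) (psiMode 𝕜 n)
      = if k = j + n then hbar 𝕜 * bMode 𝕜 (j + n) else 0 := by
    intro k
    rw [superTerm, (hasParity_psiMode 𝕜 n).mul_superComm, superComm_bMode_psiMode,
      superComm_psiMode_psiMode, zero_mul, add_zero]
    by_cases h : k = j + n
    · rw [if_pos (by omega), if_pos h, h, commute_hbar_of_mem_weylAlg 𝕜 (bMode_memHat 𝕜 _)]
    · rw [if_neg (by omega), if_neg h, mul_zero]
  simp only [h2] at h1
  exact h1.unique (hasSum_ite_eq _ _)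

theorem superComm_superG_bMode (j l : ℤ) : superComm (superG 𝕜 j) (bMode 𝕜 l)
    = ((1 / 2 : 𝕜) - l) • (hbar 𝕜 * psiMode 𝕜 (j - 1 + l)) := by
  have h1 := hasSum_superComm_left (summable_superTerm 𝕜 j).hasSum (isFil_bMode 𝕜 l)
  have h2 : ∀ k, superComm (superTerm 𝕜 j k) (bMode 𝕜 l)
      = if k = 1 - l then ((1 / 2 : 𝕜) - l) • (hbar 𝕜 * psiMode 𝕜 (j - 1 + l)) else 0 := by
    intro k
    rw [superTerm, (hasParity_bMode 𝕜 l).mul_superComm, superComm_bMode_bMode,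
      superComm_swap (hasParity_bMode 𝕜 l) (hasParity_psiMode 𝕜 _), superComm_bMode_psiMode,
      twist_false]
    by_cases h : k = 1 - l
    · rw [if_pos (by omega : k + l = 1), if_pos h, smul_mul_assoc, h,
        show j - (1 - l) = j - 1 + l by omega]
      simp only [Bool.false_and, Bool.false_eq_true, if_false, neg_zero, mul_zero, zero_add]
      congr 1; push_cast; ring
    · rw [if_neg (by omega : ¬ k + l = 1), if_neg h]
      simp
  simp only [h2] at h1
  exact h1.unique (hasSum_ite_eq _ _)

theorem superComm_superG_chiMode (j : ℤ) : superComm (superG 𝕜 j) (chiMode 𝕜) = 0 :=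
  superComm_eq_zero_of_hasSum 𝕜 (summable_superTerm 𝕜 j).hasSum (isFil_chiMode 𝕜) fun k => by
    rw [superTerm, (hasParity_chiMode 𝕜).mul_superComm, superComm_bMode_chiMode,
      superComm_psiMode_chiMode]
    simp

end ModeCommutators

section AiryCommutators

variable {𝕜 : Type*} [RCLike 𝕜] {N : ℤ} {D : ℤ → 𝕜}

theorem airyH_eq {i : ℤ} (hi : 1 ≤ i) : airyH 𝕜 N D i
    = bMode 𝕜 i + virasoroL 𝕜 (i + N - 1) + if i ≤ N + 1 then D i • hbar 𝕜 else 0 := by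
  rw [airyH, bMode, if_pos (show 0 < i by omega)]

theorem airyF_eq {j : ℤ} (hj : 1 ≤ j) : airyF 𝕜 N j = psiMode 𝕜 j + superG 𝕜 (j + N) := by
  rw [airyF, psiMode, if_pos (show 0 < j by omega)]

theorem airyH_mem (i : ℤ) : airyH 𝕜 N D i ∈ weylAlg 𝕜 ℕ+ (WithBot ℕ+) := by
  rw [airyH]
  refine add_mem (add_mem ?_ (virasoroL_mem 𝕜 _)) ?_
  · exact polyWeyl_le_weylAlg 𝕜 (hbar_derVar_mem_polyWeyl 𝕜 _)
  · split_ifs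
    exacts [Subalgebra.smul_mem _ (hbar_memHat 𝕜) _, zero_mem (weylAlg 𝕜 _ _)]

theorem airyF_mem (j : ℤ) : airyF 𝕜 N j ∈ weylAlg 𝕜 ℕ+ (WithBot ℕ+) :=
  add_mem (polyWeyl_le_weylAlg 𝕜 (hbar_derVar_mem_polyWeyl 𝕜 _)) (superG_mem 𝕜 _)

theorem hasParity_airyH (i : ℤ) : HasParity false (airyH 𝕜 N D i) := by
  rw [airyH]
  refine ((hasParity_hbar_derVar 𝕜 (Sum.inl _)).add (hasParity_virasoroL 𝕜 _)).add ?_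
  split_ifs
  exacts [hasParity_false_hbar.smul _, HasParity.zero]

theorem hasParity_airyF (j : ℤ) : HasParity true (airyF 𝕜 N j) :=
  (hasParity_hbar_derVar 𝕜 (Sum.inr _)).add (hasParity_superG 𝕜 _)

variable (𝕜 N) in
/-- The bosonic modes, with `b_{N - 1/2}` shifted by a constant. -/
noncomputable def bShift (k : ℤ) : TwOp 𝕜 := bMode 𝕜 k + if k = N then 1 else 0

theorem superComm_bShift (T : TwOp 𝕜) (k : ℤ) :
    superComm T (bShift 𝕜 N k) = superComm T (bMode 𝕜 k) := by
  rw [bShift, superComm_add_right]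
  split_ifs
  · rw [superComm_one, add_zero]
  · rw [superComm_zero_right, add_zero]

theorem superComm_airyH_bMode {i : ℤ} (hi : 1 ≤ i) (k : ℤ) :
    superComm (airyH 𝕜 N D i) (bMode 𝕜 k)
      = ((1 / 2 : 𝕜) - k) • (hbar 𝕜 * bShift 𝕜 N (i + N - 1 + k)) := by
  rw [airyH_eq hi, superComm_add_left, superComm_add_left, superComm_bMode_bMode,
    superComm_virasoroL_bMode, superComm_hbar_ite 𝕜 _ _ _ (bMode_memHat 𝕜 k), bShift, add_zero,
    mul_add, smul_add, add_comm]
  congr 1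
  by_cases h : i + k = 1
  · rw [if_pos h, if_pos (by omega), mul_one]
    obtain rfl : i = 1 - k := by omega
    congr 1; push_cast; ring
  · rw [if_neg h, if_neg (by omega), mul_zero, smul_zero]

theorem superComm_airyH_psiMode {i : ℤ} (hi : 1 ≤ i) (n : ℤ) :
    superComm (airyH 𝕜 N D i) (psiMode 𝕜 n)
      = (-(((i : 𝕜) + N - 1) / 2 + n)) • (hbar 𝕜 * psiMode 𝕜 (i + N - 1 + n)) := by
  rw [airyH_eq hi, superComm_add_left, superComm_add_left, superComm_bMode_psiMode,
    superComm_virasoroL_psiMode, superComm_hbar_ite 𝕜 _ _ _ (psiMode_memHat 𝕜 n), add_zero,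
    zero_add]
  push_cast
  rfl

theorem superComm_airyH_chiMode {i : ℤ} (hi : 1 ≤ i) :
    superComm (airyH 𝕜 N D i) (chiMode 𝕜) = 0 := by
  rw [airyH_eq hi, superComm_add_left, superComm_add_left, superComm_bMode_chiMode,
    superComm_virasoroL_chiMode,
    superComm_hbar_ite 𝕜 _ _ _ (polyWeyl_le_weylAlg 𝕜 (chiMode_mem 𝕜)), add_zero, zero_add]

theorem superComm_airyF_psiMode {j : ℤ} (hj : 1 ≤ j) (n : ℤ) :
    superComm (airyF 𝕜 N j) (psiMode 𝕜 n) = hbar 𝕜 * bShift 𝕜 N (j + N + n) := by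
  rw [airyF_eq hj, superComm_add_left, superComm_psiMode_psiMode, superComm_superG_psiMode,
    bShift, mul_add, add_comm]
  congr 1
  by_cases h : j + n = 0
  · rw [if_pos h, if_pos (by omega), mul_one]
  · rw [if_neg h, if_neg (by omega), mul_zero]

theorem superComm_airyF_bMode {j : ℤ} (hj : 1 ≤ j) (l : ℤ) :
    superComm (airyF 𝕜 N j) (bMode 𝕜 l)
      = ((1 / 2 : 𝕜) - l) • (hbar 𝕜 * psiMode 𝕜 (j + N - 1 + l)) := by
  rw [airyF_eq hj, superComm_add_left, superComm_superG_bMode,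
    superComm_swap (hasParity_bMode 𝕜 l) (hasParity_psiMode 𝕜 j), superComm_bMode_psiMode]
  simp

theorem superComm_airyF_chiMode {j : ℤ} (hj : 1 ≤ j) :
    superComm (airyF 𝕜 N j) (chiMode 𝕜) = 0 := by
  rw [airyF_eq hj, superComm_add_left, superComm_superG_chiMode, superComm_psiMode_chiMode,
    add_zero]

end AiryCommutators

section Vacuum

variable {𝕜 ι κ : Type*} [Field 𝕜]

open Classical in
/-- A monomial as a series. -/
noncomputable def monoSer (𝕜 : Type*) {ι κ : Type*} [Field 𝕜] (μ : Mono ι κ) : Ser 𝕜 ι κ :=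
  ⟨fun ν => if ν = μ then 1 else 0, fun d => (Set.finite_singleton μ).subset fun ν hν => by
    by_contra h
    exact hν.2 (if_neg h)⟩

open Classical in
theorem monoSer_coeff (μ ν : Mono ι κ) :
    (monoSer 𝕜 μ).coeff ν = if ν = μ then 1 else 0 := rfl

/-- The series `1`. -/
noncomputable def vac (𝕜 : Type*) {ι κ : Type*} [Field 𝕜] : Ser 𝕜 ι κ := monoSer 𝕜 ⟨0, 0, ∅⟩

theorem hbar_monoSer (p : ℕ) (a : ι →₀ ℕ) (S : Finset κ) :
    hbar 𝕜 (monoSer 𝕜 ⟨p, a, S⟩) = monoSer 𝕜 ⟨p + 1, a, S⟩ := by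
  classical
  refine Ser.ext fun ⟨q, b, T⟩ => ?_
  rw [hbar_coeff, monoSer_coeff, monoSer_coeff, ← ite_and]
  refine if_congr ?_ rfl rfl
  simp only [Mono.mk.injEq]
  exact ⟨fun h => ⟨by omega, h.2.2⟩, fun h => ⟨by omega, by omega, h.2⟩⟩

theorem mulX_monoSer (i : ι) (p : ℕ) (a : ι →₀ ℕ) (S : Finset κ) :
    mulX 𝕜 i (monoSer 𝕜 ⟨p, a, S⟩) = monoSer 𝕜 ⟨p, a + Finsupp.single i 1, S⟩ := by
  classical
  refine Ser.ext fun ⟨q, b, T⟩ => ?_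
  rw [mulX_coeff, monoSer_coeff, monoSer_coeff, ← ite_and]
  refine if_congr ?_ rfl rfl
  simp only [Mono.mk.injEq]
  constructor
  · rintro ⟨h1, h2, h3, h4⟩
    exact ⟨h2, by rw [← h3, tsub_add_cancel_of_le (Finsupp.single_le_iff.mpr h1)], h4⟩
  · rintro ⟨h1, rfl, h2⟩
    exact ⟨by simp, h1, by simp, h2⟩

theorem mulTheta_monoSer [LinearOrder κ] (j : κ) (p : ℕ) (a : ι →₀ ℕ) {S : Finset κ} (hj : j ∉ S) :
    mulTheta 𝕜 j (monoSer 𝕜 ⟨p, a, S⟩) = thetaSign 𝕜 j S • monoSer 𝕜 ⟨p, a, insert j S⟩ := by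
  classical
  refine Ser.ext fun ⟨q, b, T⟩ => ?_
  rw [mulTheta_coeff, coeff_smul, monoSer_coeff, monoSer_coeff]
  simp only [Mono.mk.injEq]
  by_cases h : T = insert j S
  · subst h
    rw [if_pos (Finset.mem_insert_self j S), thetaSign_insert hj, if_neg (lt_irrefl _),
      Finset.erase_insert hj]
    simp
  · rw [if_neg (c := _ ∧ _ ∧ T = insert j S) (fun h' => h h'.2.2), mul_zero]
    split_ifs with h1 h2
    · exact absurd (by rw [← h2.2.2, Finset.insert_erase h1]) h
    · simp
    · rfl

theorem monoSer_mem [LinearOrder κ] (K : Submodule 𝕜 (Ser 𝕜 ι κ)) (h1 : vac 𝕜 ∈ K)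
    (hh : ∀ f ∈ K, hbar 𝕜 f ∈ K) (hm : ∀ a, ∀ f ∈ K, mulVar 𝕜 a f ∈ K) (μ : Mono ι κ) :
    monoSer 𝕜 μ ∈ K := by
  obtain ⟨p, a, S⟩ := μ
  induction p with
  | succ p ih => rw [← hbar_monoSer]; exact hh _ ih
  | zero =>
    induction h : a.degree generalizing a with
    | zero =>
      obtain rfl := (Finsupp.degree_eq_zero_iff a).mp h
      induction S using Finset.induction_on with
      | empty => exact h1
      | insert j S hj ih =>
        have h := hm (Sum.inr j) _ ih
        change mulTheta 𝕜 j _ ∈ K at h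
        rw [mulTheta_monoSer j _ _ hj] at h
        have := K.smul_mem (thetaSign 𝕜 j S) h
        rwa [smul_smul, thetaSign_mul_self, one_smul] at this
    | succ n ih =>
      obtain ⟨i, hi⟩ : ∃ i, a i ≠ 0 := by
        by_contra! h0
        rw [show a = 0 from Finsupp.ext h0, map_zero] at h
        omega
      have ha : a = a - Finsupp.single i 1 + Finsupp.single i 1 :=
        (tsub_add_cancel_of_le (Finsupp.single_le_iff.mpr (Nat.one_le_iff_ne_zero.mpr hi))).symm
      have hd : (a - Finsupp.single i 1).degree = n := by
        rw [ha, map_add, Finsupp.degree_single] at h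
        omega
      rw [ha, ← mulX_monoSer]
      exact hm (Sum.inl i) _ (ih _ hd)

theorem IsFil.eq_zero_of_monoSer {T : Op 𝕜 ι κ} (hT : IsFil T)
    (h : ∀ μ, T (monoSer 𝕜 μ) = 0) : T = 0 := by
  classical
  refine LinearMap.ext fun f => ?_
  rw [LinearMap.zero_apply]
  refine eq_of_forall_sub_mem_Fil fun d => ?_
  set s := (f.finite_deg_lt d).toFinset
  have h1 : f - ∑ μ ∈ s, f.coeff μ • monoSer 𝕜 μ ∈ Fil 𝕜 ι κ d := by
    intro ν hν
    rw [coeff_sub, coeff_sum]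
    simp only [coeff_smul, monoSer_coeff, mul_ite, mul_one, mul_zero]
    rw [Finset.sum_ite_eq, sub_eq_zero]
    split_ifs with h'
    · rfl
    · by_contra h0
      exact h' ((Set.Finite.mem_toFinset _).mpr ⟨hν, h0⟩)
  have h2 := hT d _ h1
  rwa [map_sub, map_sum, Finset.sum_eq_zero fun μ _ => by rw [map_smul, h, smul_zero]] at h2

theorem hbar_derVar_vac [LinearOrder κ] (a : ι ⊕ κ) :
    (hbar 𝕜 * derVar 𝕜 a : Op 𝕜 ι κ) (vac 𝕜) = 0 := by
  have h : (derVar 𝕜 a : Op 𝕜 ι κ) (vac 𝕜) = 0 := by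
    refine Ser.ext fun μ => ?_
    rw [coeff_zero]
    rcases a with i | j
    · refine (derX_coeff i _ μ).trans ?_
      rw [vac, monoSer_coeff, if_neg, mul_zero]
      simp [Mono.mk.injEq]
    · refine (derTheta_coeff j _ μ).trans ?_
      have h0 : (vac 𝕜 : Ser 𝕜 ι κ).coeff ⟨μ.hExp, μ.xExp, insert j μ.odd⟩ = 0 := by
        rw [vac, monoSer_coeff, if_neg]
        simp [Mono.mk.injEq]
      rw [h0, mul_zero, ite_self]
  rw [Module.End.mul_apply, h, map_zero]

theorem hasSum_apply_eq {α : Type*} {F : α → Op 𝕜 ι κ} {S : Op 𝕜 ι κ} (h : HasSum F S)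
    {f : Ser 𝕜 ι κ} (s : Finset α) (hF : ∀ i ∉ s, F i f = 0) : S f = ∑ i ∈ s, F i f :=
  eq_of_forall_sub_mem_Fil fun d => hasSum_apply_sub_mem_Fil h s fun i hi => by
    rw [hF i hi]; exact zero_mem _

end Vacuum

section Schur

variable {𝕜 : Type*} [RCLike 𝕜]

/-- The operator super-commutes with all modes. -/
structure CommutesWithModes (Z : TwOp 𝕜) : Prop where
  bMode : ∀ k, superComm Z (bMode 𝕜 k) = 0
  psiMode : ∀ n, superComm Z (psiMode 𝕜 n) = 0
  chiMode : superComm Z (chiMode 𝕜) = 0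

theorem sqrt_two_ne_zero : ((Real.sqrt 2 : ℝ) : 𝕜) ≠ 0 := by
  rw [Ne, RCLike.ofReal_eq_zero]
  positivity

theorem CommutesWithModes.mulVar {Z : TwOp 𝕜} (h : CommutesWithModes Z) (a : ℕ+ ⊕ WithBot ℕ+) :
    superComm Z (mulVar 𝕜 a) = 0 := by
  rcases a with i | j
  · have h1 := h.bMode (1 - (i : ℕ))
    have hi : (1 : ℤ) ≤ (i : ℕ) := by exact_mod_cast i.pos
    rw [bMode_of_nonpos 𝕜 (by omega), sub_sub_cancel, posIdx_coe, superComm_smul_right] at h1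
    refine (smul_eq_zero.mp h1).resolve_left fun h2 => ?_
    have h3 : ((2 * (i : ℕ) - 1 : ℤ) : 𝕜) = 0 := by
      push_cast at h2 ⊢
      linear_combination 2 * h2
    have := Int.cast_eq_zero.mp h3
    omega
  · induction j using WithBot.recBotCoe with
    | bot =>
      have h1 := h.psiMode 0
      rw [psiMode_zero, superComm_smul_right, superComm_add_right] at h1
      have h2 := (smul_eq_zero.mp h1).resolve_left (inv_ne_zero sqrt_two_ne_zero)
      have h3 := h.chiMode
      rw [SuperAiry.chiMode, sub_eq_add_neg, superComm_add_right, superComm_neg_right] at h3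
      have h4 := congrArg₂ (· + ·) h2 h3
      have h5 : (2 : 𝕜) • superComm Z (SuperAiry.mulVar 𝕜 (Sum.inr ⊥)) = 0 := by
        rw [two_smul]
        simpa [add_assoc, add_left_comm] using h4
      exact (smul_eq_zero.mp h5).resolve_left two_ne_zero
    | coe j =>
      have h1 := h.psiMode (-(j : ℕ))
      have hj : (1 : ℤ) ≤ (j : ℕ) := by exact_mod_cast j.pos
      rwa [psiMode_of_neg 𝕜 (by omega), neg_neg, posIdx_coe] at h1

theorem CommutesWithModes.hbar_derTheta {Z : TwOp 𝕜} (h : CommutesWithModes Z) (j : WithBot ℕ+) :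
    superComm Z (hbar 𝕜 * derVar 𝕜 (Sum.inr j)) = 0 := by
  induction j using WithBot.recBotCoe with
  | bot =>
    have h3 := h.chiMode
    rw [SuperAiry.chiMode, sub_eq_add_neg, superComm_add_right, superComm_neg_right, h.mulVar,
      zero_add] at h3
    exact neg_eq_zero.mp h3
  | coe j =>
    have h1 := h.psiMode (j : ℕ)
    have hj : (1 : ℤ) ≤ (j : ℕ) := by exact_mod_cast j.pos
    rwa [psiMode_of_pos 𝕜 (by omega), posIdx_coe] at h1

theorem CommutesWithModes.eq_zero {Z : TwOp 𝕜} (h : CommutesWithModes Z) {b : Bool}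
    (hb : HasParity b Z) (hZ : Z ∈ weylAlg 𝕜 ℕ+ (WithBot ℕ+)) (hv : Z (vac 𝕜) = 0) : Z = 0 := by
  refine (isFil_of_mem_weylHat 𝕜 hZ).eq_zero_of_monoSer fun μ => ?_
  refine monoSer_mem (LinearMap.ker Z) hv (fun f hf => ?_) (fun a f hf => ?_) μ
  · rw [LinearMap.mem_ker] at *
    have := LinearMap.congr_fun (commute_hbar_of_mem_weylAlg 𝕜 hZ) f
    rw [Module.End.mul_apply, Module.End.mul_apply, hf, map_zero] at this
    exact this.symm
  · rw [LinearMap.mem_ker] at *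
    have h1 := h.mulVar a
    rw [hb.superComm_eq, sub_eq_zero] at h1
    have := LinearMap.congr_fun h1 f
    rwa [Module.End.mul_apply, Module.End.mul_apply, hf, map_zero] at this

theorem CommutesWithModes.eq_zero_of_odd {Z : TwOp 𝕜} (h : CommutesWithModes Z)
    (hb : HasParity true Z) (hZ : Z ∈ weylAlg 𝕜 ℕ+ (WithBot ℕ+)) : Z = 0 := by
  refine h.eq_zero hb hZ (Ser.ext fun μ => ?_)
  rw [coeff_zero]
  obtain ⟨p, a, S⟩ := μ
  rcases S.eq_empty_or_nonempty with rfl | ⟨j, hj⟩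
  · have h1 := LinearMap.congr_fun (isOddOp_iff.mpr hb) (vac 𝕜)
    have h2 : parity (vac 𝕜) = (vac 𝕜 : Ser 𝕜 ℕ+ (WithBot ℕ+)) := by
      refine Ser.ext fun μ => ?_
      rw [parity_coeff, vac, monoSer_coeff]
      split_ifs with h
      · rw [h]; simp
      · simp
    have h3 := congrArg (fun f => f.coeff ⟨p, a, ∅⟩) h1
    simp only [Module.End.mul_apply, LinearMap.neg_apply, h2, parity_coeff, coeff_neg,
      Finset.card_empty, pow_zero, one_mul] at h3
    exact self_eq_neg.mp h3
  · have h1 := h.hbar_derTheta j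
    rw [hb.superComm_eq, twist_true, hasParity_true.mp (hasParity_hbar_derVar 𝕜 (Sum.inr j)),
      neg_mul, sub_neg_eq_add] at h1
    have h2 := LinearMap.congr_fun h1 (vac 𝕜)
    rw [LinearMap.add_apply, Module.End.mul_apply, hbar_derVar_vac, map_zero, zero_add,
      LinearMap.zero_apply, mul_assoc, Module.End.mul_apply] at h2
    have h3 := congrArg (fun f => (divHbar 𝕜 f).coeff ⟨p, a, S.erase j⟩) h2
    have h4 : ∀ f : Ser 𝕜 ℕ+ (WithBot ℕ+), divHbar 𝕜 (hbar 𝕜 f) = f :=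
      fun f => LinearMap.congr_fun divHbar_mul_hbar f
    simp only [h4, map_zero, coeff_zero] at h3
    change (derTheta 𝕜 j (Z (vac 𝕜))).coeff _ = 0 at h3
    rw [derTheta_coeff, if_pos (Finset.notMem_erase j S)] at h3
    simp only [Finset.insert_erase hj] at h3
    refine (mul_eq_zero.mp h3).resolve_left fun h0 => ?_
    have := thetaSign_mul_self (𝕜 := 𝕜) j (S.erase j)
    rw [h0, zero_mul] at this
    exact zero_ne_one this

end Schur

section VacuumValues

variable {𝕜 : Type*} [RCLike 𝕜]

theorem bMode_vac {k : ℤ} (hk : 0 < k) : bMode 𝕜 k (vac 𝕜) = 0 := by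
  rw [bMode_of_pos 𝕜 hk, hbar_derVar_vac]

theorem psiMode_vac {n : ℤ} (hn : 0 < n) : psiMode 𝕜 n (vac 𝕜) = 0 := by
  rw [psiMode_of_pos 𝕜 hn, hbar_derVar_vac]

theorem bosonTerm_vac {m k : ℤ} (h : 0 < k ∨ 0 < m + 1 - k) : bosonTerm 𝕜 m k (vac 𝕜) = 0 := by
  rw [bosonTerm, bNormal_eq, Module.End.mul_apply, bMode_vac (by omega), map_zero]

theorem fermionTerm_vac {m j : ℤ} (h : 0 < -j ∨ 0 < m + j) : fermionTerm 𝕜 m j (vac 𝕜) = 0 := by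
  rw [fermionTerm, psiNormal, LinearMap.smul_apply]
  split_ifs
  · rw [Module.End.mul_apply, psiMode_vac (by omega), map_zero, smul_zero]
  · rw [LinearMap.neg_apply, Module.End.mul_apply, psiMode_vac (by omega), map_zero, neg_zero,
      smul_zero]

theorem superTerm_vac {j k : ℤ} (h : 0 < k ∨ 0 < j - k) : superTerm 𝕜 j k (vac 𝕜) = 0 := by
  rw [superTerm]
  rcases h with h | h
  · rw [bMode_mul_psiMode, Module.End.mul_apply, bMode_vac h, map_zero]
  · rw [Module.End.mul_apply, psiMode_vac h, map_zero]

theorem superG_vac {j : ℤ} (hj : 0 < j) : superG 𝕜 j (vac 𝕜) = 0 :=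
  (hasSum_apply_eq (summable_superTerm 𝕜 j).hasSum ∅
    fun k _ => superTerm_vac (by omega)).trans (by simp)

theorem superG_zero_vac : superG 𝕜 0 (vac 𝕜) = bMode 𝕜 0 (psiMode 𝕜 0 (vac 𝕜)) :=
  (hasSum_apply_eq (summable_superTerm 𝕜 0).hasSum {0}
    fun k hk => superTerm_vac (by simp at hk; omega)).trans (by simp [superTerm])

theorem virasoroL_vac {m : ℤ} (hm : 0 ≤ m) :
    virasoroL 𝕜 m (vac 𝕜) = if m = 0 then (1 / 8 : 𝕜) • hbar 𝕜 (vac 𝕜) else 0 := by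
  have h1 : (∑' k, bosonTerm 𝕜 m k) (vac 𝕜) = 0 :=
    (hasSum_apply_eq (summable_bosonTerm 𝕜 m).hasSum ∅
      fun k _ => bosonTerm_vac (by omega)).trans (by simp)
  have h2 : (∑' j, fermionTerm 𝕜 m j) (vac 𝕜) = 0 := (hasSum_apply_eq (f := vac 𝕜) (summable_fermionTerm 𝕜 m).hasSum ∅ fun j _ => by
    by_cases h : 0 < -j ∨ 0 < m + j
    · exact fermionTerm_vac h
    · rw [show j = 0 by omega, show m = 0 by omega, fermionTerm]
      simp).trans (by simp)
  rw [virasoroL, fermionPart, LinearMap.add_apply, LinearMap.add_apply, LinearMap.smul_apply,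
    LinearMap.smul_apply, h1, h2]
  split_ifs <;> simp

theorem virasoroL_neg_one_vac : virasoroL 𝕜 (-1) (vac 𝕜)
    = (1 / 2 : 𝕜) • bMode 𝕜 0 (bMode 𝕜 0 (vac 𝕜))
      + (1 / 2 : 𝕜) • psiMode 𝕜 (-1) (psiMode 𝕜 0 (vac 𝕜)) := by
  have h1 := (hasSum_apply_eq (f := vac 𝕜) (summable_bosonTerm 𝕜 (-1)).hasSum {0}
    fun k hk => bosonTerm_vac (by simp at hk; omega))
  have h2 := (hasSum_apply_eq (f := vac 𝕜) (summable_fermionTerm 𝕜 (-1)).hasSum {0, 1}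
    fun j hj => fermionTerm_vac (by simp at hj; omega))
  rw [Finset.sum_singleton, bosonTerm, bNormal_eq] at h1
  rw [Finset.sum_pair zero_ne_one, fermionTerm, fermionTerm, psiNormal, psiNormal] at h2
  rw [virasoroL, fermionPart, LinearMap.add_apply, LinearMap.add_apply, LinearMap.smul_apply,
    LinearMap.smul_apply, h1, h2]
  norm_num
  module

end VacuumValues

section Relations

variable {𝕜 : Type*} [RCLike 𝕜] {N : ℤ} {D : ℤ → 𝕜}

theorem airyH_superComm_hbar_mul (i : ℤ) (T : TwOp 𝕜) :
    superComm (airyH 𝕜 N D i) (hbar 𝕜 * T) = hbar 𝕜 * superComm (airyH 𝕜 N D i) T :=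
  (hasParity_airyH i).superComm_mul_hbar (commute_hbar_of_mem_weylAlg 𝕜 (airyH_mem i)) T

theorem airyF_superComm_hbar_mul (j : ℤ) (T : TwOp 𝕜) :
    superComm (airyF 𝕜 N j) (hbar 𝕜 * T) = hbar 𝕜 * superComm (airyF 𝕜 N j) T :=
  (hasParity_airyF j).superComm_mul_hbar (commute_hbar_of_mem_weylAlg 𝕜 (airyF_mem j)) T

theorem superComm_hbar_mul_bMode {b : Bool} {T : TwOp 𝕜} (h : HasParity b T) (k : ℤ) :
    superComm (hbar 𝕜 * T) (bMode 𝕜 k) = hbar 𝕜 * superComm T (bMode 𝕜 k) :=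
  superComm_hbar_mul h (hasParity_bMode 𝕜 k) (commute_hbar_of_mem_weylAlg 𝕜 (bMode_memHat 𝕜 k))

theorem superComm_hbar_mul_psiMode {b : Bool} {T : TwOp 𝕜} (h : HasParity b T) (k : ℤ) :
    superComm (hbar 𝕜 * T) (psiMode 𝕜 k) = hbar 𝕜 * superComm T (psiMode 𝕜 k) :=
  superComm_hbar_mul h (hasParity_psiMode 𝕜 k)
    (commute_hbar_of_mem_weylAlg 𝕜 (psiMode_memHat 𝕜 k))

theorem superComm_hbar_mul_chiMode {b : Bool} {T : TwOp 𝕜} (h : HasParity b T) :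
    superComm (hbar 𝕜 * T) (chiMode 𝕜) = hbar 𝕜 * superComm T (chiMode 𝕜) :=
  superComm_hbar_mul h (hasParity_chiMode 𝕜)
    (commute_hbar_of_mem_weylAlg 𝕜 (polyWeyl_le_weylAlg 𝕜 (chiMode_mem 𝕜)))

theorem hbar_mul_mem {T : TwOp 𝕜} (h : T ∈ weylAlg 𝕜 ℕ+ (WithBot ℕ+)) :
    hbar 𝕜 * T ∈ weylAlg 𝕜 ℕ+ (WithBot ℕ+) := mul_mem (hbar_memHat 𝕜) h

theorem HasParity.hbar_mul {b : Bool} {T : TwOp 𝕜} (h : HasParity b T) :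
    HasParity b (hbar 𝕜 * T) := by
  simpa using hasParity_false_hbar.mul h

theorem superComm_airyH_airyF (hN : -1 ≤ N) {m j : ℤ} (hm : 1 ≤ m) (hj : 1 ≤ j) :
    superComm (airyH 𝕜 N D m) (airyF 𝕜 N j)
      = hbar 𝕜 * ((((m : 𝕜) - N - 1) / 2 - ((j : 𝕜) - 1 / 2)) • airyF 𝕜 N (m + j + N - 1)) := by
  set c : 𝕜 := ((m : 𝕜) - N - 1) / 2 - ((j : 𝕜) - 1 / 2) with hc
  have hX : 1 ≤ m + j + N - 1 ∨ c = 0 := by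
    by_cases h : 1 ≤ m + j + N - 1
    · exact Or.inl h
    · obtain rfl : m = 1 := by omega
      obtain rfl : j = 1 := by omega
      obtain rfl : N = -1 := by omega
      right; rw [hc]; push_cast; ring
  set X := c • airyF 𝕜 N (m + j + N - 1) with hXdef
  have hXp : HasParity true X := (hasParity_airyF _).smul _
  have hXB : ∀ l, superComm X (bMode 𝕜 l)
      = c • ((1 / 2 : 𝕜) - l) • (hbar 𝕜 * psiMode 𝕜 (m + j + N - 1 + N - 1 + l)) := by
    intro l
    rw [hXdef, superComm_smul_left]
    rcases hX with h | h
    · rw [superComm_airyF_bMode h]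
    · rw [h, zero_smul, zero_smul]
  have hXP : ∀ n, superComm X (psiMode 𝕜 n)
      = c • (hbar 𝕜 * bShift 𝕜 N (m + j + N - 1 + N + n)) := by
    intro l
    rw [hXdef, superComm_smul_left]
    rcases hX with h | h
    · rw [superComm_airyF_psiMode h]
    · rw [h, zero_smul, zero_smul]
  have hXc : superComm X (chiMode 𝕜) = 0 := by
    rw [hXdef, superComm_smul_left]
    rcases hX with h | h
    · rw [superComm_airyF_chiMode h, smul_zero]
    · rw [h, zero_smul]
  have hH := hasParity_airyH (N := N) (D := D) m
  have hF := hasParity_airyF (𝕜 := 𝕜) (N := N) j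
  rw [← sub_eq_zero]
  refine CommutesWithModes.eq_zero_of_odd ⟨fun l => ?_, fun n => ?_, ?_⟩
    ((hH.superComm hF).sub hXp.hbar_mul) ?_
  · rw [superComm_sub_left, superComm_hbar_mul_bMode hXp, hXB,
      superComm_superComm hH hF (hasParity_bMode 𝕜 l), superComm_airyF_bMode hj,
      superComm_airyH_bMode hm, superComm_smul_right, superComm_smul_right,
      airyH_superComm_hbar_mul, airyF_superComm_hbar_mul, superComm_bShift,
      superComm_airyF_bMode hj, superComm_airyH_psiMode hm]
    rw [show j + N - 1 + (m + N - 1 + l) = m + j + N - 1 + N - 1 + l by ring,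
      show m + N - 1 + (j + N - 1 + l) = m + j + N - 1 + N - 1 + l by ring]
    simp only [Bool.false_and, Bool.false_eq_true, if_false, mul_smul_comm]
    push_cast
    rw [hc]
    module
  · rw [superComm_sub_left, superComm_hbar_mul_psiMode hXp, hXP,
      superComm_superComm hH hF (hasParity_psiMode 𝕜 n), superComm_airyF_psiMode hj,
      superComm_airyH_psiMode hm, superComm_smul_right,
      airyH_superComm_hbar_mul, airyF_superComm_hbar_mul, superComm_bShift,
      superComm_airyF_psiMode hj, superComm_airyH_bMode hm]
    rw [show j + N + (m + N - 1 + n) = m + j + N - 1 + N + n by ring,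
      show m + N - 1 + (j + N + n) = m + j + N - 1 + N + n by ring]
    simp only [Bool.false_and, Bool.false_eq_true, if_false, mul_smul_comm]
    push_cast
    rw [hc]
    module
  · rw [superComm_sub_left, superComm_hbar_mul_chiMode hXp, hXc,
      superComm_superComm hH hF (hasParity_chiMode 𝕜), superComm_airyF_chiMode hj,
      superComm_airyH_chiMode hm, superComm_zero_right, superComm_zero_right]
    simp
  · exact sub_mem (superComm_mem_weylAlg (airyH_mem m) (airyF_mem j))
      (hbar_mul_mem (Subalgebra.smul_mem _ (airyF_mem _) _))

theorem airyF_vac {j : ℤ} (hj : 1 ≤ j) (hjN : 1 ≤ j + N) : airyF 𝕜 N j (vac 𝕜) = 0 := by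
  rw [airyF_eq hj, LinearMap.add_apply, psiMode_vac (by omega), superG_vac (by omega), add_zero]

theorem airyF_one_vac : airyF 𝕜 (-1) 1 (vac 𝕜) = bMode 𝕜 0 (psiMode 𝕜 0 (vac 𝕜)) := by
  rw [airyF_eq le_rfl, LinearMap.add_apply, psiMode_vac (by omega), zero_add]
  exact superG_zero_vac

theorem airyH_vac {i : ℤ} (hi : 1 ≤ i) (hiN : 0 ≤ i + N - 1) : airyH 𝕜 N D i (vac 𝕜)
    = ((if i + N - 1 = 0 then 1 / 8 else 0) + if i ≤ N + 1 then D i else 0 : 𝕜)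
      • hbar 𝕜 (vac 𝕜) := by
  rw [airyH_eq hi, LinearMap.add_apply, LinearMap.add_apply, bMode_vac (by omega), zero_add,
    virasoroL_vac hiN, add_smul]
  congr 1
  · split_ifs <;> simp
  · split_ifs <;> simp

theorem psiMode_zero_psiMode_zero (f : Ser 𝕜 ℕ+ (WithBot ℕ+)) :
    psiMode 𝕜 0 (psiMode 𝕜 0 f) = (1 / 2 : 𝕜) • hbar 𝕜 f := by
  have h := superComm_psiMode_psiMode 𝕜 0 0
  rw [superComm_of_odd (hasParity_psiMode 𝕜 0) (hasParity_psiMode 𝕜 0), if_pos (add_zero 0),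
    ← two_smul 𝕜] at h
  rw [← h, LinearMap.smul_apply, smul_smul, Module.End.mul_apply]
  norm_num

/-- The value of `{F_k, F_1}` on `1` for `N = -1` comes from this one. -/
theorem airyF_airyF_one_vac {k : ℤ} (hk : 1 ≤ k) :
    airyF 𝕜 (-1) k (airyF 𝕜 (-1) 1 (vac 𝕜))
      = if k = 1 then hbar 𝕜 (airyH 𝕜 (-1) D 1 (vac 𝕜))
        else if k = 2 then (1 / 4 : 𝕜) • hbar 𝕜 (hbar 𝕜 (vac 𝕜)) else 0 := by
  have hF := hasParity_airyF (𝕜 := 𝕜) (N := -1) k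
  have h1 : ∀ f, airyF 𝕜 (-1) k (bMode 𝕜 0 f) = bMode 𝕜 0 (airyF 𝕜 (-1) k f)
      + (1 / 2 : 𝕜) • hbar 𝕜 (psiMode 𝕜 (k - 2) f) := by
    intro f
    have h := LinearMap.congr_fun (superComm_airyF_bMode (𝕜 := 𝕜) (N := -1) hk 0) f
    rw [superComm_of_even_right (hasParity_bMode 𝕜 0), LinearMap.sub_apply, sub_eq_iff_eq_add]
      at h
    rw [Module.End.mul_apply, Module.End.mul_apply, LinearMap.smul_apply,
      Module.End.mul_apply] at h
    rw [h, add_comm, show k + -1 - 1 + 0 = k - 2 by ring]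
    simp
  have h2 : ∀ f, airyF 𝕜 (-1) k (psiMode 𝕜 0 f) = hbar 𝕜 (bMode 𝕜 (k - 1) f)
      - psiMode 𝕜 0 (airyF 𝕜 (-1) k f) := by
    intro f
    have h := LinearMap.congr_fun (superComm_airyF_psiMode (𝕜 := 𝕜) (N := -1) hk 0) f
    rw [superComm_of_odd hF (hasParity_psiMode 𝕜 0), LinearMap.add_apply, ← eq_sub_iff_add_eq]
      at h
    rw [Module.End.mul_apply, Module.End.mul_apply, Module.End.mul_apply, bShift,
      if_neg (by omega), add_zero, show k + -1 + 0 = k - 1 by ring] at h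
    exact h
  have hc : ∀ (T : TwOp 𝕜), T ∈ weylAlg 𝕜 ℕ+ (WithBot ℕ+) → ∀ f, T (hbar 𝕜 f) = hbar 𝕜 (T f) :=
    fun T hT f => (LinearMap.congr_fun (commute_hbar_of_mem_weylAlg 𝕜 hT) f).symm
  rw [airyF_one_vac, h1, h2, map_sub, hc _ (bMode_memHat 𝕜 0)]
  split_ifs with hk1 hk2
  · subst hk1
    have h3 : psiMode 𝕜 0 (bMode 𝕜 0 (psiMode 𝕜 0 (vac 𝕜)))
        = (1 / 2 : 𝕜) • hbar 𝕜 (bMode 𝕜 0 (vac 𝕜)) := by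
      rw [← psiMode_zero_psiMode_zero]
      have := LinearMap.congr_fun (bMode_mul_psiMode 𝕜 0 0) (vac 𝕜)
      rw [Module.End.mul_apply, Module.End.mul_apply] at this
      rw [this]
    rw [airyF_one_vac, h3, airyH_eq le_rfl, LinearMap.add_apply, LinearMap.add_apply,
      bMode_vac one_pos, if_neg (by omega), map_smul, hc _ (bMode_memHat 𝕜 0)]
    rw [show (1 : ℤ) + -1 - 1 = -1 by norm_num, virasoroL_neg_one_vac,
      show (1 : ℤ) - 2 = -1 by norm_num, show (1 : ℤ) - 1 = 0 by norm_num]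
    simp only [LinearMap.zero_apply, zero_add, add_zero, map_add, map_smul]
    module
  · subst hk2
    rw [airyF_vac (by omega) (by omega), bMode_vac (by omega), map_zero, map_zero, map_zero,
      map_zero, sub_zero, zero_add, sub_self, psiMode_zero_psiMode_zero, map_smul, smul_smul]
    norm_num
  · rw [airyF_vac (by omega) (by omega), bMode_vac (by omega), map_zero, map_zero, map_zero,
      map_zero, sub_zero, zero_add]
    have h := LinearMap.congr_fun (superComm_psiMode_psiMode 𝕜 (k - 2) 0) (vac 𝕜)
    rw [superComm_of_odd (hasParity_psiMode 𝕜 _) (hasParity_psiMode 𝕜 0), if_neg (by omega),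
      LinearMap.add_apply, Module.End.mul_apply, Module.End.mul_apply,
      psiMode_vac (n := k - 2) (by omega), map_zero, add_zero, LinearMap.zero_apply] at h
    rw [h, map_zero, smul_zero]

theorem anticomm_airyF_vac (hN : -1 ≤ N) {j k : ℤ} (hj : 1 ≤ j) (hk : 1 ≤ k) :
    superComm (airyF 𝕜 N j) (airyF 𝕜 N k) (vac 𝕜)
      = (hbar 𝕜 * ((2 : 𝕜) • airyH 𝕜 N D (j + k + N)) : TwOp 𝕜) (vac 𝕜) := by
  rw [superComm_of_odd (hasParity_airyF j) (hasParity_airyF k), LinearMap.add_apply,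
    Module.End.mul_apply, Module.End.mul_apply, Module.End.mul_apply, LinearMap.smul_apply,
    map_smul]
  have key : ∀ k : ℤ, 2 ≤ k → airyF 𝕜 (-1) k (airyF 𝕜 (-1) 1 (vac 𝕜))
      = (2 : 𝕜) • hbar 𝕜 (airyH 𝕜 (-1) D k (vac 𝕜)) := by
    intro k hk
    rw [airyF_airyF_one_vac (D := D) (by omega), if_neg (by omega),
      airyH_vac (by omega) (by omega), if_neg (show ¬ k ≤ -1 + 1 by omega), add_zero, map_smul,
      smul_smul]
    by_cases h : k = 2
    · rw [if_pos h, if_pos (by omega)]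
      norm_num
    · rw [if_neg h, if_neg (by omega)]
      simp
  have h0 : 1 ≤ j + N → 1 ≤ k + N → airyF 𝕜 N j (airyF 𝕜 N k (vac 𝕜))
      + airyF 𝕜 N k (airyF 𝕜 N j (vac 𝕜)) = (2 : 𝕜) • hbar 𝕜 (airyH 𝕜 N D (j + k + N) (vac 𝕜)) := by
    intro h1 h2
    rw [airyF_vac hj h1, airyF_vac hk h2, airyH_vac (by omega) (by omega), if_neg (by omega),
      if_neg (by omega)]
    simp
  by_cases h1 : 1 ≤ j + N
  · by_cases h2 : 1 ≤ k + N
    · exact h0 h1 h2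
    · obtain rfl : N = -1 := by omega
      obtain rfl : k = 1 := by omega
      rw [airyF_vac hj h1, map_zero, add_zero, key j (by omega)]
      congr 4; ring
  · obtain rfl : N = -1 := by omega
    obtain rfl : j = 1 := by omega
    by_cases h2 : 1 ≤ k + -1
    · rw [airyF_vac hk h2, map_zero, zero_add, key k (by omega)]
      congr 4; ring
    · obtain rfl : k = 1 := by omega
      rw [airyF_airyF_one_vac (D := D) le_rfl, if_pos rfl, two_smul]
      norm_num

theorem superComm_airyF_airyF (hN : -1 ≤ N) {j k : ℤ} (hj : 1 ≤ j) (hk : 1 ≤ k) :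
    superComm (airyF 𝕜 N j) (airyF 𝕜 N k)
      = hbar 𝕜 * ((2 : 𝕜) • airyH 𝕜 N D (j + k + N)) := by
  have hi : 1 ≤ j + k + N := by omega
  have hF := fun j => hasParity_airyF (𝕜 := 𝕜) (N := N) j
  have hX : HasParity false ((2 : 𝕜) • airyH 𝕜 N D (j + k + N)) := (hasParity_airyH _).smul _
  rw [← sub_eq_zero]
  refine CommutesWithModes.eq_zero ⟨fun l => ?_, fun n => ?_, ?_⟩
    (((hF j).superComm (hF k)).sub hX.hbar_mul) ?_ ?_
  · rw [superComm_sub_left, superComm_hbar_mul_bMode hX, superComm_smul_left,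
      superComm_airyH_bMode hi, superComm_superComm (hF j) (hF k) (hasParity_bMode 𝕜 l),
      superComm_airyF_bMode hj, superComm_airyF_bMode hk, superComm_smul_right,
      superComm_smul_right, airyF_superComm_hbar_mul, airyF_superComm_hbar_mul,
      superComm_airyF_psiMode hj, superComm_airyF_psiMode hk]
    rw [show j + N + (k + N - 1 + l) = j + k + N + N - 1 + l by ring,
      show k + N + (j + N - 1 + l) = j + k + N + N - 1 + l by ring]
    simp only [Bool.and_self, if_true, mul_smul_comm]
    module
  · rw [superComm_sub_left, superComm_hbar_mul_psiMode hX, superComm_smul_left,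
      superComm_airyH_psiMode hi, superComm_superComm (hF j) (hF k) (hasParity_psiMode 𝕜 n),
      superComm_airyF_psiMode hj, superComm_airyF_psiMode hk,
      airyF_superComm_hbar_mul, airyF_superComm_hbar_mul, superComm_bShift, superComm_bShift,
      superComm_airyF_bMode hj, superComm_airyF_bMode hk]
    rw [show j + N - 1 + (k + N + n) = j + k + N + N - 1 + n by ring,
      show k + N - 1 + (j + N + n) = j + k + N + N - 1 + n by ring]
    simp only [Bool.and_self, if_true, mul_smul_comm]
    push_cast
    module
  · rw [superComm_sub_left, superComm_hbar_mul_chiMode hX, superComm_smul_left,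
      superComm_airyH_chiMode hi, superComm_superComm (hF j) (hF k) (hasParity_chiMode 𝕜),
      superComm_airyF_chiMode hj, superComm_airyF_chiMode hk, superComm_zero_right,
      superComm_zero_right]
    simp
  · exact sub_mem (superComm_mem_weylAlg (airyF_mem j) (airyF_mem k))
      (hbar_mul_mem (Subalgebra.smul_mem _ (airyH_mem _) _))
  · rw [LinearMap.sub_apply, anticomm_airyF_vac hN hj hk (D := D), sub_self]

/-- The relation for `N ≥ 0`, where `1` is an eigenvector of all `H_i`. -/
theorem superComm_airyH_airyH_of_nonneg (hN : 0 ≤ N) {m n : ℤ} (hm : 1 ≤ m) (hn : 1 ≤ n) :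
    superComm (airyH 𝕜 N D m) (airyH 𝕜 N D n)
      = hbar 𝕜 * (((m : 𝕜) - n) • airyH 𝕜 N D (m + n + N - 1)) := by
  have hi : 1 ≤ m + n + N - 1 := by omega
  have hH := fun j => hasParity_airyH (N := N) (D := D) j
  have hX : HasParity false (((m : 𝕜) - n) • airyH 𝕜 N D (m + n + N - 1)) := (hH _).smul _
  rw [← sub_eq_zero]
  refine CommutesWithModes.eq_zero ⟨fun l => ?_, fun p => ?_, ?_⟩
    (((hH m).superComm (hH n)).sub hX.hbar_mul) ?_ ?_
  · rw [superComm_sub_left, superComm_hbar_mul_bMode hX, superComm_smul_left,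
      superComm_airyH_bMode hi, superComm_superComm (hH m) (hH n) (hasParity_bMode 𝕜 l),
      superComm_airyH_bMode hm, superComm_airyH_bMode hn, superComm_smul_right,
      superComm_smul_right, airyH_superComm_hbar_mul, airyH_superComm_hbar_mul,
      superComm_bShift, superComm_bShift,
      superComm_airyH_bMode hm, superComm_airyH_bMode hn]
    rw [show m + N - 1 + (n + N - 1 + l) = m + n + N - 1 + N - 1 + l by ring,
      show n + N - 1 + (m + N - 1 + l) = m + n + N - 1 + N - 1 + l by ring]
    simp only [Bool.and_self, Bool.false_eq_true, if_false, mul_smul_comm]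
    push_cast
    module
  · rw [superComm_sub_left, superComm_hbar_mul_psiMode hX, superComm_smul_left,
      superComm_airyH_psiMode hi, superComm_superComm (hH m) (hH n) (hasParity_psiMode 𝕜 p),
      superComm_airyH_psiMode hm, superComm_airyH_psiMode hn, superComm_smul_right,
      superComm_smul_right, airyH_superComm_hbar_mul, airyH_superComm_hbar_mul,
      superComm_airyH_psiMode hm, superComm_airyH_psiMode hn]
    rw [show m + N - 1 + (n + N - 1 + p) = m + n + N - 1 + N - 1 + p by ring,
      show n + N - 1 + (m + N - 1 + p) = m + n + N - 1 + N - 1 + p by ring]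
    simp only [Bool.and_self, Bool.false_eq_true, if_false, mul_smul_comm]
    push_cast
    module
  · rw [superComm_sub_left, superComm_hbar_mul_chiMode hX, superComm_smul_left,
      superComm_airyH_chiMode hi, superComm_superComm (hH m) (hH n) (hasParity_chiMode 𝕜),
      superComm_airyH_chiMode hm, superComm_airyH_chiMode hn, superComm_zero_right,
      superComm_zero_right]
    simp
  · exact sub_mem (superComm_mem_weylAlg (airyH_mem m) (airyH_mem n))
      (hbar_mul_mem (Subalgebra.smul_mem _ (airyH_mem _) _))
  · have hc : ∀ i f, airyH 𝕜 N D i (hbar 𝕜 f) = hbar 𝕜 (airyH 𝕜 N D i f) :=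
      fun i f => (LinearMap.congr_fun (commute_hbar_of_mem_weylAlg 𝕜 (airyH_mem i)) f).symm
    rw [superComm_of_even_left (hH m)]
    simp only [LinearMap.sub_apply, Module.End.mul_apply, LinearMap.smul_apply]
    rw [airyH_vac hm (by omega), airyH_vac hn (by omega), map_smul, map_smul, hc, hc,
      airyH_vac hm (by omega), airyH_vac hn (by omega), airyH_vac hi (by omega)]
    rcases eq_or_ne m n with rfl | h
    · simp
    · rw [if_neg (show ¬ m + n + N - 1 + N - 1 = 0 by omega),
        if_neg (show ¬ m + n + N - 1 ≤ N + 1 by omega)]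
      simp only [map_smul]
      module

/-- The relation for `N = -1`, where the `H_i` are anticommutators of the `F_j`. -/
theorem superComm_airyH_airyH_of_neg_one {m n : ℤ} (hm : 1 ≤ m) (hn : 1 ≤ n) :
    superComm (airyH 𝕜 (-1) D m) (airyH 𝕜 (-1) D n)
      = hbar 𝕜 * (((m : 𝕜) - n) • airyH 𝕜 (-1) D (m + n + -1 - 1)) := by
  have hH := fun j => hasParity_airyH (N := -1) (D := D) j
  have hF := fun j => hasParity_airyF (𝕜 := 𝕜) (N := -1) j
  have h1 := superComm_airyF_airyF (D := D) (le_refl (-1)) (le_refl 1) hn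
  have h2 := superComm_superComm (hH m) (hF 1) (hF n)
  rw [h1, airyH_superComm_hbar_mul, superComm_smul_right, superComm_airyH_airyF le_rfl hm le_rfl,
    superComm_airyH_airyF le_rfl hm hn, airyF_superComm_hbar_mul, superComm_smul_right,
    superComm_hbar_mul ((hF _).smul _) (hF n) (commute_hbar_of_mem_weylAlg 𝕜 (airyF_mem n)),
    superComm_smul_left] at h2
  rw [show 1 + n + -1 = n by ring] at h2
  have h3 : (((m : 𝕜) - (-1 : ℤ) - 1) / 2 - (((1 : ℤ) : 𝕜) - 1 / 2)) •
      superComm (airyF 𝕜 (-1) (m + 1 + -1 - 1)) (airyF 𝕜 (-1) n)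
      = (((m : 𝕜) - (-1 : ℤ) - 1) / 2 - (((1 : ℤ) : 𝕜) - 1 / 2)) •
        (hbar 𝕜 * ((2 : 𝕜) • airyH 𝕜 (-1) D (m + n + -1 - 1))) := by
    rcases eq_or_lt_of_le hm with rfl | h
    · have : (((1 : ℤ) : 𝕜) - (-1 : ℤ) - 1) / 2 - (((1 : ℤ) : 𝕜) - 1 / 2) = 0 := by
        push_cast; ring
      rw [this, zero_smul, zero_smul]
    · rw [superComm_airyF_airyF (D := D) le_rfl (by omega) hn]
      congr 5; ring
  have h4 : (((m : 𝕜) - (-1 : ℤ) - 1) / 2 - ((n : 𝕜) - 1 / 2)) •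
      superComm (airyF 𝕜 (-1) 1) (airyF 𝕜 (-1) (m + n + -1 - 1))
      = (((m : 𝕜) - (-1 : ℤ) - 1) / 2 - ((n : 𝕜) - 1 / 2)) •
        (hbar 𝕜 * ((2 : 𝕜) • airyH 𝕜 (-1) D (m + n + -1 - 1))) := by
    by_cases h : m = 1 ∧ n = 1
    · obtain ⟨rfl, rfl⟩ := h
      have : (((1 : ℤ) : 𝕜) - (-1 : ℤ) - 1) / 2 - (((1 : ℤ) : 𝕜) - 1 / 2) = 0 := by
        push_cast; ring
      rw [this, zero_smul, zero_smul]
    · rw [superComm_airyF_airyF (D := D) le_rfl le_rfl (by omega)]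
      congr 5; ring
  rw [h3, h4] at h2
  simp only [Bool.false_and, Bool.false_eq_true, if_false] at h2
  have h5 := eq_add_of_sub_eq h2.symm
  rw [← mul_add] at h5
  have h6 := congrArg ((1 / 2 : 𝕜) • ·) (hbar_mul_cancel h5)
  simp only [smul_smul] at h6
  norm_num at h6
  rw [h6]
  simp only [mul_smul_comm]
  module

theorem superComm_airyH_airyH (hN : -1 ≤ N) {m n : ℤ} (hm : 1 ≤ m) (hn : 1 ≤ n) :
    superComm (airyH 𝕜 N D m) (airyH 𝕜 N D n)
      = hbar 𝕜 * (((m : 𝕜) - n) • airyH 𝕜 N D (m + n + N - 1)) := by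
  rcases eq_or_lt_of_le hN with rfl | h
  · exact superComm_airyH_airyH_of_neg_one hm hn
  · exact superComm_airyH_airyH_of_nonneg (by omega) hm hn

end Relations

section DualTopology

variable {𝕜 ι κ : Type*} [Field 𝕜]

theorem dualSp_tendsto_iff {α : Type*} {l : Filter α} {u : α → DualSp 𝕜 ι κ} {φ : DualSp 𝕜 ι κ} :
    Tendsto u l (𝓝 φ) ↔ ∀ v, ∀ᶠ i in l, (u i).eval v = φ.eval v := by
  rw [nhds_iInf, tendsto_iInf]
  refine forall_congr' fun d => ?_
  rw [@nhds_induced _ _ ⊥, tendsto_comap_iff, @nhds_discrete _ ⊥ (@DiscreteTopology.mk _ ⊥ rfl),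
    tendsto_pure]
  rfl

/-- Evaluation at a vector as a linear map. -/
noncomputable def DualSp.evalHom (v : (ι ⊕ κ) →₀ 𝕜) : DualSp 𝕜 ι κ →ₗ[𝕜] 𝕜 where
  toFun φ := φ.eval v
  map_add' _ _ := rfl
  map_smul' _ _ := rfl

theorem DualSp.evalHom_apply (v : (ι ⊕ κ) →₀ 𝕜) (φ : DualSp 𝕜 ι κ) :
    DualSp.evalHom v φ = φ.eval v := rfl

theorem DualSp.eval_smul (c : 𝕜) (φ : DualSp 𝕜 ι κ) (v) : (c • φ).eval v = c * φ.eval v := rfl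

theorem DualSp.eval_add_right (φ : DualSp 𝕜 ι κ) (v w) : φ.eval (v + w) = φ.eval v + φ.eval w :=
  LinearMap.map_add (show Module.Dual 𝕜 _ from φ) v w

theorem DualSp.eval_smul_right (φ : DualSp 𝕜 ι κ) (c : 𝕜) (v) : φ.eval (c • v) = c * φ.eval v :=
  LinearMap.map_smul (show Module.Dual 𝕜 _ from φ) c v

theorem dualBasis_eval (a : ι ⊕ κ) (v : (ι ⊕ κ) →₀ 𝕜) : (dualBasis a).eval v = v a := rfl

/-- A family of functionals that tends to zero pointwise is summable. -/
theorem dualSp_summable {α : Type*} {u : α → DualSp 𝕜 ι κ}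
    (h : ∀ v, {i | (u i).eval v ≠ 0}.Finite) : Summable u := by
  let χ : DualSp 𝕜 ι κ := show Module.Dual 𝕜 ((ι ⊕ κ) →₀ 𝕜) from
    { toFun := fun v => ∑ᶠ i, (u i).eval v
      map_add' := fun v w => by
        rw [← finsum_add_distrib (h v) (h w)]
        simp only [DualSp.eval_add_right]
      map_smul' := fun c v => by
        simp only [DualSp.eval_smul_right, RingHom.id_apply, smul_eq_mul, mul_finsum] }
  refine ⟨χ, dualSp_tendsto_iff.mpr fun v => ?_⟩
  filter_upwards [eventually_ge_atTop (h v).toFinset] with s hs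
  rw [← DualSp.evalHom_apply, map_sum]
  refine (finsum_eq_sum_of_support_subset _ fun i hi => hs ?_).symm
  exact (h v).mem_toFinset.mpr hi

theorem hasSum_dualBasis (φ : DualSp 𝕜 ι κ) :
    HasSum (fun a => φ.eval (Finsupp.single a 1) • dualBasis a) φ := by
  classical
  refine dualSp_tendsto_iff.mpr fun v => ?_
  filter_upwards [eventually_ge_atTop v.support] with s hs
  have h1 : v = ∑ a ∈ s, v a • Finsupp.single a (1 : 𝕜) := by
    conv_lhs => rw [← Finsupp.sum_single v]
    rw [Finsupp.sum_of_support_subset v hs _ (fun _ _ => Finsupp.single_zero _)]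
    simp
  have h2 : φ.eval v = ∑ a ∈ s, v a * φ.eval (Finsupp.single a 1) := by
    conv_lhs => rw [h1]
    refine (map_sum (show Module.Dual 𝕜 _ from φ) _ _).trans ?_
    exact Finset.sum_congr rfl fun a _ => φ.eval_smul_right _ _
  rw [h2, ← DualSp.evalHom_apply, map_sum]
  refine Finset.sum_congr rfl fun a _ => ?_
  rw [DualSp.evalHom_apply, DualSp.eval_smul, dualBasis_eval, mul_comm]

end DualTopology

section DualMap

variable {𝕜 ι κ : Type*} [Field 𝕜] {X : ι ⊕ κ → Op 𝕜 ι (WithBot κ)}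

/-- The values on the dual set tend to zero pointwise. -/
def IsNull (X : ι ⊕ κ → Op 𝕜 ι (WithBot κ)) : Prop :=
  ∀ f d, ∀ᶠ a in cofinite, X a f ∈ Fil 𝕜 ι (WithBot κ) d

theorem IsNull.summable (hX : IsNull X) (φ : DualSp 𝕜 ι κ) :
    Summable fun a => φ.eval (Finsupp.single a 1) • X a :=
  summable_of_cofinite fun f d => (hX f d).mono fun _ ha => Submodule.smul_mem _ _ ha

/-- The continuous linear map with prescribed values on the dual set. -/
noncomputable def IsNull.dualMap (hX : IsNull X) : DualSp 𝕜 ι κ →ₗ[𝕜] Op 𝕜 ι (WithBot κ) where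
  toFun φ := ∑' a, φ.eval (Finsupp.single a 1) • X a
  map_add' φ ψ := by
    rw [← (hX.summable φ).tsum_add (hX.summable ψ)]
    refine tsum_congr fun a => ?_
    rw [← add_smul]; rfl
  map_smul' c φ := by
    refine HasSum.tsum_eq ?_
    have := (hX.summable φ).hasSum.const_smul c
    simpa only [DualSp.eval_smul, smul_smul, RingHom.id_apply] using this

theorem IsNull.hasSum (hX : IsNull X) (φ : DualSp 𝕜 ι κ) :
    HasSum (fun a => φ.eval (Finsupp.single a 1) • X a) (hX.dualMap φ) :=
  (hX.summable φ).hasSum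

theorem IsNull.dualMap_dualBasis (hX : IsNull X) (a : ι ⊕ κ) :
    hX.dualMap (dualBasis a) = X a := by
  classical
  refine (hX.hasSum (dualBasis a)).unique ?_
  convert hasSum_ite_eq a (X a) using 2 with b
  rw [dualBasis_eval, Finsupp.single_apply]
  split_ifs with h
  · rw [one_smul, h]
  · rw [zero_smul]

theorem IsNull.continuous_dualMap (hX : IsNull X) : Continuous hX.dualMap := by
  refine continuous_iff_continuousAt.mpr fun φ => op_tendsto_iff.mpr fun f d => ?_
  set s := (show {a | X a f ∉ Fil 𝕜 ι (WithBot κ) d}.Finite from hX f d).toFinset with hs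
  have h1 : ∀ a ∉ s, X a f ∈ Fil 𝕜 ι (WithBot κ) d := fun a ha => by
    by_contra h
    exact ha ((Set.Finite.mem_toFinset _).mpr h)
  have h2 : ∀ᶠ ψ in 𝓝 φ, ∀ a ∈ s, ψ.eval (Finsupp.single a 1) = φ.eval (Finsupp.single a 1) :=
    (eventually_all_finset s).mpr fun a _ => dualSp_tendsto_iff.mp tendsto_id _
  filter_upwards [h2] with ψ hψ
  have h3 := fun ψ : DualSp 𝕜 ι κ => hasSum_apply_sub_mem_Fil (hX.hasSum ψ) (f := f) (d := d) s
    fun a ha => Submodule.smul_mem _ _ (h1 a ha)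
  have h4 := sub_mem (h3 ψ) (h3 φ)
  rw [show ∑ a ∈ s, (ψ.eval (Finsupp.single a 1) • X a) f
      = ∑ a ∈ s, (φ.eval (Finsupp.single a 1) • X a) f from
    Finset.sum_congr rfl fun a ha => by rw [hψ a ha]] at h4
  simpa using h4

theorem IsNull.eq_dualMap (hX : IsNull X) {H : DualSp 𝕜 ι κ →ₗ[𝕜] Op 𝕜 ι (WithBot κ)}
    (hc : Continuous H) (h : ∀ a, H (dualBasis a) = X a) : H = hX.dualMap := by
  refine LinearMap.ext fun φ => ?_
  have h1 := (hasSum_dualBasis φ).map H hc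
  refine HasSum.unique ?_ (hX.hasSum φ)
  convert h1 using 2 with a
  simp [h]

variable [LinearOrder κ]

theorem IsNull.superComm_dualMap (hX : IsNull X) (hW : ∀ a, X a ∈ weylAlg 𝕜 ι (WithBot κ))
    (idx : ι ⊕ κ → ι ⊕ κ → ι ⊕ κ) (t : ι ⊕ κ → ι ⊕ κ → 𝕜)
    (hcomm : ∀ a b, superComm (X a) (X b) = hbar 𝕜 * (t a b • X (idx a b)))
    (hfin : ∀ c, {p : (ι ⊕ κ) × (ι ⊕ κ) | idx p.1 p.2 = c}.Finite) (φ ψ : DualSp 𝕜 ι κ) :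
    ∃ χ, superComm (hX.dualMap φ) (hX.dualMap ψ) = hbar 𝕜 * hX.dualMap χ := by
  have hWφ : ∀ φ, hX.dualMap φ ∈ weylAlg 𝕜 ι (WithBot κ) := fun φ =>
    isClosed_weylAlg 𝕜 |>.mem_of_tendsto (hX.hasSum φ)
      (Eventually.of_forall fun _ => sum_mem fun a _ => Subalgebra.smul_mem _ (hW a) _)
  let u : (ι ⊕ κ) × (ι ⊕ κ) → DualSp 𝕜 ι κ := fun p =>
    (φ.eval (Finsupp.single p.1 1) * ψ.eval (Finsupp.single p.2 1) * t p.1 p.2) •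
      dualBasis (idx p.1 p.2)
  have hu : Summable u := dualSp_summable fun v => by
    refine (v.support.finite_toSet.biUnion fun c _ => hfin c).subset fun p hp => ?_
    simp only [Set.mem_iUnion]
    refine ⟨idx p.1 p.2, ?_, rfl⟩
    refine Finset.mem_coe.mpr (Finsupp.mem_support_iff.mpr fun h0 => hp ?_)
    change _ * v (idx p.1 p.2) = 0
    rw [h0, mul_zero]
  obtain ⟨χ, hχ⟩ := hu
  refine ⟨χ, ?_⟩
  have h1 : HasSum (fun p => hbar 𝕜 * hX.dualMap (u p)) (hbar 𝕜 * hX.dualMap χ) :=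
    isFil_hbar.hasSum_mul_left (hχ.map hX.dualMap hX.continuous_dualMap)
  have h2 : ∀ p, hbar 𝕜 * hX.dualMap (u p) = superComm (φ.eval (Finsupp.single p.1 1) • X p.1)
      (ψ.eval (Finsupp.single p.2 1) • X p.2) := by
    intro p
    rw [superComm_smul_left, superComm_smul_right, hcomm, map_smul, hX.dualMap_dualBasis]
    simp only [mul_smul_comm, smul_smul, mul_assoc]
  simp only [h2] at h1
  have h3 := h1.prod_fiberwise (g := fun a =>
    superComm (φ.eval (Finsupp.single a 1) • X a) (hX.dualMap ψ)) fun a => by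
      have h : IsFil (φ.eval (Finsupp.single a 1) • X a) := (isFil_of_mem_weylHat 𝕜 (hW a)).smul _
      exact (hX.hasSum ψ).map (superCommHom (φ.eval (Finsupp.single a 1) • X a))
        h.continuous_superComm_right
  exact (hasSum_superComm_left (hX.hasSum φ) (isFil_of_mem_weylHat 𝕜 (hWφ ψ))).unique h3

end DualMap

section Degree

variable {𝕜 ι κ : Type*} [Field 𝕜]

/-- The operator raises degrees by exactly `d`. -/
def RaisesDeg (d : ℕ) (T : Op 𝕜 ι κ) : Prop :=
  ∀ e f, (∀ μ, μ.deg ≠ e → f.coeff μ = 0) → ∀ μ, μ.deg ≠ e + d → (T f).coeff μ = 0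

namespace RaisesDeg

variable {d e : ℕ} {T S : Op 𝕜 ι κ}

theorem mul (hT : RaisesDeg d T) (hS : RaisesDeg e S) : RaisesDeg (d + e) (T * S) :=
  fun k f hf μ hμ => hT (k + e) _ (hS k f hf) μ (by omega)

theorem add (hT : RaisesDeg d T) (hS : RaisesDeg d S) : RaisesDeg d (T + S) :=
  fun k f hf μ hμ => by
    rw [LinearMap.add_apply, coeff_add, hT k f hf μ hμ, hS k f hf μ hμ, add_zero]

theorem smul (c : 𝕜) (hT : RaisesDeg d T) : RaisesDeg d (c • T) :=
  fun k f hf μ hμ => by rw [LinearMap.smul_apply, coeff_smul, hT k f hf μ hμ, mul_zero]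

theorem neg (hT : RaisesDeg d T) : RaisesDeg d (-T) :=
  fun k f hf μ hμ => by rw [LinearMap.neg_apply, coeff_neg, hT k f hf μ hμ, neg_zero]

theorem zero : RaisesDeg d (0 : Op 𝕜 ι κ) := fun _ _ _ _ _ => rfl

theorem hasSum {α : Type*} {F : α → Op 𝕜 ι κ} (h : HasSum F T) (hF : ∀ i, RaisesDeg d (F i)) :
    RaisesDeg d T := by
  intro k f hf μ hμ
  obtain ⟨s, hs⟩ := (op_tendsto_iff.mp h f (μ.deg + 1)).exists
  rw [← coeff_eq_of_sub_mem_Fil hs (Nat.lt_succ_self _), LinearMap.sum_apply, coeff_sum]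
  exact Finset.sum_eq_zero fun i _ => hF i k f hf μ hμ

theorem component_eq_zero (hT : RaisesDeg d T) (h : e ≠ d) : component e T = 0 :=
  Op.ext_coeff fun f μ => by
    rw [component_coeff, LinearMap.zero_apply, coeff_zero]
    split_ifs with h'
    · refine hT (μ.deg - e) _ (fun ν hν => ?_) μ (by omega)
      rw [homPart_coeff, if_neg hν]
    · rfl

end RaisesDeg

theorem component_add (d : ℕ) (T S : Op 𝕜 ι κ) :
    component d (T + S) = component d T + component d S :=
  Op.ext_coeff fun f μ => by
    rw [LinearMap.add_apply, coeff_add, component_coeff, component_coeff, component_coeff]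
    split_ifs <;> simp

theorem raisesDeg_hbar : RaisesDeg 2 (hbar 𝕜 : Op 𝕜 ι κ) := fun e f hf μ hμ => by
  rw [hbar_coeff]
  split_ifs with h
  · refine hf _ ?_
    simp only [Mono.deg] at hμ ⊢; omega
  · rfl

theorem Mono.deg_sub_single {μ : Mono ι κ} {i : ι} (h : 0 < μ.xExp i) :
    Mono.deg (⟨μ.hExp, μ.xExp - Finsupp.single i 1, μ.odd⟩ : Mono ι κ) + 1 = μ.deg := by
  have h1 : μ.xExp.degree = (μ.xExp - Finsupp.single i 1).degree + 1 := by
    have h0 : Finsupp.single i 1 ≤ μ.xExp := Finsupp.single_le_iff.mpr h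
    conv_lhs => rw [← tsub_add_cancel_of_le h0]
    rw [map_add, Finsupp.degree_single]
  simp only [Mono.deg]; omega

variable [LinearOrder κ]

theorem raisesDeg_mulVar (a : ι ⊕ κ) : RaisesDeg 1 (mulVar 𝕜 a : Op 𝕜 ι κ) := by
  intro e f hf μ hμ
  rcases a with i | j
  · refine (mulX_coeff i f μ).trans ?_
    split_ifs with h
    · have := Mono.deg_sub_single h
      exact hf _ (by omega)
    · rfl
  · refine (mulTheta_coeff j f μ).trans ?_
    split_ifs with h
    · rw [hf, mul_zero]
      have := Finset.card_erase_add_one h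
      simp only [Mono.deg] at hμ ⊢; omega
    · rfl

/-- The value of `ħ ∂` at a monomial involves one coefficient, whose degree is smaller by one. -/
theorem hbar_derVar_coeff (a : ι ⊕ κ) (μ : Mono ι κ) :
    (∀ f : Ser 𝕜 ι κ, ((hbar 𝕜 * derVar 𝕜 a : Op 𝕜 ι κ) f).coeff μ = 0) ∨
    ∃ (c : 𝕜) (ν : Mono ι κ), ν.deg + 1 = μ.deg ∧
      ∀ f : Ser 𝕜 ι κ, ((hbar 𝕜 * derVar 𝕜 a : Op 𝕜 ι κ) f).coeff μ = c * f.coeff ν := by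
  by_cases h : 0 < μ.hExp
  · rcases a with i | j
    · refine Or.inr ⟨(μ.xExp i : 𝕜) + 1, ⟨μ.hExp - 1, μ.xExp + Finsupp.single i 1, μ.odd⟩,
        ?_, fun f => ?_⟩
      rotate_left 1
      · rw [Module.End.mul_apply, hbar_coeff, if_pos h]
        exact derX_coeff i f _
      · simp only [Mono.deg, map_add, Finsupp.degree_single]; omega
    · by_cases hj : j ∈ μ.odd
      · refine Or.inl fun f => ?_
        rw [Module.End.mul_apply, hbar_coeff, if_pos h]
        exact (derTheta_coeff j f _).trans (if_neg (not_not.mpr hj))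
      · refine Or.inr ⟨thetaSign 𝕜 j μ.odd, ⟨μ.hExp - 1, μ.xExp, insert j μ.odd⟩,
          ?_, fun f => ?_⟩
        rotate_left 1
        · rw [Module.End.mul_apply, hbar_coeff, if_pos h]
          exact (derTheta_coeff j f _).trans (if_pos hj)
        · simp only [Mono.deg, Finset.card_insert_of_notMem hj]; omega
  · refine Or.inl fun f => ?_
    rw [Module.End.mul_apply, hbar_coeff, if_neg h]

theorem raisesDeg_hbar_derVar (a : ι ⊕ κ) :
    RaisesDeg 1 (hbar 𝕜 * derVar 𝕜 a : Op 𝕜 ι κ) := by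
  intro e f hf μ hμ
  rcases hbar_derVar_coeff (𝕜 := 𝕜) a μ with h | ⟨c, ν, hν, h⟩
  · exact h f
  · rw [h, hf ν (by omega), mul_zero]

theorem component_one_hbar_derVar (a : ι ⊕ κ) :
    component 1 (hbar 𝕜 * derVar 𝕜 a : Op 𝕜 ι κ) = hbar 𝕜 * derVar 𝕜 a :=
  Op.ext_coeff fun f μ => by
    rw [component_coeff]
    rcases hbar_derVar_coeff (𝕜 := 𝕜) a μ with h | ⟨c, ν, hν, h⟩
    · rw [h, h, ite_self]
    · rw [h, h, if_pos (by omega), homPart_coeff, if_pos (by omega)]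

theorem truncLE_one_of_raisesDeg (a : ι ⊕ κ) {R : Op 𝕜 ι κ} (hR : RaisesDeg 2 R) :
    truncLE 1 (hbar 𝕜 * derVar 𝕜 a + R) = hbar 𝕜 * derVar 𝕜 a := by
  rw [truncLE, Finset.sum_range_succ, Finset.sum_range_one, component_add, component_add,
    hR.component_eq_zero (by omega), hR.component_eq_zero (by omega),
    (raisesDeg_hbar_derVar a).component_eq_zero (by omega), component_one_hbar_derVar]
  simp

end Degree

section AiryStructureProof

variable {𝕜 : Type*} [RCLike 𝕜] {N : ℤ} {D : ℤ → 𝕜}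

theorem raisesDeg_bMode (k : ℤ) : RaisesDeg 1 (bMode 𝕜 k) := by
  rcases lt_or_ge 0 k with h | h
  · rw [bMode_of_pos 𝕜 h]; exact raisesDeg_hbar_derVar _
  · rw [bMode_of_nonpos 𝕜 h]; exact (raisesDeg_mulVar _).smul _

theorem raisesDeg_psiMode (n : ℤ) : RaisesDeg 1 (psiMode 𝕜 n) := by
  rcases lt_trichotomy n 0 with h | rfl | h
  · rw [psiMode_of_neg 𝕜 h]; exact raisesDeg_mulVar _
  · rw [psiMode_zero]
    exact ((raisesDeg_mulVar _).add (raisesDeg_hbar_derVar _)).smul _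
  · rw [psiMode_of_pos 𝕜 h]; exact raisesDeg_hbar_derVar _

theorem raisesDeg_virasoroL (m : ℤ) : RaisesDeg 2 (virasoroL 𝕜 m) := by
  rw [virasoroL, fermionPart]
  refine ((RaisesDeg.smul _ ?_).add (RaisesDeg.smul _ ?_)).add ?_
  · refine RaisesDeg.hasSum (summable_bosonTerm 𝕜 m).hasSum fun k => ?_
    rw [bosonTerm, bNormal_eq]
    exact (raisesDeg_bMode _).mul (raisesDeg_bMode _)
  · refine RaisesDeg.hasSum (summable_fermionTerm 𝕜 m).hasSum fun k => ?_
    rw [fermionTerm, psiNormal]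
    refine RaisesDeg.smul _ ?_
    split_ifs
    · exact (raisesDeg_psiMode _).mul (raisesDeg_psiMode _)
    · exact ((raisesDeg_psiMode _).mul (raisesDeg_psiMode _)).neg
  · split_ifs
    exacts [raisesDeg_hbar.smul _, RaisesDeg.zero]

theorem raisesDeg_superG (j : ℤ) : RaisesDeg 2 (superG 𝕜 j) :=
  RaisesDeg.hasSum (summable_superTerm 𝕜 j).hasSum fun _ =>
    (raisesDeg_bMode _).mul (raisesDeg_psiMode _)

variable (N D) in
/-- The operators `H_i` and `F_j` as a family indexed by the dual set. -/
noncomputable def airyVal : ℕ+ ⊕ ℕ+ → TwOp 𝕜 :=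
  Sum.elim (fun i => airyH 𝕜 N D (i : ℕ)) fun j => airyF 𝕜 N (j : ℕ)

theorem airyVal_inl (i : ℕ+) : airyVal N D (Sum.inl i) = airyH 𝕜 N D (i : ℕ) := rfl
theorem airyVal_inr (j : ℕ+) : airyVal N D (Sum.inr j) = airyF 𝕜 N (j : ℕ) := rfl

theorem one_le_coe (i : ℕ+) : (1 : ℤ) ≤ (i : ℕ) := by exact_mod_cast i.pos

theorem isNull_airyVal : IsNull (airyVal N D) := by
  intro f d
  obtain ⟨K, -, hK⟩ := exists_modes_mem_Fil 𝕜 f d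
  obtain ⟨K', hK'⟩ := exists_currents_mem_Fil 𝕜 f d
  have hfin : {i : ℕ+ | ((i : ℕ) : ℤ) ≤ max (max K (K' - N + 1)) (N + 1)}.Finite := by
    refine (Set.finite_Iic (posIdx (max (max K (K' - N + 1)) (N + 1)))).subset fun i hi => ?_
    have h1 := one_le_coe i
    have h2 := coe_posIdx (k := max (max K (K' - N + 1)) (N + 1)) (lt_of_lt_of_le h1 hi)
    rw [Set.mem_Iic]
    have h3 : ((i : ℕ) : ℤ) ≤ ((posIdx (max (max K (K' - N + 1)) (N + 1)) : ℕ+) : ℕ) :=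
      le_of_le_of_eq hi h2.symm
    exact_mod_cast h3
  refine ((hfin.image Sum.inl).union (hfin.image Sum.inr)).subset fun a ha => ?_
  by_contra hcon
  apply ha
  rcases a with i | i
  · have hi : ¬ ((i : ℕ) : ℤ) ≤ max (max K (K' - N + 1)) (N + 1) :=
      fun h => hcon (Or.inl ⟨i, h, rfl⟩)
    rw [Set.mem_ofPred_eq, airyVal_inl, airyH_eq (one_le_coe i), if_neg (by omega), add_zero]
    exact add_mem (hK _ (by omega)).1 (hK' _ (by omega)).1
  · have hi : ¬ ((i : ℕ) : ℤ) ≤ max (max K (K' - N + 1)) (N + 1) :=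
      fun h => hcon (Or.inr ⟨i, h, rfl⟩)
    rw [Set.mem_ofPred_eq, airyVal_inr, airyF_eq (one_le_coe i)]
    exact add_mem (hK _ (by omega)).2 (hK' _ (by omega)).2

theorem airyVal_mem (a : ℕ+ ⊕ ℕ+) : airyVal N D a ∈ weylAlg 𝕜 ℕ+ (WithBot ℕ+) := by
  rcases a with i | j
  exacts [airyH_mem _, airyF_mem _]

/-- The number of a basis variable. -/
def varNum : ℕ+ ⊕ ℕ+ → ℤ := Sum.elim (fun i => (i : ℕ)) fun j => (j : ℕ)

theorem superComm_airyVal (hN : -1 ≤ N) (a b : ℕ+ ⊕ ℕ+) : ∃ (c : ℕ+ ⊕ ℕ+) (t : 𝕜),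
    superComm (airyVal N D a) (airyVal N D b) = hbar 𝕜 * (t • airyVal N D c) ∧
      varNum a + varNum b ≤ varNum c + 2 := by
  have hpos : ∀ k : ℤ, k ≤ ((posIdx k : ℕ+) : ℕ) := by
    intro k
    rcases lt_or_ge 0 k with h | h
    · exact (coe_posIdx h).ge
    · have := one_le_coe (posIdx k); omega
  have hH : ∀ (t : 𝕜) (k : ℤ), (k ≤ 0 → t = 0) →
      t • airyH 𝕜 N D k = t • airyVal N D (Sum.inl (posIdx k)) := by
    intro t k h
    rcases lt_or_ge 0 k with hk | hk
    · rw [airyVal_inl, coe_posIdx hk]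
    · rw [h hk, zero_smul, zero_smul]
  have hF : ∀ (t : 𝕜) (k : ℤ), (k ≤ 0 → t = 0) →
      t • airyF 𝕜 N k = t • airyVal N D (Sum.inr (posIdx k)) := by
    intro t k h
    rcases lt_or_ge 0 k with hk | hk
    · rw [airyVal_inr, coe_posIdx hk]
    · rw [h hk, zero_smul, zero_smul]
  have hHF : ∀ i j : ℕ+, ∃ (t : 𝕜), superComm (airyH 𝕜 N D (i : ℕ)) (airyF 𝕜 N (j : ℕ))
      = hbar 𝕜 * (t • airyVal N D (Sum.inr (posIdx ((i : ℕ) + (j : ℕ) + N - 1)))) := by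
    intro i j
    have hi := one_le_coe i
    have hj := one_le_coe j
    refine ⟨_, (superComm_airyH_airyF hN hi hj).trans (congrArg _ (hF _ _ fun h => ?_))⟩
    have h1 : ((i : ℕ) : ℤ) = 1 := by omega
    have h2 : ((j : ℕ) : ℤ) = 1 := by omega
    have h3 : N = -1 := by omega
    rw [h1, h2, h3]
    push_cast; ring
  rcases a with i | i <;> rcases b with j | j
  · have hi := one_le_coe i
    have hj := one_le_coe j
    refine ⟨Sum.inl (posIdx ((i : ℕ) + (j : ℕ) + N - 1)), _,
      (superComm_airyH_airyH hN hi hj).trans (congrArg _ (hH _ _ fun h => ?_)), ?_⟩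
    · have h1 : ((i : ℕ) : ℤ) = 1 := by omega
      have h2 : ((j : ℕ) : ℤ) = 1 := by omega
      rw [h1, h2, sub_self]
    · have := hpos ((i : ℕ) + (j : ℕ) + N - 1)
      simp only [varNum, Sum.elim_inl]
      omega
  · obtain ⟨t, h⟩ := hHF i j
    refine ⟨_, t, h, ?_⟩
    have := hpos ((i : ℕ) + (j : ℕ) + N - 1)
    simp only [varNum, Sum.elim_inl, Sum.elim_inr]
    omega
  · obtain ⟨t, h⟩ := hHF j i
    refine ⟨Sum.inr (posIdx ((j : ℕ) + (i : ℕ) + N - 1)), -t,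
      (superComm_swap (hasParity_airyH _) (hasParity_airyF _)).trans ?_, ?_⟩
    · rw [h, neg_smul, mul_neg]
      rfl
    · have := hpos ((j : ℕ) + (i : ℕ) + N - 1)
      simp only [varNum, Sum.elim_inl, Sum.elim_inr]
      omega
  · have hi := one_le_coe i
    have hj := one_le_coe j
    refine ⟨Sum.inl (posIdx ((i : ℕ) + (j : ℕ) + N)), _,
      (superComm_airyF_airyF hN hi hj).trans (congrArg _ (hH _ _ fun h => ?_)), ?_⟩
    · omega
    · have := hpos ((i : ℕ) + (j : ℕ) + N)
      simp only [varNum, Sum.elim_inl, Sum.elim_inr]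
      omega

theorem finite_varNum_le (M : ℤ) : {a : ℕ+ ⊕ ℕ+ | varNum a ≤ M}.Finite := by
  have hfin : {i : ℕ+ | ((i : ℕ) : ℤ) ≤ M}.Finite := by
    refine (Set.finite_Iic (posIdx M)).subset fun i hi => ?_
    have h1 := one_le_coe i
    have h2 := coe_posIdx (k := M) (lt_of_lt_of_le h1 hi)
    rw [Set.mem_Iic]
    have h3 : ((i : ℕ) : ℤ) ≤ ((posIdx M : ℕ+) : ℕ) := le_of_le_of_eq hi h2.symm
    exact_mod_cast h3
  refine ((hfin.image Sum.inl).union (hfin.image Sum.inr)).subset ?_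
  rintro (i | i) h
  exacts [Or.inl ⟨i, h, rfl⟩, Or.inr ⟨i, h, rfl⟩]

theorem one_le_varNum (a : ℕ+ ⊕ ℕ+) : 1 ≤ varNum a := by
  rcases a with i | i
  exacts [one_le_coe i, one_le_coe i]

variable (N D) in
/-- The super quantum Airy structure. -/
noncomputable def airyMap : DualSp 𝕜 ℕ+ ℕ+ →ₗ[𝕜] TwOp 𝕜 := (isNull_airyVal (N := N) (D := D)).dualMap

theorem airyMap_comm (hN : -1 ≤ N) (φ ψ : DualSp 𝕜 ℕ+ ℕ+) :
    ∃ χ, superComm (airyMap N D φ) (airyMap N D ψ) = hbar 𝕜 * airyMap N D χ := by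
  choose idx t h hle using superComm_airyVal (𝕜 := 𝕜) (D := D) hN
  refine isNull_airyVal.superComm_dualMap airyVal_mem idx t h (fun c => ?_) φ ψ
  refine ((finite_varNum_le (varNum c + 1)).prod (finite_varNum_le (varNum c + 1))).subset ?_
  rintro ⟨a, b⟩ rfl
  have h1 := hle a b
  have h2 := one_le_varNum a
  have h3 := one_le_varNum b
  constructor
  · change varNum a ≤ varNum (idx a b) + 1
    omega
  · change varNum b ≤ varNum (idx a b) + 1
    omega

theorem isSuperQuantumAiryStructure_airyMap (hN : -1 ≤ N) :
    IsSuperQuantumAiryStructure (airyMap N D) := by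
  have hmem : ∀ φ, airyMap N D φ ∈ weylHat 𝕜 ℕ+ (WithBot ℕ+) := fun φ =>
    hasSum_mem_weylAlg 𝕜 (isNull_airyVal.hasSum φ) fun a =>
      Subalgebra.smul_mem _ (airyVal_mem a) _
  have heven : ∀ φ : DualSp 𝕜 ℕ+ ℕ+, φ.IsEven → IsEvenOp (airyMap N D φ) := fun φ hφ =>
    isEvenOp_iff.mpr (HasParity.hasSum (isNull_airyVal.hasSum φ) fun a => by
      rcases a with i | j
      · exact (hasParity_airyH _).smul _
      · rw [hφ j, zero_smul]; exact HasParity.zero)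
  have hodd : ∀ φ : DualSp 𝕜 ℕ+ ℕ+, φ.IsOdd → IsOddOp (airyMap N D φ) := fun φ hφ =>
    isOddOp_iff.mpr (HasParity.hasSum (isNull_airyVal.hasSum φ) fun a => by
      rcases a with i | j
      · rw [hφ i, zero_smul]; exact HasParity.zero
      · exact (hasParity_airyF _).smul _)
  refine ⟨hmem, isNull_airyVal.continuous_dualMap, heven, hodd,
    leftIdeal_involutive hmem heven hodd (airyMap_comm hN), fun a => ?_⟩
  rw [airyMap, isNull_airyVal.dualMap_dualBasis]
  rcases a with i | j
  · rw [airyVal_inl, airyH, add_assoc, dxVar, posIdx_coe]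
    refine truncLE_one_of_raisesDeg (Sum.inl i) ((raisesDeg_virasoroL _).add ?_)
    split_ifs
    exacts [raisesDeg_hbar.smul _, RaisesDeg.zero]
  · rw [airyVal_inr, airyF, dthetaVar, posIdx_coe]
    exact truncLE_one_of_raisesDeg (Sum.inr (j : WithBot ℕ+)) (raisesDeg_superG _)

end AiryStructureProof

section ExtraVariable

variable {𝕜 : Type*} [RCLike 𝕜] {N : ℤ}

theorem bMode_ne_zero (k : ℤ) : bMode 𝕜 k ≠ 0 := by
  intro h0
  have h1 := superComm_bMode_bMode 𝕜 k (1 - k)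
  rw [h0, superComm_zero_left, if_pos (by ring)] at h1
  have hk : (k : 𝕜) - 1 / 2 ≠ 0 := by
    intro h
    have h2 : ((2 * k : ℤ) : 𝕜) = ((1 : ℤ) : 𝕜) := by
      push_cast
      linear_combination 2 * h
    have h3 : 2 * k = 1 := Int.cast_injective h2
    omega
  have h4 : hbar 𝕜 * (1 : TwOp 𝕜) = hbar 𝕜 * 0 := by
    rw [mul_one, mul_zero]
    exact (smul_eq_zero_iff_right hk).mp h1.symm
  have h5 := congrArg (fun T : TwOp 𝕜 => (T (vac 𝕜)).coeff ⟨0, 0, ∅⟩) (hbar_mul_cancel h4)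
  rw [vac] at h5
  simp [monoSer_coeff] at h5

theorem theta0_eq : theta0 𝕜
    = (1 / 2 : 𝕜) • (((Real.sqrt 2 : ℝ) : 𝕜) • psiMode 𝕜 0 + chiMode 𝕜) := by
  rw [psiMode_zero, smul_smul, mul_inv_cancel₀ (sqrt_two_ne_zero), one_smul, chiMode, theta0,
    show (mulVar 𝕜 (Sum.inr ⊥) + hbar 𝕜 * derVar 𝕜 (Sum.inr ⊥)
      + (mulVar 𝕜 (Sum.inr ⊥) - hbar 𝕜 * derVar 𝕜 (Sum.inr ⊥)) : TwOp 𝕜)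
      = (2 : 𝕜) • mulVar 𝕜 (Sum.inr ⊥) by rw [two_smul]; abel, smul_smul]
  norm_num

theorem superComm_airyF_theta0_ne_zero {j : ℤ} (hj : 1 ≤ j) :
    superComm (airyF 𝕜 N j) (theta0 𝕜) ≠ 0 := by
  rw [theta0_eq, superComm_smul_right, superComm_add_right, superComm_smul_right,
    superComm_airyF_psiMode hj, superComm_airyF_chiMode hj, add_zero, bShift,
    if_neg (by omega), add_zero, smul_smul]
  refine smul_ne_zero (mul_ne_zero (by norm_num) (sqrt_two_ne_zero)) fun h => ?_
  exact bMode_ne_zero (𝕜 := 𝕜) (j + N + 0) (hbar_mul_cancel (h.trans (mul_zero _).symm))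

end ExtraVariable

section BosonicPart

variable {𝕜 : Type*} [RCLike 𝕜] {N : ℤ} {D : ℤ → 𝕜}

theorem hbar_mul_dxVar_mul (k l : ℤ) :
    hbar 𝕜 * dxVar 𝕜 k * (hbar 𝕜 * dxVar 𝕜 l) = hbar 𝕜 ^ 2 * dxVar 𝕜 k * dxVar 𝕜 l := by
  have h : hbar 𝕜 * dxVar 𝕜 k = dxVar 𝕜 k * hbar 𝕜 := (hbar_commute_derVar 𝕜 _).eq
  rw [← mul_assoc, mul_assoc (hbar 𝕜) (dxVar 𝕜 k) (hbar 𝕜), ← h, ← mul_assoc, pow_two]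

theorem xVar_mul_hbar_mul_dxVar (k l : ℤ) :
    xVar 𝕜 k * (hbar 𝕜 * dxVar 𝕜 l) = hbar 𝕜 * xVar 𝕜 k * dxVar 𝕜 l := by
  have h : hbar 𝕜 * xVar 𝕜 k = xVar 𝕜 k * hbar 𝕜 := (hbar_commute_mulVar 𝕜 _).eq
  rw [h, mul_assoc]

variable (𝕜) in
/-- The summands with one creation and one annihilation operator, ordered by the latter. -/
noncomputable def bosonCross (m k : ℤ) : TwOp 𝕜 :=
  if 1 ≤ k ∧ m + 1 ≤ k then bMode 𝕜 (m + 1 - k) * bMode 𝕜 k else 0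

variable (𝕜) in
/-- The summands with two annihilation operators. -/
noncomputable def bosonPos (m k : ℤ) : TwOp 𝕜 :=
  if 1 ≤ k ∧ k ≤ m then hbar 𝕜 ^ 2 * dxVar 𝕜 k * dxVar 𝕜 (m + 1 - k) else 0

variable (𝕜) in
/-- The summand with two creation operators. -/
noncomputable def bosonNeg (m : ℤ) : TwOp 𝕜 :=
  if m = -1 then (1 / 4 : 𝕜) • xVar 𝕜 1 ^ 2 else 0

theorem bosonTerm_eq {m : ℤ} (hm : -1 ≤ m) (k : ℤ) : bosonTerm 𝕜 m k
    = bosonPos 𝕜 m k + (bosonCross 𝕜 m k + bosonCross 𝕜 m (m + 1 - k))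
      + if k = 0 then bosonNeg 𝕜 m else 0 := by
  rw [bosonTerm, bNormal, bosonPos, bosonCross, bosonCross, bosonNeg]
  rcases lt_or_ge 0 k with hk | hk <;> rcases lt_or_ge 0 (m + 1 - k) with hl | hl
  · rw [if_neg (by omega), if_pos (by omega), if_neg (by omega), if_neg (by omega),
      if_neg (by omega), bMode_of_pos 𝕜 hk, bMode_of_pos 𝕜 hl, add_zero, add_zero, add_zero]
    exact hbar_mul_dxVar_mul k _
  · rw [if_pos (by omega), if_neg (by omega), if_pos (by omega), if_neg (by omega),
      if_neg (by omega), add_zero, add_zero, zero_add]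
  · rw [if_neg (by omega), if_neg (by omega), if_neg (by omega), if_pos (by omega),
      sub_sub_cancel, zero_add, zero_add, left_eq_add]
    split_ifs
    · omega
    · rfl
    · rfl
  · obtain rfl : k = 0 := by omega
    obtain rfl : m = -1 := by omega
    rw [if_neg (by omega), if_neg (by omega), if_neg (by omega), if_neg (by omega),
      if_pos rfl, if_pos rfl, show (-1 + 1 - 0 : ℤ) = 0 by norm_num, bMode_of_nonpos 𝕜 le_rfl,
      smul_mul_smul_comm, pow_two, Int.cast_zero, sub_zero, add_zero, add_zero, zero_add]
    change _ • (xVar 𝕜 (1 - 0) * xVar 𝕜 (1 - 0)) = _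
    rw [sub_zero]
    congr 1
    norm_num

theorem summable_bosonCross (m : ℤ) : Summable (bosonCross 𝕜 m) :=
  summable_of_cofinite fun f d => by
    obtain ⟨K, hK⟩ := exists_bosonTerm_mem_Fil 𝕜 f d
    refine (Set.finite_Ioo 0 K).subset fun k hk => ?_
    by_contra h
    refine hk ?_
    change bosonCross 𝕜 m k f ∈ Fil 𝕜 ℕ+ (WithBot ℕ+) d
    simp only [Set.mem_Ioo] at h
    rw [bosonCross]
    split_ifs with h1
    · have h2 := hK m k (by omega)
      rwa [bosonTerm, bNormal, if_pos (by omega)] at h2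
    · exact zero_mem (Fil 𝕜 ℕ+ (WithBot ℕ+) d)

theorem bosonCross_add_self (m k : ℤ) : bosonCross 𝕜 m k + bosonCross 𝕜 m k
    = if 1 ≤ k ∧ m + 1 ≤ k then
      (2 * (k : 𝕜) - 2 * m - 1) • (hbar 𝕜 * xVar 𝕜 (k - m) * dxVar 𝕜 k) else 0 := by
  rw [bosonCross]
  split_ifs with h
  · have h1 : bMode 𝕜 (m + 1 - k) = ((1 / 2 : 𝕜) - (m + 1 - k : ℤ)) • xVar 𝕜 (k - m) := by
      rw [bMode, if_neg (by omega), show 1 - (m + 1 - k) = k - m by ring]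
    have h2 : bMode 𝕜 k = hbar 𝕜 * dxVar 𝕜 k := by rw [bMode, if_pos (by omega)]
    rw [h1, h2, smul_mul_assoc, ← add_smul, xVar_mul_hbar_mul_dxVar]
    congr 1
    push_cast; ring
  · exact add_zero 0

theorem tsum_bosonTerm {m : ℤ} (hm : -1 ≤ m) : ∑' k, bosonTerm 𝕜 m k
    = ∑ k ∈ Finset.Icc 1 m, hbar 𝕜 ^ 2 * dxVar 𝕜 k * dxVar 𝕜 (m + 1 - k)
      + (∑' k : ℤ, if 1 ≤ k ∧ m + 1 ≤ k then
          (2 * (k : 𝕜) - 2 * m - 1) • (hbar 𝕜 * xVar 𝕜 (k - m) * dxVar 𝕜 k) else 0)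
      + if m = -1 then (1 / 4 : 𝕜) • xVar 𝕜 1 ^ 2 else 0 := by
  have hQ := summable_bosonCross (𝕜 := 𝕜) m
  have hP : HasSum (bosonPos 𝕜 m) (∑ k ∈ Finset.Icc 1 m, bosonPos 𝕜 m k) :=
    hasSum_sum_of_ne_finset_zero fun k hk => if_neg fun h => hk (Finset.mem_Icc.mpr h)
  have hQr : HasSum (bosonCross 𝕜 m ∘ Equiv.subLeft (m + 1)) (∑' k, bosonCross 𝕜 m k) :=
    (Equiv.hasSum_iff _).mpr hQ.hasSum
  have hR : HasSum (fun k : ℤ => if k = 0 then bosonNeg 𝕜 m else 0) (bosonNeg 𝕜 m) :=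
    hasSum_ite_eq 0 _
  have hB := (hP.add (hQ.hasSum.add hQr)).add hR
  rw [(tsum_congr (bosonTerm_eq hm)).trans hB.tsum_eq, ← hQ.tsum_add hQ, tsum_congr (bosonCross_add_self m), bosonNeg]
  congr 2
  refine Finset.sum_congr rfl fun k hk => ?_
  rw [bosonPos, if_pos (Finset.mem_Icc.mp hk)]

theorem airyH_neg_one {i : ℤ} (hi : 1 ≤ i) : airyH 𝕜 (-1) D i
    = kwOp 𝕜 i + (if i = 2 then (1 / 16 : 𝕜) • hbar 𝕜 else 0) + fermionPart 𝕜 (i - 2) := by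
  rw [airyH, if_neg (by omega), add_zero, virasoroL, kwOp, show i + -1 - 1 = i - 2 by ring,
    tsum_bosonTerm (by omega), smul_add, smul_add]
  have h1 : (1 / 2 : 𝕜) • (if i - 2 = -1 then (1 / 4 : 𝕜) • xVar 𝕜 1 ^ 2 else 0)
      = if i = 1 then (1 / 8 : 𝕜) • xVar 𝕜 1 ^ 2 else 0 := by
    by_cases h : i = 1
    · rw [if_pos (by omega), if_pos h, smul_smul]; norm_num
    · rw [if_neg (by omega), if_neg h, smul_zero]
  have h2 : (if i - 2 = 0 then (1 / 8 : 𝕜) • hbar 𝕜 else 0 : TwOp 𝕜)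
      = (if i = 2 then (1 / 16 : 𝕜) • hbar 𝕜 else 0)
        + if i = 2 then (1 / 16 : 𝕜) • hbar 𝕜 else 0 := by
    by_cases h : i = 2
    · rw [if_pos (by omega), if_pos h, ← add_smul]; norm_num
    · rw [if_neg (by omega), if_neg h, add_zero]
  have h3 : ∀ k : ℤ, (if 1 ≤ k ∧ i - 2 + 1 ≤ k then (2 * (k : 𝕜) - 2 * (i - 2 : ℤ) - 1) •
        (hbar 𝕜 * xVar 𝕜 (k - (i - 2)) * dxVar 𝕜 k) else 0)
      = if 1 ≤ k ∧ i - 1 ≤ k then (2 * (k : 𝕜) - 2 * (i : 𝕜) + 3) •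
        (hbar 𝕜 * xVar 𝕜 (k - i + 2) * dxVar 𝕜 k) else 0 := by
    intro k
    rw [show i - 2 + 1 = i - 1 by ring, show k - (i - 2) = k - i + 2 by ring,
      show 2 * (k : 𝕜) - 2 * (i - 2 : ℤ) - 1 = 2 * (k : 𝕜) - 2 * (i : 𝕜) + 3 by push_cast; ring]
  rw [h1, h2, tsum_congr h3, show i - 2 + 1 = i - 1 by ring]
  abel

theorem airyH_zero {i : ℤ} (hi : 1 ≤ i) : airyH 𝕜 0 D i
    = bgwOp 𝕜 i + (if i = 1 then ((1 / 16 : 𝕜) + D 1) • hbar 𝕜 else 0)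
      + fermionPart 𝕜 (i - 1) := by
  rw [airyH, virasoroL, bgwOp, add_zero, tsum_bosonTerm (by omega), if_neg (by omega), add_zero,
    smul_add]
  have h2 : (if i - 1 = 0 then (1 / 8 : 𝕜) • hbar 𝕜 else 0 : TwOp 𝕜)
        + (if i ≤ 0 + 1 then D i • hbar 𝕜 else 0)
      = (if i = 1 then (1 / 16 : 𝕜) • hbar 𝕜 else 0)
        + if i = 1 then ((1 / 16 : 𝕜) + D 1) • hbar 𝕜 else 0 := by
    by_cases h : i = 1
    · rw [if_pos (by omega), if_pos (by omega), if_pos h, if_pos h, h, ← add_smul, ← add_smul]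
      congr 1
      ring
    · rw [if_neg (by omega), if_neg (by omega), if_neg h, if_neg h]
  have h3 : ∀ k : ℤ, (if 1 ≤ k ∧ i - 1 + 1 ≤ k then (2 * (k : 𝕜) - 2 * (i - 1 : ℤ) - 1) •
        (hbar 𝕜 * xVar 𝕜 (k - (i - 1)) * dxVar 𝕜 k) else 0)
      = if i ≤ k then (2 * (k : 𝕜) - 2 * (i : 𝕜) + 1) •
        (hbar 𝕜 * xVar 𝕜 (k - i + 1) * dxVar 𝕜 k) else 0 := by
    intro k
    rw [show k - (i - 1) = k - i + 1 by ring,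
      show 2 * (k : 𝕜) - 2 * (i - 1 : ℤ) - 1 = 2 * (k : 𝕜) - 2 * (i : 𝕜) + 1 by push_cast; ring]
    by_cases h : i ≤ k
    · rw [if_pos h, if_pos (by omega)]
    · rw [if_neg h, if_neg (by omega)]
  rw [tsum_congr h3, sub_add_cancel, ← add_assoc, add_assoc _ _ (if i ≤ 0 + 1 then _ else _), h2]
  abel

end BosonicPart

section SuperVirasoro

variable {𝕜 : Type*} [RCLike 𝕜] {N : ℤ} {D : ℤ → 𝕜}

theorem single_mem_svirSub {u : SVirBasis} {c : 𝕜} (h : u ∉ svirSub N → c = 0) :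
    Finsupp.single u c ∈ Finsupp.supported 𝕜 𝕜 (svirSub N) := by
  by_cases hu : u ∈ svirSub N
  · exact Finsupp.single_mem_supported 𝕜 c hu
  · rw [h hu, Finsupp.single_zero]; exact zero_mem _

theorem svirBracket_L_L (hN : -1 ≤ N) {m n : ℤ} (hm : N ≤ m) (hn : N ≤ n) :
    svirBracket (𝕜 := 𝕜) (.L m) (.L n) = Finsupp.single (.L (m + n)) ((m : 𝕜) - n) := by
  rw [svirBracket]
  split_ifs with h
  · have h1 : m = -1 ∨ m = 0 ∨ m = 1 := by omega
    rcases h1 with rfl | rfl | rfl <;> norm_num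
  · rw [Finsupp.single_zero, add_zero]

theorem svirBracket_G_G (hN : -1 ≤ N) {j k : ℤ} (hj : N + 1 ≤ j) (hk : N + 1 ≤ k) :
    svirBracket (𝕜 := 𝕜) (.G j) (.G k) = Finsupp.single (.L (j + k - 1)) 2 := by
  rw [svirBracket]
  split_ifs with h
  · have h1 : j = 0 ∨ j = 1 := by omega
    rcases h1 with rfl | rfl <;> norm_num
  · rw [Finsupp.single_zero, add_zero]

theorem svirBracket_mem_supported (hN : -1 ≤ N) {u v : SVirBasis} (hu : u ∈ svirSub N)
    (hv : v ∈ svirSub N) : svirBracket u v ∈ Finsupp.supported 𝕜 𝕜 (svirSub N) := by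
  have key : ∀ n j : ℤ, N ≤ n → N + 1 ≤ j →
      Finsupp.single (.G (n + j)) ((n : 𝕜) / 2 - ((j : 𝕜) - 1 / 2))
        ∈ Finsupp.supported 𝕜 𝕜 (svirSub N) := by
    intro n j hn hj
    refine single_mem_svirSub fun h => ?_
    replace h : ¬ N + 1 ≤ n + j := h
    obtain rfl : n = -1 := by omega
    obtain rfl : j = 0 := by omega
    push_cast; ring
  rcases u with m | j | _ <;> rcases v with n | k | _
  · rw [svirBracket_L_L hN hu hv]
    refine single_mem_svirSub fun h => ?_
    replace hu : N ≤ m := hu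
    replace hv : N ≤ n := hv
    replace h : ¬ N ≤ m + n := h
    obtain rfl : n = -1 := by omega
    obtain rfl : m = -1 := by omega
    exact sub_self _
  · exact key m k hu hv
  · exact hv.elim
  · exact neg_mem (key n j hv hu)
  · rw [svirBracket_G_G hN hu hv]
    refine single_mem_svirSub fun h => ?_
    replace hu : N + 1 ≤ j := hu
    replace hv : N + 1 ≤ k := hv
    replace h : ¬ N ≤ j + k - 1 := h
    omega
  · exact hv.elim
  all_goals exact hu.elim

theorem superComm_svirMap (hN : -1 ≤ N) {u v : SVirBasis} (hu : u ∈ svirSub N)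
    (hv : v ∈ svirSub N) : superComm (svirMap 𝕜 N D u) (svirMap 𝕜 N D v)
      = hbar 𝕜 * Finsupp.linearCombination 𝕜 (svirMap 𝕜 N D) (svirBracket u v) := by
  have key : ∀ n j : ℤ, N ≤ n → N + 1 ≤ j →
      superComm (svirMap 𝕜 N D (.L n)) (svirMap 𝕜 N D (.G j))
        = hbar 𝕜 * Finsupp.linearCombination 𝕜 (svirMap 𝕜 N D)
          (Finsupp.single (.G (n + j)) ((n : 𝕜) / 2 - ((j : 𝕜) - 1 / 2))) := by
    intro n j hn hj
    rw [svirMap, svirMap, superComm_airyH_airyF hN (by omega) (by omega),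
      Finsupp.linearCombination_single, svirMap,
      show n - N + 1 + (j - N) + N - 1 = n + j - N by ring]
    congr 2
    push_cast; ring
  rcases u with m | j | _ <;> rcases v with n | k | _
  · replace hu : N ≤ m := hu
    replace hv : N ≤ n := hv
    rw [svirBracket_L_L hN hu hv, svirMap, svirMap,
      superComm_airyH_airyH hN (by omega) (by omega),
      Finsupp.linearCombination_single, svirMap,
      show m - N + 1 + (n - N + 1) + N - 1 = m + n - N + 1 by ring]
    congr 2
    push_cast; ring
  · exact key m k hu hv
  · exact hv.elim
  · rw [svirBracket, map_neg, mul_neg, ← key n j hv hu]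
    exact superComm_swap (hasParity_airyH _) (hasParity_airyF _)
  · replace hu : N + 1 ≤ j := hu
    replace hv : N + 1 ≤ k := hv
    rw [svirBracket_G_G hN hu hv, svirMap, svirMap,
      superComm_airyF_airyF (D := D) hN (by omega) (by omega),
      Finsupp.linearCombination_single, svirMap,
      show j - N + (k - N) + N = j + k - 1 - N + 1 by ring]
  · exact hv.elim
  all_goals exact hu.elim

end SuperVirasoro

end SuperAiry

theorem mainTheorem12 {𝕜 : Type*} [RCLike 𝕜] (N : ℤ) (hN : -1 ≤ N) (D : ℤ → 𝕜) :
    -- the mode sums converge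
    (∀ m : ℤ, Summable (SuperAiry.bosonTerm 𝕜 m) ∧ Summable (SuperAiry.fermionTerm 𝕜 m)
      ∧ Summable (SuperAiry.superTerm 𝕜 m)) ∧
    -- the modes represent the super Heisenberg algebra
    (∀ k l : ℤ, SuperAiry.superComm (SuperAiry.bMode 𝕜 k) (SuperAiry.bMode 𝕜 l)
        = if k + l = 1 then ((k : 𝕜) - 1 / 2) • SuperAiry.hbar 𝕜 else 0) ∧
    (∀ m n : ℤ, SuperAiry.superComm (SuperAiry.psiMode 𝕜 m) (SuperAiry.psiMode 𝕜 n)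
        = if m + n = 0 then SuperAiry.hbar 𝕜 else 0) ∧
    (∀ k n : ℤ, SuperAiry.superComm (SuperAiry.bMode 𝕜 k) (SuperAiry.psiMode 𝕜 n) = 0) ∧
    -- the super quantum Airy structure, which is determined by its values on the dual set
    (∃ H : SuperAiry.DualSp 𝕜 ℕ+ ℕ+ →ₗ[𝕜] SuperAiry.TwOp 𝕜,
      SuperAiry.IsSuperQuantumAiryStructure H ∧
      (∀ i : ℕ+, H (SuperAiry.dualBasis (Sum.inl i)) = SuperAiry.airyH 𝕜 N D (i : ℕ)) ∧
      (∀ j : ℕ+, H (SuperAiry.dualBasis (Sum.inr j)) = SuperAiry.airyF 𝕜 N (j : ℕ)) ∧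
      ∀ H' : SuperAiry.DualSp 𝕜 ℕ+ ℕ+ →ₗ[𝕜] SuperAiry.TwOp 𝕜, Continuous H' →
        (∀ a : ℕ+ ⊕ ℕ+, H' (SuperAiry.dualBasis a) = H (SuperAiry.dualBasis a)) → H' = H) ∧
    -- the commutation relations
    (∀ m n : ℤ, 1 ≤ m → 1 ≤ n →
      SuperAiry.superComm (SuperAiry.airyH 𝕜 N D m) (SuperAiry.airyH 𝕜 N D n)
        = SuperAiry.hbar 𝕜 * (((m : 𝕜) - n) • SuperAiry.airyH 𝕜 N D (m + n + N - 1))) ∧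
    (∀ m j : ℤ, 1 ≤ m → 1 ≤ j →
      SuperAiry.superComm (SuperAiry.airyH 𝕜 N D m) (SuperAiry.airyF 𝕜 N j)
        = SuperAiry.hbar 𝕜 * ((((m : 𝕜) - N - 1) / 2 - ((j : 𝕜) - 1 / 2)) •
            SuperAiry.airyF 𝕜 N (m + j + N - 1))) ∧
    (∀ j k : ℤ, 1 ≤ j → 1 ≤ k →
      SuperAiry.superComm (SuperAiry.airyF 𝕜 N j) (SuperAiry.airyF 𝕜 N k)
        = SuperAiry.hbar 𝕜 * ((2 : 𝕜) • SuperAiry.airyH 𝕜 N D (j + k + N))) ∧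
    -- they are those of a subalgebra of the super Virasoro algebra in the Neveu-Schwarz sector
    (∀ u ∈ SuperAiry.svirSub N, ∀ v ∈ SuperAiry.svirSub N,
      SuperAiry.svirBracket u v ∈ Finsupp.supported 𝕜 𝕜 (SuperAiry.svirSub N) ∧
      SuperAiry.superComm (SuperAiry.svirMap 𝕜 N D u) (SuperAiry.svirMap 𝕜 N D v)
        = SuperAiry.hbar 𝕜 * Finsupp.linearCombination 𝕜 (SuperAiry.svirMap 𝕜 N D)
            (SuperAiry.svirBracket u v)) ∧
    -- the extra odd variable does occur
    (∀ j : ℤ, 1 ≤ j →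
      SuperAiry.superComm (SuperAiry.airyF 𝕜 N j) (SuperAiry.theta0 𝕜) ≠ 0) ∧
    -- the bosonic parts for `N = -1` and `N = 0`
    (N = -1 → ∀ i : ℤ, 1 ≤ i → SuperAiry.airyH 𝕜 N D i
      = SuperAiry.kwOp 𝕜 i + (if i = 2 then (1 / 16 : 𝕜) • SuperAiry.hbar 𝕜 else 0)
        + SuperAiry.fermionPart 𝕜 (i - 2)) ∧
    (N = 0 → ∀ i : ℤ, 1 ≤ i → SuperAiry.airyH 𝕜 N D i
      = SuperAiry.bgwOp 𝕜 i
        + (if i = 1 then ((1 / 16 : 𝕜) + D 1) • SuperAiry.hbar 𝕜 else 0)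
        + SuperAiry.fermionPart 𝕜 (i - 1)) := by
  have hnull := SuperAiry.isNull_airyVal (N := N) (D := D)
  refine ⟨fun m => ⟨SuperAiry.summable_bosonTerm 𝕜 m, SuperAiry.summable_fermionTerm 𝕜 m,
      SuperAiry.summable_superTerm 𝕜 m⟩, SuperAiry.superComm_bMode_bMode 𝕜,
    SuperAiry.superComm_psiMode_psiMode 𝕜, SuperAiry.superComm_bMode_psiMode 𝕜,
    ⟨SuperAiry.airyMap N D, SuperAiry.isSuperQuantumAiryStructure_airyMap hN,
      fun i => hnull.dualMap_dualBasis (Sum.inl i), fun j => hnull.dualMap_dualBasis (Sum.inr j),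
      fun H' hc h => hnull.eq_dualMap hc fun a => (h a).trans (hnull.dualMap_dualBasis a)⟩,
    fun _ _ => SuperAiry.superComm_airyH_airyH hN, fun _ _ => SuperAiry.superComm_airyH_airyF hN,
    fun _ _ => SuperAiry.superComm_airyF_airyF hN,
    fun _ hu _ hv => ⟨SuperAiry.svirBracket_mem_supported hN hu hv,
      SuperAiry.superComm_svirMap hN hu hv⟩,
    fun _ => SuperAiry.superComm_airyF_theta0_ne_zero, ?_, ?_⟩
  · rintro rfl i hi
    exact SuperAiry.airyH_neg_one hi
  · rintro rfl i hi
    exact SuperAiry.airyH_zero hi
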